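/- **Theorem 3.2 (Consistency of the estimators).** Let $p\ge 1$, and let $\Theta$ be the set of pairs $\theta=(\mu,\Sigma)$ with $\mu\in\mathbb R^p$ and $\Sigma$ a symmetric positive definite $p\times p$ matrix. Let $g:[0,\infty)\to[0,\infty)$ be nonincreasing and such that, for every $\theta=(\mu,\Sigma)\in\Theta$, $$f_\theta(x)=|\Sigma|^{-1/2}\,g\big((x-\mu)^T\Sigma^{-1}(x-\mu)\big)$$ is the Lebesgue density of a probability $\mathbb P_\theta$ on $\mathbb R^p$. Assume: - (G1) there is a strictly decreasing sequence $t_n\to 0$ with $g(t_n)<g(t_{n+1})$ for every $n$; - (G2) $g$ is continuous on $[0,\infty)$; - (Gp) if $p>1$, there is $\gamma>p/2$ with $\lim_{r\to\infty}r^\gamma g(r)=0$. An ellipsoid is a set $\{x\in\mathbb R^p:(x-\mu)^T\Sigma^{-1}(x-\mu)\le r^2\}$ with $(\mu,\Sigma)\in\Theta$ and $r>0$. A minimum volume ellipsoid (MVE) of a measure $\mathbb P$ is an ellipsoid $A$ with $\mathbb P(A)\ge 1/2$ whose volume is minimal among all ellipsoids with this property. Let $X_1,X_2,\dots$ be i.i.d.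 random vectors with law $$\mathbb P=(1-\pi_0)\mathbb P_{\theta_0}+\pi_0Q,\qquad 0\le\pi_0<1/2,\quad \theta_0\in\Theta,$$ in the gross error model, that is, $Q$ is a probability with $Q(A)=0$ for every MVE $A$ of $\mathbb P$. Assume that the MVE of $\mathbb P$ is unique. Let $P_n$ be the empirical measure of $X_1,\dots,X_n$, and let $A_n$ be empirical MVEs: almost surely, $A_n$ is an MVE of $P_n$ for all large $n$. Put $\log 0=-\infty$ and $0\cdot\infty=0$. Given $A_n$ and the sample: - an MLE(s) is a maximizer $(\hat\pi,\hat\theta)$ over $[0,1)\times\Theta$ of $P_n\big(I_{A_n}\log((1-\pi)f_\theta)+I_{A_n^c}\log((1-\pi)\mathbb P_\theta(A_n^c)+\pi)\big)$; - an MLE(c) is a maximizer over $\Theta$ of $P_n\big(I_{A_n}\log f_\theta+I_{A_n^c}\log\mathbb P_\theta(A_n^c)\big)$; - an MLE(r) at level $\alpha>0$ is a maximizer over $\{\theta\in\Theta:\mathbb P_\theta(A_n)\ge\alpha\}$ of $P_n\big(I_{A_n}\log(f_\theta/\mathbb P_\theta(A_n))\big)$. A sequence of such estimators means a sequence of random elements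 which, almost surely, are such maximizers for all large $n$. Then: 1. Every sequence $(\hat\pi_n,\hat\theta_n)$ of MLE(s) is strongly consistent: $\hat\pi_n\to\pi_0$ and $\hat\theta_n\to\theta_0$ a.s. 2. If $\pi_0=0$, every sequence $\hat\theta_{c,n}$ of MLE(c) is strongly consistent: $\hat\theta_{c,n}\to\theta_0$ a.s. 3. If $\alpha\in(0,1/2)$, every sequence $\hat\theta_{r,n}$ of MLE(r) at level $\alpha$ is strongly consistent: $\hat\theta_{r,n}\to\theta_0$ a.s. Moreover, $\dfrac{\mathbb P_{\hat\theta_{r,n}}(A_n)-P_n(A_n)}{\mathbb P_{\hat\theta_{r,n}}(A_n)}\to\pi_0$ a.s. -/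

import Mathlib

open MeasureTheory ProbabilityTheory Filter Topology
open scoped ENNReal Matrix

noncomputable section

namespace EllipticalGEM

/-- Location-scatter pairs `θ = (μ, Σ)`; the admissible ones are those in `paramSpace`. -/
abbrev Param (p : ℕ) : Type := (Fin p → ℝ) × Matrix (Fin p) (Fin p) ℝ

/-- The parameter space `Θ`: the scatter matrix is symmetric positive definite. -/
def paramSpace (p : ℕ) : Set (Param p) := {θ | θ.2.PosDef}

/-- The quadratic form `(x - μ)ᵀ Σ⁻¹ (x - μ)`. -/
def quadDist {p : ℕ} (θ : Param p) (x : Fin p → ℝ) : ℝ :=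
  (x - θ.1) ⬝ᵥ (θ.2⁻¹ *ᵥ (x - θ.1))

/-- The closed ellipsoid `{x : (x - μ)ᵀ Σ⁻¹ (x - μ) ≤ r²}`. -/
def ellipsoid {p : ℕ} (θ : Param p) (r : ℝ) : Set (Fin p → ℝ) :=
  {x | quadDist θ x ≤ r ^ 2}

/-- Nondegenerate closed ellipsoids, as sets. -/
def IsEllipsoid {p : ℕ} (A : Set (Fin p → ℝ)) : Prop :=
  ∃ θ ∈ paramSpace p, ∃ r : ℝ, 0 < r ∧ A = ellipsoid θ r

/-- `A` is a minimum volume ellipsoid (MVE) of `P`: it has the least Lebesgue measure among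
the ellipsoids of `P`-measure at least `1/2`. -/
def IsMVE {p : ℕ} (P : Measure (Fin p → ℝ)) (A : Set (Fin p → ℝ)) : Prop :=
  IsEllipsoid A ∧ (1 / 2 : ℝ≥0∞) ≤ P A ∧
    ∀ B, IsEllipsoid B → (1 / 2 : ℝ≥0∞) ≤ P B → volume A ≤ volume B

/-- The density `f_θ(x) = |Σ|^{-1/2} g((x - μ)ᵀ Σ⁻¹ (x - μ))`. -/
def density {p : ℕ} (g : ℝ → ℝ) (θ : Param p) (x : Fin p → ℝ) : ℝ :=
  (Real.sqrt θ.2.det)⁻¹ * g (quadDist θ x)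

/-- The measure `P_θ` with Lebesgue density `f_θ`. -/
def ellipticalMeasure {p : ℕ} (g : ℝ → ℝ) (θ : Param p) : Measure (Fin p → ℝ) :=
  volume.withDensity fun x => ENNReal.ofReal (density g θ x)

/-- `g`, of which only the values on `[0, ∞)` matter, is nonincreasing and nonnegative there and
defines an elliptical family of probability measures on `ℝ^p`. -/
structure IsEllipticalGenerator (p : ℕ) (g : ℝ → ℝ) : Prop where
  antitoneOn : AntitoneOn g (Set.Ici 0)
  nonneg : ∀ t, 0 ≤ t → 0 ≤ g t
  isProbabilityMeasure : ∀ θ ∈ paramSpace p, IsProbabilityMeasure (ellipticalMeasure g θ)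

/-- There are `t₀ > t₁ > ⋯` decreasing to `0` with `g(t_n) < g(t_{n+1})` for every `n`. -/
def CondG1 (g : ℝ → ℝ) : Prop :=
  ∃ t : ℕ → ℝ, StrictAnti t ∧ Tendsto t atTop (𝓝 0) ∧ ∀ n, g (t n) < g (t (n + 1))

/-- `g` is continuous on `[0, ∞)`. -/
def CondG2 (g : ℝ → ℝ) : Prop := ContinuousOn g (Set.Ici 0)

/-- If `p > 1`, then `r^γ g(r) → 0` as `r → ∞` for some `γ > p/2`. -/
def CondGp (p : ℕ) (g : ℝ → ℝ) : Prop :=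
  1 < p → ∃ γ : ℝ, (p : ℝ) / 2 < γ ∧ Tendsto (fun r : ℝ => r ^ γ * g r) atTop (𝓝 0)

/-- The mixture `(1 - π) P_θ + π Q`. -/
def contaminated {p : ℕ} (g : ℝ → ℝ) (π : ℝ) (θ : Param p) (Q : Measure (Fin p → ℝ)) :
    Measure (Fin p → ℝ) :=
  ENNReal.ofReal (1 - π) • ellipticalMeasure g θ + ENNReal.ofReal π • Q

/-- `(1 - π) P_θ + π Q` is in the gross error model: the contamination `Q` does not charge any
MVE of the mixture. The uncontaminated case `π = 0` is included. -/
structure IsGEM {p : ℕ} (g : ℝ → ℝ) (π : ℝ) (θ : Param p) (Q : Measure (Fin p → ℝ)) :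
    Prop where
  nonneg : 0 ≤ π
  lt_one : π < 1
  mem_paramSpace : θ ∈ paramSpace p
  isProbabilityMeasure : IsProbabilityMeasure Q
  null_of_isMVE : ∀ A, IsMVE (contaminated g π θ Q) A → Q A = 0

/-- The empirical measure `P_n` of `x₀, …, x_{n-1}`. -/
def empirical {p : ℕ} (x : ℕ → Fin p → ℝ) (n : ℕ) : Measure (Fin p → ℝ) :=
  (n : ℝ≥0∞)⁻¹ • ∑ i ∈ Finset.range n, Measure.dirac (x i)

/-- `P_n L`, the average of an extended-real valued function over `x₀, …, x_{n-1}`. -/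
def empiricalMean {p : ℕ} (x : ℕ → Fin p → ℝ) (n : ℕ) (L : (Fin p → ℝ) → EReal) : EReal :=
  (∑ i ∈ Finset.range n, L (x i)) / (n : EReal)

/-- Logarithm of a nonnegative real, with `log 0 = -∞`. -/
def elog (t : ℝ) : EReal := ENNReal.log (ENNReal.ofReal t)

/-- The smart log-likelihood `I_A log((1 - π) f_θ) + I_{Aᶜ} log((1 - π) P_θ(Aᶜ) + π)`. -/
def smartLogLik {p : ℕ} (g : ℝ → ℝ) (A : Set (Fin p → ℝ)) (π : ℝ) (θ : Param p)
    (x : Fin p → ℝ) : EReal :=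
  A.indicator (fun y => elog ((1 - π) * density g θ y)) x +
    Aᶜ.indicator (fun _ => elog ((1 - π) * (ellipticalMeasure g θ).real Aᶜ + π)) x

/-- The censored log-likelihood `I_A log f_θ + I_{Aᶜ} log P_θ(Aᶜ)`. -/
def censoredLogLik {p : ℕ} (g : ℝ → ℝ) (A : Set (Fin p → ℝ)) (θ : Param p)
    (x : Fin p → ℝ) : EReal :=
  A.indicator (fun y => elog (density g θ y)) x +
    Aᶜ.indicator (fun _ => elog ((ellipticalMeasure g θ).real Aᶜ)) x

open Classical in
/-- The truncated log-likelihood `I_A log(f_θ / P_θ(A))`, equal to `-∞` if `P_θ(A) = 0`. -/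
def truncatedLogLik {p : ℕ} (g : ℝ → ℝ) (A : Set (Fin p → ℝ)) (θ : Param p)
    (x : Fin p → ℝ) : EReal :=
  if ellipticalMeasure g θ A = 0 then ⊥
  else A.indicator (fun y => elog (density g θ y / (ellipticalMeasure g θ).real A)) x

/-- `(π, θ)` is an MLE(s) based on the set `A` and the sample `x₀, …, x_{n-1}`: it maximizes the
smart log-likelihood over `[0, 1) × Θ`. -/
def IsMLEs {p : ℕ} (g : ℝ → ℝ) (A : Set (Fin p → ℝ)) (x : ℕ → Fin p → ℝ) (n : ℕ)
    (π : ℝ) (θ : Param p) : Prop :=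
  π ∈ Set.Ico (0 : ℝ) 1 ∧ θ ∈ paramSpace p ∧
    ∀ π' ∈ Set.Ico (0 : ℝ) 1, ∀ θ' ∈ paramSpace p,
      empiricalMean x n (smartLogLik g A π' θ') ≤ empiricalMean x n (smartLogLik g A π θ)

/-- `θ` is an MLE(c): it maximizes the censored log-likelihood over `Θ`. -/
def IsMLEc {p : ℕ} (g : ℝ → ℝ) (A : Set (Fin p → ℝ)) (x : ℕ → Fin p → ℝ) (n : ℕ)
    (θ : Param p) : Prop :=
  θ ∈ paramSpace p ∧ ∀ θ' ∈ paramSpace p,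
    empiricalMean x n (censoredLogLik g A θ') ≤ empiricalMean x n (censoredLogLik g A θ)

/-- The restricted parameter set `Θ_A^α = {θ ∈ Θ : P_θ(A) ≥ α}`. -/
def restrictedParams {p : ℕ} (g : ℝ → ℝ) (A : Set (Fin p → ℝ)) (α : ℝ) : Set (Param p) :=
  {θ | θ ∈ paramSpace p ∧ α ≤ (ellipticalMeasure g θ).real A}

/-- `θ` is an MLE(r) at level `α`: it maximizes the truncated log-likelihood over `Θ_A^α`. -/
def IsMLEr {p : ℕ} (g : ℝ → ℝ) (α : ℝ) (A : Set (Fin p → ℝ)) (x : ℕ → Fin p → ℝ) (n : ℕ)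
    (θ : Param p) : Prop :=
  θ ∈ restrictedParams g A α ∧ ∀ θ' ∈ restrictedParams g A α,
    empiricalMean x n (truncatedLogLik g A θ') ≤ empiricalMean x n (truncatedLogLik g A θ)

/-- The induced contamination level `π^*(θ) = (P_θ(A) - P_n(A)) / P_θ(A)`. -/
def inducedLevel {p : ℕ} (g : ℝ → ℝ) (A : Set (Fin p → ℝ)) (x : ℕ → Fin p → ℝ) (n : ℕ)
    (θ : Param p) : ℝ :=
  ((ellipticalMeasure g θ).real A - (empirical x n).real A) / (ellipticalMeasure g θ).real A

end EllipticalGEM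

end

/-! Write `w = 1 - π`. The three estimators are instances of one object: a pair `(w, σ)` whose
log-likelihood, with terms `log (w f_σ)` on `A_n` and `log (1 - w P_σ(A_n))` off it, is at least
that of the truth `(1 - π₀, θ₀)`; this is `Dominates`. For an MLE(s) it is the definition, and an
MLE(c) is the case `w = 1`. For an MLE(r) take `w = P_n(A_n) / P_σ(A_n)`: the likelihood splits into
a truncated factor, maximized by `σ`, and a binomial factor, maximized by this `w`, and `1 - w` is
the induced level (`IsMLEr.dominates`). Consistency then reduces to `tendsto_of_dominates`.

Population MVE. Level sets of `f_θ₀` have the least volume for given `P_θ₀`-mass. Since `Q` does not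
charge the MVE, and the MVE is unique, it is `E = {q_θ₀ ≤ t}` with `(1 - π₀) P_θ₀(E) = 1/2` and
`Q(E) = 0` (`exists_isPopulationLevel`). Almost surely the empirical measures converge weakly; the
rest is deterministic. Limits are taken along ultrafilters finer than `atTop`, so bounded sequences
converge without extraction. Hyperplanes have mass at most `π₀ < 1/2`, so the `A_n` cannot flatten;
their limit has mass at least `1/2` and volume at most that of `E`, hence is `E`
(`exists_tendsto_mve`).

Compactness of the estimators. If the least eigenvalue `l` of the scatter tends to `0`, the
determinant raises each log-density by at most `(p/2) |log l|`, while the decay of `g` lowers it by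
about `γ |log l|` at observations outside a thin slab. Near `E` thin slabs carry little mass,
because `Q(E) = 0`. As `γ > p/2`, the likelihood falls to `-∞`, a contradiction
(`exists_eigenvalue_ge`). Bounds on the determinant and the location follow.

Identification. The bound `log z ≤ 2 (√z - 1)` turns domination into an inequality between bounded
quantities, with no integrability of logarithms. In the limit it says `∫_E (√(w' f_σ') - √(w₀
f_θ₀))² ≤ 0`. So the weighted densities agree on `E`, and (G1) forces `(w', σ') = (w₀, θ₀)`
(`eq_of_density_eq`).

In dimension one no decay is assumed: it follows from the mere existence of a maximizer for one
sample, tested against distributions concentrating at an observation on the boundary of `A_n`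
(`polynomialDecay_of_bounded`). -/

open scoped Pointwise

namespace EllipticalGEM

variable {p : ℕ}

/-! ### Positive definite matrices: Cauchy-Schwarz, eigenvalues and trace bounds. -/

section LinearAlgebra

lemma dotProduct_mulVec_comm {S : Matrix (Fin p) (Fin p) ℝ} (hS : S.IsHermitian)
    (x y : Fin p → ℝ) : x ⬝ᵥ (S *ᵥ y) = (S *ᵥ x) ⬝ᵥ y := by
  have h : Sᵀ = S := by simpa [Matrix.IsSymm] using hS
  rw [Matrix.dotProduct_mulVec, ← Matrix.mulVec_transpose, h]

lemma posDef_mulVec_inv_mulVec {S : Matrix (Fin p) (Fin p) ℝ} (hS : S.PosDef)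
    (y : Fin p → ℝ) : S *ᵥ (S⁻¹ *ᵥ y) = y := by
  have := hS.det_pos.ne'
  rw [Matrix.mulVec_mulVec, Matrix.mul_nonsing_inv _ (isUnit_iff_ne_zero.2 this),
    Matrix.one_mulVec]

lemma posDef_inv_mulVec_mulVec {S : Matrix (Fin p) (Fin p) ℝ} (hS : S.PosDef)
    (y : Fin p → ℝ) : S⁻¹ *ᵥ (S *ᵥ y) = y := by
  have := hS.det_pos.ne'
  rw [Matrix.mulVec_mulVec, Matrix.nonsing_inv_mul _ (isUnit_iff_ne_zero.2 this),
    Matrix.one_mulVec]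

lemma posDef_dotProduct_mulVec_pos {S : Matrix (Fin p) (Fin p) ℝ} (hS : S.PosDef)
    {y : Fin p → ℝ} (hy : y ≠ 0) : 0 < y ⬝ᵥ (S *ᵥ y) := by
  simpa using hS.dotProduct_mulVec_pos hy

lemma posDef_dotProduct_mulVec_nonneg {S : Matrix (Fin p) (Fin p) ℝ} (hS : S.PosDef)
    (y : Fin p → ℝ) : 0 ≤ y ⬝ᵥ (S *ᵥ y) := by
  simpa using hS.posSemidef.dotProduct_mulVec_nonneg y

/-- Cauchy-Schwarz inequality for the pair of norms attached to `S` and `S⁻¹`. -/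
lemma sq_dotProduct_le {S : Matrix (Fin p) (Fin p) ℝ} (hS : S.PosDef) (v y : Fin p → ℝ) :
    (v ⬝ᵥ y) ^ 2 ≤ (v ⬝ᵥ (S *ᵥ v)) * (y ⬝ᵥ (S⁻¹ *ᵥ y)) := by
  by_cases hv : v = 0
  · simp [hv]
  have h1 : 0 < v ⬝ᵥ (S *ᵥ v) := posDef_dotProduct_mulVec_pos hS hv
  set a := v ⬝ᵥ (S *ᵥ v)
  -- This `t` minimizes the `S⁻¹`-norm of `y - t • S v`; nonnegativity of the minimum is the
  -- inequality.
  set t := (v ⬝ᵥ y) / a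
  have h2 := posDef_dotProduct_mulVec_nonneg hS.inv (y - t • (S *ᵥ v))
  have e1 : (S *ᵥ v) ⬝ᵥ (S⁻¹ *ᵥ y) = v ⬝ᵥ y := by
    rw [← dotProduct_mulVec_comm hS.1, posDef_mulVec_inv_mulVec hS]
  have e2 : (S *ᵥ v) ⬝ᵥ v = a := dotProduct_comm _ _
  rw [Matrix.mulVec_sub, Matrix.mulVec_smul, posDef_inv_mulVec_mulVec hS] at h2
  simp only [sub_dotProduct, dotProduct_sub, smul_dotProduct, dotProduct_smul, smul_eq_mul, e1,
    e2, dotProduct_comm y v] at h2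
  have h3 : t * a = v ⬝ᵥ y := div_mul_cancel₀ _ h1.ne'
  have h4 : 0 ≤ y ⬝ᵥ (S⁻¹ *ᵥ y) - t * (v ⬝ᵥ y) := by
    have : t * (t * a) = t * (v ⬝ᵥ y) := by rw [h3]
    linarith
  have h5 : t * (v ⬝ᵥ y) * a = (v ⬝ᵥ y) ^ 2 := by rw [mul_right_comm, h3]; ring
  nlinarith

lemma dotProduct_self_nonneg' (y : Fin p → ℝ) : 0 ≤ y ⬝ᵥ y := by
  simpa using dotProduct_star_self_nonneg y

lemma norm_sq_le_dotProduct_self (y : Fin p → ℝ) : ‖y‖ ^ 2 ≤ y ⬝ᵥ y := by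
  have h : ‖y‖ ≤ √(y ⬝ᵥ y) := by
    refine (pi_norm_le_iff_of_nonneg (Real.sqrt_nonneg _)).2 fun i => ?_
    refine Real.abs_le_sqrt ?_
    rw [pow_two]
    exact Finset.single_le_sum (f := fun i => y i * y i) (fun j _ => mul_self_nonneg _)
      (Finset.mem_univ i)
  calc ‖y‖ ^ 2 ≤ √(y ⬝ᵥ y) ^ 2 := by gcongr
    _ = _ := Real.sq_sqrt (dotProduct_self_nonneg' y)

lemma exists_posDef_eigen {S : Matrix (Fin p) (Fin p) ℝ} (hS : S.PosDef) :
    ∃ (e : Fin p → ℝ) (v : Fin p → Fin p → ℝ), (∀ i, 0 < e i) ∧ (∀ i, v i ⬝ᵥ v i = 1) ∧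
      (∀ i, v i ⬝ᵥ (S *ᵥ v i) = e i) ∧ S.det = ∏ i, e i ∧ S.trace = ∑ i, e i ∧
      (∀ y, y ⬝ᵥ y = ∑ i, (v i ⬝ᵥ y) ^ 2) ∧ ∀ y, y ⬝ᵥ (S *ᵥ y) = ∑ i, e i * (v i ⬝ᵥ y) ^ 2 := by
  let b := hS.1.eigenvectorBasis
  have hv : ∀ i, S *ᵥ (b i).ofLp = hS.1.eigenvalues i • (b i).ofLp := hS.1.mulVec_eigenvectorBasis
  have h1 : ∀ i, (b i).ofLp ⬝ᵥ (b i).ofLp = 1 := by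
    intro i
    have := b.orthonormal.1 i
    have h2 : inner ℝ (b i) (b i) = 1 := by rw [real_inner_self_eq_norm_sq, this]; norm_num
    rwa [EuclideanSpace.inner_eq_star_dotProduct, star_trivial] at h2
  have h3 : ∀ y z : Fin p → ℝ, y ⬝ᵥ z = ∑ i, ((b i).ofLp ⬝ᵥ y) * ((b i).ofLp ⬝ᵥ z) := by
    intro y z
    have := b.sum_inner_mul_inner (WithLp.toLp 2 y) (WithLp.toLp 2 z)
    simp only [EuclideanSpace.inner_eq_star_dotProduct, star_trivial] at this
    rw [dotProduct_comm y z, ← this]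
    refine Finset.sum_congr rfl fun i _ => ?_
    rw [dotProduct_comm z]
  refine ⟨hS.1.eigenvalues, fun i => (b i).ofLp, hS.eigenvalues_pos, h1, fun i => ?_, ?_, ?_,
    fun y => ?_, fun y => ?_⟩
  · rw [hv, dotProduct_smul, h1]; simp
  · simpa using hS.1.det_eq_prod_eigenvalues
  · simpa using hS.1.trace_eq_sum_eigenvalues
  · rw [h3]; exact Finset.sum_congr rfl fun i _ => by ring
  · rw [h3]
    refine Finset.sum_congr rfl fun i _ => ?_
    rw [dotProduct_mulVec_comm hS.1, hv, smul_dotProduct]; simp; ring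

/-- The smallest eigenvalue of a positive definite matrix. -/
lemma exists_min_eigenvalue (hp : 1 ≤ p) {S : Matrix (Fin p) (Fin p) ℝ} (hS : S.PosDef) :
    ∃ l > 0, ∃ v : Fin p → ℝ, v ⬝ᵥ v = 1 ∧ v ⬝ᵥ (S *ᵥ v) = l ∧ l ^ p ≤ S.det ∧
      S.trace * l ^ (p - 1) ≤ p * S.det ∧ ∀ y, l * (y ⬝ᵥ y) ≤ y ⬝ᵥ (S *ᵥ y) := by
  obtain ⟨e, v, he, hv, hve, hdet, htr, hy, hSy⟩ := exists_posDef_eigen hS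
  have : Nonempty (Fin p) := ⟨⟨0, hp⟩⟩
  obtain ⟨k, hk⟩ := Finite.exists_min e
  refine ⟨e k, he k, v k, hv k, hve k, ?_, ?_, fun y => ?_⟩
  · rw [hdet]
    calc e k ^ p = ∏ _i : Fin p, e k := by simp
      _ ≤ _ := Finset.prod_le_prod (fun i _ => (he k).le) (fun i _ => hk i)
  -- Each eigenvalue times the `(p - 1)`-th power of the least one is at most the determinant. Later
  -- this turns an upper bound on the determinant and a lower bound on `l` into an upper bound on
  -- the trace.
  · rw [htr, Finset.sum_mul]
    calc ∑ i, e i * e k ^ (p - 1) ≤ ∑ _i : Fin p, S.det := by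
          refine Finset.sum_le_sum fun i _ => ?_
          rw [hdet, ← Finset.mul_prod_erase _ _ (Finset.mem_univ i)]
          refine mul_le_mul_of_nonneg_left ?_ (he i).le
          calc e k ^ (p - 1) = ∏ _j ∈ Finset.univ.erase i, e k := by simp
            _ ≤ _ := Finset.prod_le_prod (fun i _ => (he k).le) (fun i _ => hk i)
      _ = _ := by simp
  · rw [hy, hSy, Finset.mul_sum]
    exact Finset.sum_le_sum fun i _ => mul_le_mul_of_nonneg_right (hk i) (sq_nonneg _)

lemma dotProduct_mulVec_le_trace {S : Matrix (Fin p) (Fin p) ℝ} (hS : S.PosDef)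
    (y : Fin p → ℝ) : y ⬝ᵥ (S *ᵥ y) ≤ S.trace * (y ⬝ᵥ y) := by
  obtain ⟨e, v, he, hv, hve, hdet, htr, hy, hSy⟩ := exists_posDef_eigen hS
  rw [hSy, hy, htr, Finset.mul_sum]
  refine Finset.sum_le_sum fun i _ => mul_le_mul_of_nonneg_right ?_ (sq_nonneg _)
  exact Finset.single_le_sum (fun j _ => (he j).le) (Finset.mem_univ i)

/-- The quadratic form is nonnegative at `e_i ± e_j`, so `2 |S i j| ≤ S i i + S j j`. A trace bound
thus gives entrywise compactness. -/
lemma abs_apply_le_trace {S : Matrix (Fin p) (Fin p) ℝ} (hS : S.PosDef) (i j : Fin p) :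
    |S i j| ≤ S.trace := by
  have hd : ∀ k, S k k ≤ S.trace := fun k =>
    Finset.single_le_sum (f := fun k => S k k) (fun l _ => hS.diag_pos.le) (Finset.mem_univ k)
  have hsym : S j i = S i j := by simpa using hS.1.apply i j
  have h : ∀ c : ℝ, 0 ≤ S i i + c * S i j + c * (S j i + c * S j j) := by
    intro c
    have := posDef_dotProduct_mulVec_nonneg hS (Pi.single i 1 + c • Pi.single j 1)
    simpa [Matrix.mulVec_add, Matrix.mulVec_smul, add_dotProduct, smul_dotProduct, mul_add,
      dotProduct_add, Matrix.mulVec_single, add_assoc, add_comm, add_left_comm] using this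
  have h1 := h 1
  have h2 := h (-1)
  rw [hsym] at h1 h2
  have := hd i
  have := hd j
  rw [abs_le]; constructor <;> linarith

end LinearAlgebra

/-! ### Ellipsoids, their volumes and their boundaries. -/

section Geometry

lemma quadDist_nonneg {θ : Param p} (hθ : θ ∈ paramSpace p) (x : Fin p → ℝ) :
    0 ≤ quadDist θ x :=
  posDef_dotProduct_mulVec_nonneg (Matrix.PosDef.inv hθ) _

lemma quadDist_pos {θ : Param p} (hθ : θ ∈ paramSpace p) {x : Fin p → ℝ} (hx : x ≠ θ.1) :
    0 < quadDist θ x :=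
  posDef_dotProduct_mulVec_pos (Matrix.PosDef.inv hθ) (sub_ne_zero.2 hx)

lemma quadDist_self (θ : Param p) : quadDist θ θ.1 = 0 := by simp [quadDist]

lemma sq_dotProduct_sub_le_quadDist {θ : Param p} (hθ : θ ∈ paramSpace p) (v x : Fin p → ℝ) :
    (v ⬝ᵥ (x - θ.1)) ^ 2 ≤ (v ⬝ᵥ (θ.2 *ᵥ v)) * quadDist θ x :=
  sq_dotProduct_le hθ v _

/-- Cauchy-Schwarz with `v = x - μ`, the trace bounding the largest eigenvalue; then one factor `y
⬝ᵥ y` cancels. -/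
lemma dotProduct_self_le_quadDist {θ : Param p} (hθ : θ ∈ paramSpace p) (x : Fin p → ℝ) :
    (x - θ.1) ⬝ᵥ (x - θ.1) ≤ θ.2.trace * quadDist θ x := by
  set y := x - θ.1
  by_cases hy : y ⬝ᵥ y = 0
  · rw [hy]
    have h : 0 ≤ θ.2.trace := hθ.posSemidef.trace_nonneg
    exact mul_nonneg h (quadDist_nonneg hθ x)
  have hy' : 0 < y ⬝ᵥ y := lt_of_le_of_ne (dotProduct_self_nonneg' y) (Ne.symm hy)
  have h1 := sq_dotProduct_sub_le_quadDist hθ y x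
  have h2 := dotProduct_mulVec_le_trace hθ y
  have h3 := quadDist_nonneg hθ x
  have h4 : (y ⬝ᵥ y) * (y ⬝ᵥ y) ≤ (y ⬝ᵥ y) * (θ.2.trace * quadDist θ x) := by
    have := mul_le_mul_of_nonneg_right h2 h3
    nlinarith
  exact le_of_mul_le_mul_left h4 hy'

lemma norm_sub_sq_le_quadDist {θ : Param p} (hθ : θ ∈ paramSpace p) (x : Fin p → ℝ) :
    ‖x - θ.1‖ ^ 2 ≤ θ.2.trace * quadDist θ x :=
  (norm_sq_le_dotProduct_self _).trans (dotProduct_self_le_quadDist hθ x)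

lemma continuousAt_quadDist {z : Param p × (Fin p → ℝ)} (hz : z.1 ∈ paramSpace p) :
    ContinuousAt (fun z : Param p × (Fin p → ℝ) => quadDist z.1 z.2) z := by
  -- Written as adjugate over determinant, the inverse is visibly continuous where the determinant
  -- does not vanish.
  have h : (fun z : Param p × (Fin p → ℝ) => quadDist z.1 z.2) =
      fun z => (z.1.2.det)⁻¹ * ((z.2 - z.1.1) ⬝ᵥ (z.1.2.adjugate *ᵥ (z.2 - z.1.1))) := by
    funext z
    simp [quadDist, Matrix.inv_def, Matrix.smul_mulVec]
  rw [h]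
  have hd : Continuous fun z : Param p × (Fin p → ℝ) => z.1.2.det := by fun_prop
  refine (hd.continuousAt.inv₀ (Matrix.PosDef.det_pos hz).ne').mul ?_
  have h1 : Continuous fun z : Param p × (Fin p → ℝ) => z.1.2.adjugate :=
    Continuous.matrix_adjugate (by fun_prop)
  have h2 : Continuous fun z : Param p × (Fin p → ℝ) => z.2 - z.1.1 := by fun_prop
  exact (h2.dotProduct (h1.matrix_mulVec h2)).continuousAt

lemma continuous_quadDist (θ : Param p) : Continuous (quadDist θ) := by
  unfold quadDist
  fun_prop

lemma ellipsoid_eq_smul (θ : Param p) {r : ℝ} (hr : 0 < r) :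
    ellipsoid θ r = ellipsoid (θ.1, (r ^ 2) • θ.2) 1 := by
  ext x
  have h : ((r ^ 2) • θ.2)⁻¹ = (r ^ 2)⁻¹ • θ.2⁻¹ := by
    by_cases h : IsUnit θ.2.det
    · refine Matrix.inv_eq_left_inv ?_
      rw [smul_mul_smul_comm, Matrix.nonsing_inv_mul _ h, inv_mul_cancel₀ (by positivity), one_smul]
    -- For a singular scatter both inverses are `0` by convention, so positive definiteness is not
    -- needed.
    · have h' : ¬ IsUnit ((r ^ 2) • θ.2).det := by
        simpa [Matrix.det_smul, hr.ne'] using h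
      rw [Matrix.nonsing_inv_apply_not_isUnit _ h, Matrix.nonsing_inv_apply_not_isUnit _ h',
        smul_zero]
  simp only [ellipsoid, quadDist, Set.mem_ofPred_eq, h, Matrix.smul_mulVec, dotProduct_smul,
    smul_eq_mul, one_pow]
  rw [inv_mul_le_iff₀ (by positivity), mul_one]

lemma quadDist_smul {θ : Param p} (hθ : θ ∈ paramSpace p) {c : ℝ} (hc : c ≠ 0) (x : Fin p → ℝ) :
    quadDist (θ.1, c • θ.2) x = c⁻¹ * quadDist θ x := by
  have h : (c • θ.2)⁻¹ = c⁻¹ • θ.2⁻¹ := by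
    refine Matrix.inv_eq_left_inv ?_
    rw [smul_mul_smul_comm, Matrix.nonsing_inv_mul _ (isUnit_iff_ne_zero.2 hθ.det_pos.ne'),
      inv_mul_cancel₀ hc, one_smul]
  simp [quadDist, h, Matrix.smul_mulVec]

lemma smul_mem_paramSpace {θ : Param p} (hθ : θ ∈ paramSpace p) {c : ℝ} (hc : 0 < c) :
    (θ.1, c • θ.2) ∈ paramSpace p :=
  Matrix.PosDef.smul hθ hc

lemma isEllipsoid_iff {A : Set (Fin p → ℝ)} :
    IsEllipsoid A ↔ ∃ τ ∈ paramSpace p, A = ellipsoid τ 1 := by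
  constructor
  · rintro ⟨θ, hθ, r, hr, rfl⟩
    exact ⟨_, smul_mem_paramSpace hθ (by positivity), ellipsoid_eq_smul θ hr⟩
  · rintro ⟨τ, hτ, rfl⟩
    exact ⟨τ, hτ, 1, one_pos, rfl⟩

lemma isClosed_ellipsoid (θ : Param p) (r : ℝ) :
    IsClosed (ellipsoid θ r) :=
  isClosed_le (continuous_quadDist θ) continuous_const

lemma ellipsoid_subset_closedBall {θ : Param p} (hθ : θ ∈ paramSpace p) (r : ℝ) :
    ellipsoid θ r ⊆ Metric.closedBall θ.1 (√(θ.2.trace * r ^ 2)) := by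
  intro x hx
  rw [Metric.mem_closedBall, dist_eq_norm]
  refine Real.le_sqrt_of_sq_le ((norm_sub_sq_le_quadDist hθ x).trans ?_)
  have h : 0 ≤ θ.2.trace := hθ.posSemidef.trace_nonneg
  exact mul_le_mul_of_nonneg_left hx h

/-- Square root factorization of a positive definite matrix. -/
lemma exists_factor {S : Matrix (Fin p) (Fin p) ℝ} (hS : S.PosDef) :
    ∃ L : Matrix (Fin p) (Fin p) ℝ, L.det = √S.det ∧
      ∀ y, (L *ᵥ y) ⬝ᵥ (S⁻¹ *ᵥ (L *ᵥ y)) = y ⬝ᵥ y := by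
  open scoped MatrixOrder in
  have h := hS.posSemidef
  have h0 : (0 : Matrix (Fin p) (Fin p) ℝ) ≤ S := h.nonneg
  let L := CFC.sqrt S
  have hL : L * L = S := CFC.sqrt_mul_sqrt_self S h0
  have hLh : L.IsHermitian := (Matrix.nonneg_iff_posSemidef.1 (CFC.sqrt_nonneg S)).1
  have hdet : L.det = √S.det := by
    have := h.det_sqrt
    simpa [RCLike.sqrt_of_nonneg h.det_nonneg] using this
  refine ⟨L, hdet, fun y => ?_⟩
  have hu : IsUnit L.det := by
    rw [hdet]; exact isUnit_iff_ne_zero.2 (Real.sqrt_pos.2 hS.det_pos).ne'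
  have h1 : L * (S⁻¹ * L) = 1 := by
    rw [← hL, Matrix.mul_inv_rev, Matrix.mul_assoc, Matrix.nonsing_inv_mul _ hu, Matrix.mul_one,
      Matrix.mul_nonsing_inv _ hu]
  rw [← dotProduct_mulVec_comm hLh, Matrix.mulVec_mulVec, Matrix.mulVec_mulVec, Matrix.mul_assoc, h1,
    Matrix.one_mulVec]

/-- The set is a translate of the image of a Euclidean ball under a factor `L` with `det L = √det
Σ`. -/
lemma volume_setOf_quadDist_le {θ : Param p} (hθ : θ ∈ paramSpace p) (t : ℝ) :
    volume {x | quadDist θ x ≤ t} =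
      ENNReal.ofReal (√θ.2.det) * volume {y : Fin p → ℝ | y ⬝ᵥ y ≤ t} := by
  obtain ⟨L, hdet, hL⟩ := exists_factor hθ
  have hpos : 0 < √θ.2.det := Real.sqrt_pos.2 hθ.det_pos
  have hu : IsUnit L.det := by rw [hdet]; exact isUnit_iff_ne_zero.2 hpos.ne'
  have himg : {x | quadDist θ x ≤ t} =
      (fun x => x + (-θ.1)) ⁻¹' (Matrix.toLin' L '' {y : Fin p → ℝ | y ⬝ᵥ y ≤ t}) := by
    ext x
    simp only [Set.mem_ofPred_eq, Set.mem_preimage, Set.mem_image, Matrix.toLin'_apply]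
    constructor
    · intro hx
      refine ⟨L⁻¹ *ᵥ (x - θ.1), ?_, ?_⟩
      · rw [← hL, Matrix.mulVec_mulVec, Matrix.mul_nonsing_inv _ hu, Matrix.one_mulVec]
        exact hx
      · rw [Matrix.mulVec_mulVec, Matrix.mul_nonsing_inv _ hu, Matrix.one_mulVec, sub_eq_add_neg]
    · rintro ⟨y, hy, hxy⟩
      rw [quadDist, sub_eq_add_neg, ← hxy, hL]
      exact hy
  rw [himg, measure_preimage_add_right, Measure.addHaar_image_linearMap, LinearMap.det_toLin',
    hdet, abs_of_pos hpos]

lemma volume_dotProduct_le (hp : 1 ≤ p) {t : ℝ} (ht : 0 ≤ t) :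
    volume {y : Fin p → ℝ | y ⬝ᵥ y ≤ t} =
      ENNReal.ofReal (√t ^ p) * volume {y : Fin p → ℝ | y ⬝ᵥ y ≤ 1} := by
  rcases ht.eq_or_lt with rfl | ht
  · have h0 : {y : Fin p → ℝ | y ⬝ᵥ y ≤ 0} = {0} := by
      ext y
      simp only [Set.mem_ofPred_eq, Set.mem_singleton_iff]
      rw [← dotProduct_self_eq_zero (v := y)]
      exact ⟨fun h => le_antisymm h (dotProduct_self_nonneg' y), fun h => h.le⟩
    have : Nonempty (Fin p) := ⟨⟨0, hp⟩⟩
    rw [h0]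
    simp [show p ≠ 0 by omega]
  have h0 : 0 < √t := Real.sqrt_pos.2 ht
  have h : {y : Fin p → ℝ | y ⬝ᵥ y ≤ t} = √t • {y : Fin p → ℝ | y ⬝ᵥ y ≤ 1} := by
    ext y
    rw [Set.mem_smul_set_iff_inv_smul_mem₀ h0.ne']
    simp only [Set.mem_ofPred_eq, smul_dotProduct, dotProduct_smul, smul_eq_mul]
    rw [← mul_assoc, ← mul_inv, Real.mul_self_sqrt ht.le, inv_mul_le_iff₀ ht, mul_one]
  rw [h, Measure.addHaar_smul]
  simp [abs_of_pos (pow_pos h0 p)]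

lemma volume_unitBall_pos : 0 < volume {y : Fin p → ℝ | y ⬝ᵥ y ≤ 1} := by
  have ho : IsOpen {y : Fin p → ℝ | y ⬝ᵥ y < 1} := isOpen_lt (by fun_prop) continuous_const
  exact (ho.measure_pos volume ⟨0, by simp⟩).trans_le (measure_mono fun y (hy : y ⬝ᵥ y < 1) => (hy.le : y ⬝ᵥ y ≤ 1))

lemma volume_unitBall_lt_top : volume {y : Fin p → ℝ | y ⬝ᵥ y ≤ 1} < ∞ := by
  refine (measure_mono ?_).trans_lt (measure_closedBall_lt_top (x := (0 : Fin p → ℝ)) (r := 1))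
  intro y hy
  have := (norm_sq_le_dotProduct_self y).trans hy
  simpa using (sq_le_one_iff₀ (norm_nonneg y)).1 this

lemma volume_setOf_quadDist_le_lt_top (hp : 1 ≤ p) {θ : Param p} (hθ : θ ∈ paramSpace p) {t : ℝ}
    (ht : 0 ≤ t) : volume {x | quadDist θ x ≤ t} < ∞ := by
  rw [volume_setOf_quadDist_le hθ, volume_dotProduct_le hp ht]
  exact ENNReal.mul_lt_top ENNReal.ofReal_lt_top
    (ENNReal.mul_lt_top ENNReal.ofReal_lt_top volume_unitBall_lt_top)

lemma setOf_quadDist_le_eq_ellipsoid (θ : Param p) {t : ℝ} (ht : 0 ≤ t) :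
    {x | quadDist θ x ≤ t} = ellipsoid θ (√t) := by
  simp [ellipsoid, Real.sq_sqrt ht]

lemma volume_ellipsoid (hp : 1 ≤ p) {θ : Param p} (hθ : θ ∈ paramSpace p) {r : ℝ} (hr : 0 ≤ r) :
    volume (ellipsoid θ r) =
      ENNReal.ofReal (√θ.2.det * r ^ p) * volume {y : Fin p → ℝ | y ⬝ᵥ y ≤ 1} := by
  rw [ellipsoid, volume_setOf_quadDist_le hθ, volume_dotProduct_le hp (by positivity),
    Real.sqrt_sq hr, ← mul_assoc, ← ENNReal.ofReal_mul (Real.sqrt_nonneg _)]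

/-- The boundary shells of an ellipsoid are Lebesgue null. -/
lemma volume_quadDist_eq (hp : 1 ≤ p) {θ : Param p} (hθ : θ ∈ paramSpace p) (t : ℝ) :
    volume {x | quadDist θ x = t} = 0 := by
  rcases lt_or_ge t 0 with ht | ht
  · have : {x | quadDist θ x = t} = ∅ := by
      ext x
      have := quadDist_nonneg hθ x
      simp only [Set.mem_ofPred_eq, Set.mem_empty_iff_false, iff_false]
      intro h; linarith
    simp [this]
  -- The shell lies between two solid ellipsoids, and the difference of their volumes vanishes as
  -- `s` increases to `t`.
  have hbd : ∀ s, 0 ≤ s → s < t → volume {x | quadDist θ x = t} ≤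
      volume {x | quadDist θ x ≤ t} - volume {x | quadDist θ x ≤ s} := by
    intro s hs hst
    have hsub : {x | quadDist θ x ≤ s} ⊆ {x | quadDist θ x ≤ t} :=
      fun x (hx : quadDist θ x ≤ s) => (hx.trans hst.le : quadDist θ x ≤ t)
    rw [← measure_sdiff hsub
      (isClosed_le (continuous_quadDist θ) continuous_const).nullMeasurableSet
      (volume_setOf_quadDist_le_lt_top hp hθ hs).ne]
    refine measure_mono fun x (hx : quadDist θ x = t) => ⟨(hx.le : quadDist θ x ≤ t), ?_⟩
    simp only [Set.mem_ofPred_eq, not_le]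
    linarith
  rcases ht.eq_or_lt with rfl | ht0
  · have hsub : {x | quadDist θ x = 0} ⊆ {x | quadDist θ x ≤ 0} :=
      fun x (hx : quadDist θ x = 0) => (hx.le : quadDist θ x ≤ 0)
    refine le_antisymm ((measure_mono hsub).trans ?_) bot_le
    rw [volume_setOf_quadDist_le hθ, volume_dotProduct_le hp le_rfl]
    simp [show p ≠ 0 by omega]
  set V := volume {y : Fin p → ℝ | y ⬝ᵥ y ≤ 1}
  have hV : V ≠ ∞ := volume_unitBall_lt_top.ne
  have hlim : Tendsto (fun s : ℝ => ENNReal.ofReal √θ.2.det * (ENNReal.ofReal (√t ^ p) * V) -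
      ENNReal.ofReal √θ.2.det * (ENNReal.ofReal (√s ^ p) * V)) (𝓝[<] t) (𝓝 0) := by
    have h1 : Tendsto (fun s : ℝ => ENNReal.ofReal √θ.2.det * (ENNReal.ofReal (√s ^ p) * V))
        (𝓝[<] t) (𝓝 (ENNReal.ofReal √θ.2.det * (ENNReal.ofReal (√t ^ p) * V))) := by
      refine ENNReal.Tendsto.const_mul (ENNReal.Tendsto.mul_const ?_ (Or.inr hV))
        (Or.inr ENNReal.ofReal_ne_top)
      refine ENNReal.tendsto_ofReal (tendsto_nhdsWithin_of_tendsto_nhds ?_)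
      exact (Real.continuous_sqrt.pow p).tendsto t
    have h2 : ENNReal.ofReal √θ.2.det * (ENNReal.ofReal (√t ^ p) * V) ≠ ∞ :=
      ENNReal.mul_ne_top ENNReal.ofReal_ne_top (ENNReal.mul_ne_top ENNReal.ofReal_ne_top hV)
    have := ENNReal.Tendsto.sub (tendsto_const_nhds (x := ENNReal.ofReal √θ.2.det *
      (ENNReal.ofReal (√t ^ p) * V))) h1 (Or.inl h2)
    simpa using this
  refine le_antisymm (ge_of_tendsto hlim ?_) bot_le
  filter_upwards [Ioo_mem_nhdsLT ht0] with s hs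
  have := hbd s hs.1.le hs.2
  rwa [volume_setOf_quadDist_le hθ, volume_setOf_quadDist_le hθ, volume_dotProduct_le hp ht,
    volume_dotProduct_le hp hs.1.le] at this

end Geometry

/-! ### Elliptical densities and joint continuity of `P_θ(E_τ)`. -/

section Density

variable {g : ℝ → ℝ}

/-- Continuity of `g` is known on `[0, ∞)` only; clamping the argument gives a globally continuous
function with the same values on quadratic distances. -/
lemma continuous_comp_max (hG2 : CondG2 g) : Continuous fun t => g (max t 0) :=
  hG2.comp_continuous (by fun_prop) fun t => Set.mem_Ici.2 (le_max_right _ _)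

lemma density_nonneg (hg : IsEllipticalGenerator p g) {θ : Param p} (hθ : θ ∈ paramSpace p)
    (x : Fin p → ℝ) : 0 ≤ density g θ x :=
  mul_nonneg (by positivity) (hg.nonneg _ (quadDist_nonneg hθ x))

lemma density_le (hg : IsEllipticalGenerator p g) {θ : Param p} (hθ : θ ∈ paramSpace p)
    (x : Fin p → ℝ) : density g θ x ≤ (√θ.2.det)⁻¹ * g 0 :=
  mul_le_mul_of_nonneg_left
    (hg.antitoneOn (by simp) (quadDist_nonneg hθ x) (quadDist_nonneg hθ x)) (by positivity)

lemma continuousWithinAt_density (hG2 : CondG2 g) {z : Param p × (Fin p → ℝ)}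
    (hz : z.1 ∈ paramSpace p) :
    ContinuousWithinAt (fun z : Param p × (Fin p → ℝ) => density g z.1 z.2)
      (paramSpace p ×ˢ Set.univ) z := by
  have h1 : ContinuousAt (fun z : Param p × (Fin p → ℝ) =>
      (√z.1.2.det)⁻¹ * g (max (quadDist z.1 z.2) 0)) z := by
    have hd : Continuous fun z : Param p × (Fin p → ℝ) => √z.1.2.det := by fun_prop
    refine (hd.continuousAt.inv₀ (Real.sqrt_pos.2 (Matrix.PosDef.det_pos hz)).ne').mul ?_
    exact (continuous_comp_max hG2).continuousAt.comp (f := fun z : Param p × (Fin p → ℝ) =>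
      quadDist z.1 z.2) (continuousAt_quadDist hz)
  refine h1.continuousWithinAt.congr (fun y hy => ?_) ?_
  · rw [density, max_eq_left (quadDist_nonneg hy.1 _)]
  · rw [density, max_eq_left (quadDist_nonneg hz _)]

lemma continuous_density (hG2 : CondG2 g) {θ : Param p} (hθ : θ ∈ paramSpace p) :
    Continuous (density g θ) := by
  have h : density g θ = fun x => (√θ.2.det)⁻¹ * g (max (quadDist θ x) 0) := by
    funext x
    rw [density, max_eq_left (quadDist_nonneg hθ _)]
  rw [h]
  exact continuous_const.mul ((continuous_comp_max hG2).comp (continuous_quadDist θ))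

lemma integrable_density (hg : IsEllipticalGenerator p g) (hG2 : CondG2 g) {θ : Param p}
    (hθ : θ ∈ paramSpace p) : Integrable (density g θ) := by
  refine ⟨(continuous_density hG2 hθ).aestronglyMeasurable, ?_⟩
  rw [hasFiniteIntegral_iff_ofReal (Eventually.of_forall fun x => density_nonneg hg hθ x)]
  have := (hg.isProbabilityMeasure θ hθ).measure_univ
  rw [ellipticalMeasure, withDensity_apply _ MeasurableSet.univ, Measure.restrict_univ] at this
  rw [this]; simp

lemma ellipticalMeasure_apply (hg : IsEllipticalGenerator p g) (hG2 : CondG2 g) {θ : Param p}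
    (hθ : θ ∈ paramSpace p) {A : Set (Fin p → ℝ)} (hA : MeasurableSet A) :
    ellipticalMeasure g θ A = ENNReal.ofReal (∫ x in A, density g θ x) := by
  rw [ellipticalMeasure, withDensity_apply _ hA,
    ofReal_integral_eq_lintegral_ofReal (integrable_density hg hG2 hθ).integrableOn
      (Eventually.of_forall fun x => density_nonneg hg hθ x)]

lemma ellipticalMeasure_real (hg : IsEllipticalGenerator p g) (hG2 : CondG2 g) {θ : Param p}
    (hθ : θ ∈ paramSpace p) {A : Set (Fin p → ℝ)} (hA : MeasurableSet A) :
    (ellipticalMeasure g θ).real A = ∫ x in A, density g θ x := by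
  rw [measureReal_def, ellipticalMeasure_apply hg hG2 hθ hA, ENNReal.toReal_ofReal]
  exact setIntegral_nonneg hA fun x _ => density_nonneg hg hθ x

lemma ellipticalMeasure_null {θ : Param p} {A : Set (Fin p → ℝ)} (hA : volume A = 0) :
    ellipticalMeasure g θ A = 0 :=
  withDensity_absolutelyContinuous _ _ hA

/-- Ellipsoids with nearby parameters lie in a common ball. -/
lemma eventually_ellipsoid_subset {τ : Param p} :
    ∃ R, ∀ᶠ σ in 𝓝[paramSpace p] τ, ellipsoid σ 1 ⊆ Metric.closedBall 0 R := by
  have h1 : ∀ᶠ σ in 𝓝 τ, σ.2.trace < τ.2.trace + 1 :=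
    (show Continuous fun σ : Param p => σ.2.trace from
      Continuous.matrix_trace continuous_snd).continuousAt.eventually_lt
      continuousAt_const (by simp)
  have h2 : ∀ᶠ σ in 𝓝 τ, ‖σ.1‖ < ‖τ.1‖ + 1 :=
    (show Continuous fun σ : Param p => ‖σ.1‖ by fun_prop).continuousAt.eventually_lt
      continuousAt_const (by simp)
  refine ⟨√(τ.2.trace + 1) + (‖τ.1‖ + 1), ?_⟩
  filter_upwards [nhdsWithin_le_nhds h1, nhdsWithin_le_nhds h2, self_mem_nhdsWithin] with σ a b c
  intro x hx
  have h3 := ellipsoid_subset_closedBall c 1 hx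
  rw [mem_closedBall_iff_norm] at h3 ⊢
  have h4 : √(σ.2.trace * 1 ^ 2) ≤ √(τ.2.trace + 1) := Real.sqrt_le_sqrt (by linarith)
  have h5 : ‖x - 0‖ ≤ ‖x - σ.1‖ + ‖σ.1‖ := by simpa using norm_add_le (x - σ.1) σ.1
  linarith

/-- The measure `P_θ` of the ellipsoid `E_τ` depends continuously on `(θ, τ)`. -/
lemma continuousWithinAt_ellipticalMeasure (hp : 1 ≤ p) (hg : IsEllipticalGenerator p g)
    (hG2 : CondG2 g) {θ τ : Param p} (hθ : θ ∈ paramSpace p) (hτ : τ ∈ paramSpace p) :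
    ContinuousWithinAt (fun z : Param p × Param p =>
      (ellipticalMeasure g z.1).real (ellipsoid z.2 1)) (paramSpace p ×ˢ paramSpace p) (θ, τ) := by
  have hc : ContinuousWithinAt (fun z : Param p × Param p =>
      ∫ x, (ellipsoid z.2 1).indicator (density g z.1) x) (paramSpace p ×ˢ paramSpace p) (θ, τ) := by
    obtain ⟨R, hR⟩ := eventually_ellipsoid_subset (τ := τ)
    have hR' : ∀ᶠ z in 𝓝[paramSpace p ×ˢ paramSpace p] (θ, τ),
        ellipsoid z.2 1 ⊆ Metric.closedBall 0 R :=
      (tendsto_snd.mono_left (nhdsWithin_prod_eq θ τ _ _).le).eventually hR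
    have hdet : ∀ᶠ z : Param p × Param p in 𝓝[paramSpace p ×ˢ paramSpace p] (θ, τ),
        (√z.1.2.det)⁻¹ * g 0 < (√θ.2.det)⁻¹ * g 0 + 1 := by
      refine nhdsWithin_le_nhds (ContinuousAt.eventually_lt ?_ continuousAt_const (by simp))
      have hd : Continuous fun z : Param p × Param p => √z.1.2.det := by fun_prop
      exact (hd.continuousAt.inv₀ (Real.sqrt_pos.2 hθ.det_pos).ne').mul continuousAt_const
    have : FirstCountableTopology (Matrix (Fin p) (Fin p) ℝ) :=
      inferInstanceAs (FirstCountableTopology (Fin p → Fin p → ℝ))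
    -- For nearby parameters the integrand is bounded by a constant on a common ball. It converges
    -- pointwise except on the boundary of `E_τ`, which is a null set.
    refine continuousWithinAt_of_dominated
      (bound := (Metric.closedBall (0 : Fin p → ℝ) R).indicator
        fun _ => (√θ.2.det)⁻¹ * g 0 + 1) ?_ ?_ ?_ ?_
    · filter_upwards [self_mem_nhdsWithin] with z hz
      exact ((continuous_density hG2 hz.1).aestronglyMeasurable).indicator
        (isClosed_ellipsoid z.2 1).measurableSet
    · filter_upwards [self_mem_nhdsWithin, hR', hdet] with z hz h1 h2
      refine Eventually.of_forall fun x => ?_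
      have hC : 0 ≤ (√θ.2.det)⁻¹ * g 0 + 1 := by
        have := hg.nonneg 0 le_rfl
        positivity
      by_cases hx : x ∈ ellipsoid z.2 1
      · rw [Set.indicator_of_mem hx, Set.indicator_of_mem (h1 hx), Real.norm_of_nonneg
          (density_nonneg hg hz.1 x)]
        exact (density_le hg hz.1 x).trans h2.le
      · rw [Set.indicator_of_notMem hx, norm_zero]
        exact Set.indicator_nonneg (fun _ _ => hC) x
    · exact (integrable_indicator_iff Metric.isClosed_closedBall.measurableSet).2
        (integrableOn_const measure_closedBall_lt_top.ne)
    · have hne : ∀ᵐ x, quadDist τ x ≠ 1 := by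
        rw [ae_iff]
        simpa using volume_quadDist_eq hp hτ 1
      filter_upwards [hne] with x hx
      have hq : ContinuousAt (fun z : Param p × Param p => quadDist z.2 x) (θ, τ) :=
        ContinuousAt.comp (f := fun z : Param p × Param p => (z.2, x))
          (g := fun y : Param p × (Fin p → ℝ) => quadDist y.1 y.2)
          (continuousAt_quadDist hτ) (by fun_prop)
      rcases lt_or_gt_of_ne hx with h | h
      · have hd : ContinuousWithinAt (fun z : Param p × Param p => density g z.1 x)
            (paramSpace p ×ˢ paramSpace p) (θ, τ) :=
          ContinuousWithinAt.comp (f := fun z : Param p × Param p => (z.1, x))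
            (g := fun y : Param p × (Fin p → ℝ) => density g y.1 y.2)
            (t := paramSpace p ×ˢ Set.univ)
            (continuousWithinAt_density hG2 (z := (θ, x)) hθ) (by fun_prop)
            fun z hz => ⟨hz.1, trivial⟩
        have hev : ∀ᶠ z : Param p × Param p in 𝓝[paramSpace p ×ˢ paramSpace p] (θ, τ),
            (ellipsoid z.2 1).indicator (density g z.1) x = density g z.1 x := by
          filter_upwards [nhdsWithin_le_nhds (hq.eventually_lt continuousAt_const h)] with z hz
          refine Set.indicator_of_mem ?_ _
          simpa [ellipsoid] using hz.le
        refine hd.congr_of_eventuallyEq hev ?_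
        refine Set.indicator_of_mem ?_ _
        simpa [ellipsoid] using h.le
      · have hev : ∀ᶠ z : Param p × Param p in 𝓝[paramSpace p ×ˢ paramSpace p] (θ, τ),
            (ellipsoid z.2 1).indicator (density g z.1) x = 0 := by
          filter_upwards [nhdsWithin_le_nhds (continuousAt_const.eventually_lt hq h)] with z hz
          refine Set.indicator_of_notMem ?_ _
          simpa [ellipsoid] using hz
        refine (continuousWithinAt_const (b := (0 : ℝ))).congr_of_eventuallyEq hev ?_
        refine Set.indicator_of_notMem ?_ _
        simpa [ellipsoid] using h
  refine hc.congr (fun z hz => ?_) ?_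
  · rw [ellipticalMeasure_real hg hG2 hz.1 (isClosed_ellipsoid z.2 1).measurableSet,
      integral_indicator (isClosed_ellipsoid z.2 1).measurableSet]
  · rw [ellipticalMeasure_real hg hG2 hθ (isClosed_ellipsoid τ 1).measurableSet,
      integral_indicator (isClosed_ellipsoid τ 1).measurableSet]

lemma tendsto_ellipticalMeasure (hp : 1 ≤ p) (hg : IsEllipticalGenerator p g)
    (hG2 : CondG2 g) {θ τ : Param p} (hθ : θ ∈ paramSpace p) (hτ : τ ∈ paramSpace p)
    {ι : Type*} {l : Filter ι} {θs τs : ι → Param p} (hθs : Tendsto θs l (𝓝 θ))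
    (hτs : Tendsto τs l (𝓝 τ)) (hθm : ∀ᶠ i in l, θs i ∈ paramSpace p)
    (hτm : ∀ᶠ i in l, τs i ∈ paramSpace p) :
    Tendsto (fun i => (ellipticalMeasure g (θs i)).real (ellipsoid (τs i) 1)) l
      (𝓝 ((ellipticalMeasure g θ).real (ellipsoid τ 1))) := by
  refine (continuousWithinAt_ellipticalMeasure hp hg hG2 hθ hτ).tendsto.comp
    (f := fun i => (θs i, τs i)) (tendsto_nhdsWithin_iff.2 ⟨hθs.prodMk_nhds hτs, ?_⟩)
  filter_upwards [hθm, hτm] with i a b using ⟨a, b⟩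

end Density

/-! ### The population MVE is a level set of the true density. -/

section Population

variable {g : ℝ → ℝ}

/-- The level sets `{q_θ ≤ t}` maximize `P_θ(A) - c |A|` for the corresponding level `c`. -/
lemma ellipticalMeasure_sub_volume_le (hp : 1 ≤ p) (hg : IsEllipticalGenerator p g)
    (hG2 : CondG2 g) {θ : Param p} (hθ : θ ∈ paramSpace p) {t : ℝ} (ht : 0 ≤ t)
    {A : Set (Fin p → ℝ)} (hA : MeasurableSet A) (hAv : volume A ≠ ∞) :
    (ellipticalMeasure g θ).real A - (√θ.2.det)⁻¹ * g t * volume.real A ≤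
      (ellipticalMeasure g θ).real {x | quadDist θ x ≤ t} -
        (√θ.2.det)⁻¹ * g t * volume.real {x | quadDist θ x ≤ t} := by
  set c := (√θ.2.det)⁻¹ * g t
  set E := {x | quadDist θ x ≤ t}
  have hE : MeasurableSet E := (isClosed_le (continuous_quadDist θ) continuous_const).measurableSet
  have hEv : volume E ≠ ∞ := (volume_setOf_quadDist_le_lt_top hp hθ ht).ne
  have hint := integrable_density hg hG2 hθ
  have key : ∀ B : Set (Fin p → ℝ), MeasurableSet B → volume B ≠ ∞ →
      (ellipticalMeasure g θ).real B - c * volume.real B =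
        ∫ x, B.indicator (fun x => density g θ x - c) x := by
    intro B hB hBv
    rw [integral_indicator hB, integral_sub hint.integrableOn (integrableOn_const hBv),
      ellipticalMeasure_real hg hG2 hθ hB]
    simp [mul_comm]
  have hi : ∀ B : Set (Fin p → ℝ), MeasurableSet B → volume B ≠ ∞ →
      Integrable (B.indicator (fun x => density g θ x - c)) := fun B hB hBv =>
    (integrable_indicator_iff hB).2 (hint.integrableOn.sub (integrableOn_const hBv))
  rw [key A hA hAv, key E hE hEv]
  -- The integral of `f_θ - c` over a set is largest over a set that contains `{f_θ > c}` and is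
  -- contained in `{f_θ ≥ c}`; the comparison is pointwise.
  refine integral_mono (hi A hA hAv) (hi E hE hEv) fun x => ?_
  by_cases hxE : x ∈ E
  · have h0 : 0 ≤ density g θ x - c := by
      have : g t ≤ g (quadDist θ x) := hg.antitoneOn (quadDist_nonneg hθ x) ht hxE
      have : c ≤ density g θ x := mul_le_mul_of_nonneg_left this (by positivity)
      linarith
    rw [Set.indicator_of_mem hxE]
    exact Set.indicator_le_self' (fun _ _ => h0) x
  · have h0 : density g θ x - c ≤ 0 := by
      have hx : t ≤ quadDist θ x := (not_le.1 hxE).le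
      have : g (quadDist θ x) ≤ g t := hg.antitoneOn ht (quadDist_nonneg hθ x) hx
      have : density g θ x ≤ c := mul_le_mul_of_nonneg_left this (by positivity)
      linarith
    rw [Set.indicator_of_notMem hxE]
    classical
    rw [Set.indicator_apply]
    split_ifs
    exacts [h0, le_rfl]

lemma volume_real_setOf_quadDist_le (hp : 1 ≤ p) {θ : Param p} (hθ : θ ∈ paramSpace p) {t : ℝ}
    (ht : 0 ≤ t) : volume.real {x | quadDist θ x ≤ t} =
      √θ.2.det * √t ^ p * volume.real {y : Fin p → ℝ | y ⬝ᵥ y ≤ 1} := by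
  rw [measureReal_def, volume_setOf_quadDist_le hθ, volume_dotProduct_le hp ht, ENNReal.toReal_mul,
    ENNReal.toReal_mul, ENNReal.toReal_ofReal (by positivity), ENNReal.toReal_ofReal (by positivity),
    measureReal_def, mul_assoc]

lemma volume_real_unitBall_pos : 0 < volume.real {y : Fin p → ℝ | y ⬝ᵥ y ≤ 1} :=
  ENNReal.toReal_pos volume_unitBall_pos.ne' volume_unitBall_lt_top.ne

/-- Every level in `(0, 1)` is the `P_θ`-measure of an ellipsoid with parameter `θ`. -/
lemma exists_ellipticalMeasure_eq (hp : 1 ≤ p) (hg : IsEllipticalGenerator p g)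
    (hG2 : CondG2 g) {θ : Param p} (hθ : θ ∈ paramSpace p) {a : ℝ} (ha : a ∈ Set.Ioo (0 : ℝ) 1) :
    ∃ t > 0, (ellipticalMeasure g θ).real {x | quadDist θ x ≤ t} = a := by
  have := hg.isProbabilityMeasure θ hθ
  set F : ℝ → ℝ := fun t => (ellipticalMeasure g θ).real {x | quadDist θ x ≤ t} with hF
  have hmono : Monotone F := fun s t hst => by
    have hsub : {x | quadDist θ x ≤ s} ⊆ {x | quadDist θ x ≤ t} :=
      fun x (hx : quadDist θ x ≤ s) => (hx.trans hst : quadDist θ x ≤ t)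
    exact measureReal_mono hsub
  have hcont : ContinuousOn F (Set.Ioi 0) := by
    intro t ht
    have ht : 0 < t := ht
    have heq : ∀ s, 0 < s → F s = (ellipticalMeasure g θ).real (ellipsoid (θ.1, s • θ.2) 1) := by
      intro s hs
      have : {x | quadDist θ x ≤ s} = ellipsoid (θ.1, s • θ.2) 1 := by
        rw [setOf_quadDist_le_eq_ellipsoid θ hs.le, ellipsoid_eq_smul θ (Real.sqrt_pos.2 hs),
          Real.sq_sqrt hs.le]
      rw [hF, ← this]
    have hc : Continuous fun s : ℝ => (θ.1, s • θ.2) := by fun_prop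
    have := tendsto_ellipticalMeasure hp hg hG2 hθ (smul_mem_paramSpace hθ ht)
      (l := 𝓝[Set.Ioi 0] t) (θs := fun _ => θ) (τs := fun s => (θ.1, s • θ.2)) tendsto_const_nhds
      ((hc.tendsto t).mono_left nhdsWithin_le_nhds) (Eventually.of_forall fun _ => hθ)
      (by filter_upwards [self_mem_nhdsWithin] with s hs using smul_mem_paramSpace hθ hs)
    rw [ContinuousWithinAt, heq t ht]
    refine this.congr' ?_
    filter_upwards [self_mem_nhdsWithin] with s hs using (heq s hs).symm
  have h2 : ∃ t > 0, a < F t := by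
    by_contra! h
    have hU : ⋃ n : ℕ, {x | quadDist θ x ≤ (n : ℝ)} = Set.univ := by
      refine Set.eq_univ_of_forall fun x => ?_
      obtain ⟨n, hn⟩ := exists_nat_ge (quadDist θ x)
      exact Set.mem_iUnion.2 ⟨n, hn⟩
    have ht := tendsto_measure_iUnion_atTop (μ := ellipticalMeasure g θ)
      (s := fun n : ℕ => {x | quadDist θ x ≤ (n : ℝ)}) (fun m n hmn x hx =>
        le_trans (show quadDist θ x ≤ m from hx) (by exact_mod_cast hmn))
    rw [hU, measure_univ] at ht
    have ht' := (ENNReal.tendsto_toReal ENNReal.one_ne_top).comp ht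
    have : (1 : ℝ) ≤ a := by
      refine le_of_tendsto' ht' fun n => ?_
      exact (hmono (show (n : ℝ) ≤ n + 1 by linarith)).trans (h _ (by positivity))
    linarith [ha.2]
  have h1 : ∃ t > 0, F t < a := by
    by_contra! h
    have hI : ⋂ n : ℕ, {x | quadDist θ x ≤ 1 / ((n : ℝ) + 1)} = {x | quadDist θ x = 0} := by
      ext x
      simp only [Set.mem_iInter, Set.mem_ofPred_eq]
      constructor
      · intro hx
        exact le_antisymm (ge_of_tendsto' tendsto_one_div_add_atTop_nhds_zero_nat hx)
          (quadDist_nonneg hθ x)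
      · intro hx n
        rw [hx]; positivity
    have ht := tendsto_measure_iInter_atTop (μ := ellipticalMeasure g θ)
      (s := fun n : ℕ => {x | quadDist θ x ≤ 1 / ((n : ℝ) + 1)})
      (fun n => (isClosed_le (continuous_quadDist θ)
        continuous_const).measurableSet.nullMeasurableSet)
      (fun m n hmn x hx => le_trans (show quadDist θ x ≤ 1 / ((n : ℝ) + 1) from hx)
        (by gcongr)) ⟨0, measure_ne_top _ _⟩
    rw [hI, ellipticalMeasure_null (volume_quadDist_eq hp hθ 0)] at ht
    have ht' := (ENNReal.tendsto_toReal ENNReal.zero_ne_top).comp ht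
    have : a ≤ 0 := ge_of_tendsto' ht' fun n => h _ (by positivity)
    linarith [ha.1]
  obtain ⟨t1, ht1, h1⟩ := h1
  obtain ⟨t2, ht2, h2⟩ := h2
  have h12 : t1 ≤ t2 := by
    by_contra! hlt
    linarith [hmono hlt.le]
  obtain ⟨t, ht, hta⟩ := intermediate_value_Icc h12
    (hcont.mono fun t ht => lt_of_lt_of_le ht1 ht.1) ⟨h1.le, h2.le⟩
  exact ⟨t, lt_of_lt_of_le ht1 ht.1, hta⟩

lemma contaminated_apply (π : ℝ) (θ : Param p) (Q : Measure (Fin p → ℝ)) (A : Set (Fin p → ℝ)) :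
    contaminated g π θ Q A =
      ENNReal.ofReal (1 - π) * ellipticalMeasure g θ A + ENNReal.ofReal π * Q A := by
  simp [contaminated]

lemma IsGEM.isProbabilityMeasure_contaminated {π : ℝ} {θ : Param p} {Q : Measure (Fin p → ℝ)}
    (hg : IsEllipticalGenerator p g) (h : IsGEM g π θ Q) :
    IsProbabilityMeasure (contaminated g π θ Q) := by
  have := hg.isProbabilityMeasure θ h.mem_paramSpace
  have := h.isProbabilityMeasure
  refine ⟨?_⟩
  have h0 := h.nonneg
  have h1 := h.lt_one
  rw [contaminated_apply, measure_univ, measure_univ, mul_one, mul_one,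
    ← ENNReal.ofReal_add (by linarith) h0]
  simp

/-- What is needed about the population MVE: it is the level set `{q_{θ₀} ≤ t₀}`. -/
structure IsPopulationLevel (g : ℝ → ℝ) (π : ℝ) (θ : Param p) (Q : Measure (Fin p → ℝ))
    (t : ℝ) : Prop where
  pos : 0 < t
  eq_of_isMVE : ∀ A, IsMVE (contaminated g π θ Q) A → A = {x | quadDist θ x ≤ t}
  isMVE : IsMVE (contaminated g π θ Q) {x | quadDist θ x ≤ t}
  measure_eq : (1 - π) * (ellipticalMeasure g θ).real {x | quadDist θ x ≤ t} = 1 / 2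
  null : Q {x | quadDist θ x ≤ t} = 0
  generator_pos : 0 < g t
  lt_measure : ∀ s, t < s → 1 / 2 < contaminated g π θ Q {x | quadDist θ x < s}

/-- Choose `t` so that `(1 - π) P_θ(E) = 1/2`, possible as `π < 1/2`. The MVE `A` is not charged by
`Q`, so `P_θ(A) ≥ P_θ(E)`, and the extremality of level sets gives `|E| ≤ |A|`. Hence `E` is itself
an MVE, and uniqueness identifies the two. -/
lemma exists_isPopulationLevel (hp : 1 ≤ p) (hg : IsEllipticalGenerator p g)
    (hG2 : CondG2 g) {π : ℝ} (hπ : π < 1 / 2) {θ : Param p} {Q : Measure (Fin p → ℝ)}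
    (hGEM : IsGEM g π θ Q) (hMVE : ∃! A, IsMVE (contaminated g π θ Q) A) :
    ∃ t, IsPopulationLevel g π θ Q t := by
  have hθ := hGEM.mem_paramSpace
  have h0 := hGEM.nonneg
  have hP := hg.isProbabilityMeasure θ hθ
  have hw : 0 < 1 - π := by linarith
  obtain ⟨t, ht, hta⟩ := exists_ellipticalMeasure_eq hp hg hG2 hθ (a := 1 / (2 * (1 - π)))
    ⟨by positivity, by rw [div_lt_one (by positivity)]; linarith⟩
  set E := {x | quadDist θ x ≤ t} with hEdef
  have hE : MeasurableSet E := (isClosed_le (continuous_quadDist θ) continuous_const).measurableSet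
  have hEell : IsEllipsoid E :=
    ⟨θ, hθ, √t, Real.sqrt_pos.2 ht, setOf_quadDist_le_eq_ellipsoid θ ht.le⟩
  have hwE : (1 - π) * (ellipticalMeasure g θ).real E = 1 / 2 := by
    rw [hta]; field_simp
  have hhalf : ENNReal.ofReal (1 / 2) = 1 / 2 := by
    rw [ENNReal.ofReal_div_of_pos (by norm_num)]; simp
  have hwE' : ENNReal.ofReal (1 - π) * ellipticalMeasure g θ E = 1 / 2 := by
    rw [← ofReal_measureReal, ← ENNReal.ofReal_mul hw.le, hwE, hhalf]
  -- If `g t = 0`, then `P_θ(E) = 1`, and `(1 - π) P_θ(E) = 1/2` contradicts `π < 1/2`.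
  have hgt : 0 < g t := by
    by_contra! hgt
    have hgt : g t = 0 := le_antisymm hgt (hg.nonneg t ht.le)
    have hz : ellipticalMeasure g θ Eᶜ = 0 := by
      rw [ellipticalMeasure_apply hg hG2 hθ hE.compl, setIntegral_eq_zero_of_forall_eq_zero,
        ENNReal.ofReal_zero]
      intro x hx
      have hx : t < quadDist θ x := not_le.1 hx
      have : g (quadDist θ x) = 0 :=
        le_antisymm (hgt ▸ hg.antitoneOn ht.le (quadDist_nonneg hθ x) hx.le)
          (hg.nonneg _ (quadDist_nonneg hθ x))
      simp [density, this]
    have h1 := (prob_compl_eq_zero_iff hE).1 hz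
    rw [measureReal_def, h1, ENNReal.toReal_one, mul_one] at hwE
    linarith
  have hc : 0 < (√θ.2.det)⁻¹ * g t := mul_pos (inv_pos.2 (Real.sqrt_pos.2 hθ.det_pos)) hgt
  obtain ⟨A, hA, huniq⟩ := hMVE
  have hPE : 1 / 2 ≤ contaminated g π θ Q E := by
    rw [contaminated_apply, hwE']; exact le_self_add
  have hvol : volume E ≤ volume A := by
    obtain ⟨τ, hτ, hAτ⟩ := isEllipsoid_iff.1 hA.1
    have hAm : MeasurableSet A := hAτ ▸ (isClosed_ellipsoid τ 1).measurableSet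
    have hAv : volume A ≠ ∞ := by
      rw [hAτ, ellipsoid]
      exact (volume_setOf_quadDist_le_lt_top hp hτ (by norm_num)).ne
    have hPA := hA.2.1
    rw [contaminated_apply, hGEM.null_of_isMVE A hA, mul_zero, add_zero, ← ofReal_measureReal,
      ← ENNReal.ofReal_mul hw.le, ← hhalf, ENNReal.ofReal_le_ofReal_iff (by positivity)] at hPA
    have h1 : (ellipticalMeasure g θ).real E ≤ (ellipticalMeasure g θ).real A :=
      le_of_mul_le_mul_left (hwE.trans_le hPA) hw
    have h2 := ellipticalMeasure_sub_volume_le hp hg hG2 hθ ht.le hAm hAv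
    rw [← ENNReal.toReal_le_toReal (volume_setOf_quadDist_le_lt_top hp hθ ht.le).ne hAv]
    exact le_of_mul_le_mul_left (by simp only [measureReal_def] at h1 h2 ⊢; linarith) hc
  have hEMVE : IsMVE (contaminated g π θ Q) E :=
    ⟨hEell, hPE, fun B hB hPB => hvol.trans (hA.2.2 B hB hPB)⟩
  refine ⟨t, ht, fun B hB => (huniq B hB).trans (huniq E hEMVE).symm, hEMVE, hwE,
    hGEM.null_of_isMVE E hEMVE, hgt, fun s hs => ?_⟩
  -- By continuity `g` stays positive slightly beyond `t`. Extremality at level `u` then makes the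
  -- mass grow strictly with the volume.
  obtain ⟨u, ⟨htu, hus⟩, hgu⟩ : ∃ u ∈ Set.Ioo t s, 0 < g u := by
    have hcont : Tendsto (fun u => g (max u 0)) (𝓝[>] t) (𝓝 (g (max t 0))) :=
      ((continuous_comp_max hG2).tendsto t).mono_left nhdsWithin_le_nhds
    rw [max_eq_left ht.le] at hcont
    obtain ⟨u, hu, hgu⟩ := ((hcont.eventually_const_lt hgt).and (Ioo_mem_nhdsGT hs)).exists.imp
      fun u hu => And.intro hu.2 hu.1
    rw [max_eq_left (ht.trans hu.1).le] at hgu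
    exact ⟨u, hu, hgu⟩
  have hb := ellipticalMeasure_sub_volume_le hp hg hG2 hθ (ht.trans htu).le hE
    (volume_setOf_quadDist_le_lt_top hp hθ ht.le).ne
  have hcu : 0 < (√θ.2.det)⁻¹ * g u := mul_pos (inv_pos.2 (Real.sqrt_pos.2 hθ.det_pos)) hgu
  have hv : volume.real E < volume.real {x | quadDist θ x ≤ u} := by
    rw [hEdef, volume_real_setOf_quadDist_le hp hθ ht.le,
      volume_real_setOf_quadDist_le hp hθ (ht.trans htu).le]
    refine mul_lt_mul_of_pos_right ?_ volume_real_unitBall_pos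
    refine mul_lt_mul_of_pos_left ?_ (Real.sqrt_pos.2 hθ.det_pos)
    exact pow_lt_pow_left₀ (Real.sqrt_lt_sqrt ht.le htu) (Real.sqrt_nonneg _) (by omega)
  have hlt : (ellipticalMeasure g θ).real E <
      (ellipticalMeasure g θ).real {x | quadDist θ x ≤ u} := by nlinarith
  have hsub : {x | quadDist θ x ≤ u} ⊆ {x | quadDist θ x < s} :=
    fun x (hx : quadDist θ x ≤ u) => (hx.trans_lt hus : quadDist θ x < s)
  calc (1 / 2 : ℝ≥0∞) = ENNReal.ofReal ((1 - π) * (ellipticalMeasure g θ).real E) := by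
        rw [hwE, hhalf]
    _ < ENNReal.ofReal ((1 - π) * (ellipticalMeasure g θ).real {x | quadDist θ x ≤ u}) := by
        rw [ENNReal.ofReal_lt_ofReal_iff_of_nonneg (by positivity)]
        exact mul_lt_mul_of_pos_left hlt hw
    _ = ENNReal.ofReal (1 - π) * ellipticalMeasure g θ {x | quadDist θ x ≤ u} := by
        rw [ENNReal.ofReal_mul hw.le, ofReal_measureReal]
    _ ≤ contaminated g π θ Q {x | quadDist θ x ≤ u} := by
        rw [contaminated_apply]; exact le_self_add
    _ ≤ _ := measure_mono hsub

end Population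

/-! ### Almost sure weak convergence of the empirical measures. -/

section Empirical

lemma empirical_apply (x : ℕ → Fin p → ℝ) (n : ℕ) (s : Set (Fin p → ℝ)) :
    empirical x n s = (n : ℝ≥0∞)⁻¹ * ∑ i ∈ Finset.range n, s.indicator 1 (x i) := by
  simp [empirical, Measure.dirac_apply]

lemma empirical_real (x : ℕ → Fin p → ℝ) (n : ℕ) (s : Set (Fin p → ℝ)) :
    (empirical x n).real s = (∑ i ∈ Finset.range n, s.indicator (fun _ => (1 : ℝ)) (x i)) / n := by
  classical
  rw [measureReal_def, empirical_apply, ENNReal.toReal_mul, ENNReal.toReal_sum, ENNReal.toReal_inv,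
    ENNReal.toReal_natCast, inv_mul_eq_div]
  · congr 1
    refine Finset.sum_congr rfl fun i _ => ?_
    by_cases h : x i ∈ s <;> simp [h]
  · intro i _
    by_cases h : x i ∈ s <;> simp [h]

lemma isProbabilityMeasure_empirical (x : ℕ → Fin p → ℝ) {n : ℕ} (hn : n ≠ 0) :
    IsProbabilityMeasure (empirical x n) := by
  refine ⟨?_⟩
  rw [empirical_apply]
  simp [ENNReal.inv_mul_cancel (show (n : ℝ≥0∞) ≠ 0 by exact_mod_cast hn)]

lemma integral_empirical (x : ℕ → Fin p → ℝ) (n : ℕ) (f : (Fin p → ℝ) → ℝ) :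
    ∫ y, f y ∂(empirical x n) = (∑ i ∈ Finset.range n, f (x i)) / n := by
  rw [empirical, integral_smul_measure, integral_finsetSum_measure]
  · simp [inv_mul_eq_div]
  · intro i _
    exact integrable_dirac (by simp)

/-- Weak convergence of the empirical measures of a sequence, in the form used below. -/
structure EmpiricalLimit (x : ℕ → Fin p → ℝ) (P : Measure (Fin p → ℝ)) : Prop where
  isProbabilityMeasure : IsProbabilityMeasure P
  lt_of_isOpen : ∀ G, IsOpen G → ∀ c : ℝ, c < P.real G →
    ∀ᶠ n in atTop, c < (empirical x n).real G
  lt_of_isClosed : ∀ F, IsClosed F → ∀ c : ℝ, P.real F < c →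
    ∀ᶠ n in atTop, (empirical x n).real F < c
  tendsto_integral : ∀ f : (Fin p → ℝ) → ℝ, Continuous f → (∃ C, ∀ y, |f y| ≤ C) →
    Tendsto (fun n => (∑ i ∈ Finset.range n, f (x i)) / n) atTop (𝓝 (∫ y, f y ∂P))

lemma empiricalLimit_of_tendsto {x : ℕ → Fin p → ℝ} {P : Measure (Fin p → ℝ)}
    [hP : IsProbabilityMeasure P] {S : Set (Set (Fin p → ℝ))} (hS : IsPiSystem S)
    (hmeas : ∀ s ∈ S, MeasurableSet s)
    (hbasis : ∀ u : Set (Fin p → ℝ), IsOpen u → ∀ y ∈ u, ∃ s ∈ S, s ∈ 𝓝 y ∧ s ⊆ u)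
    (h : ∀ s ∈ S, Tendsto (fun n => (empirical x n).real s) atTop (𝓝 (P.real s))) :
    EmpiricalLimit x P := by
  let P' : ProbabilityMeasure (Fin p → ℝ) := ⟨P, hP⟩
  -- The index is shifted because the empirical measure of zero observations is the zero measure.
  let E : ℕ → ProbabilityMeasure (Fin p → ℝ) := fun n =>
    ⟨empirical x (n + 1), isProbabilityMeasure_empirical x n.succ_ne_zero⟩
  have hE : Tendsto E atTop (𝓝 P') := by
    refine hS.tendsto_probabilityMeasure_of_tendsto_of_mem hmeas hbasis fun s hs => ?_
    rw [← NNReal.tendsto_coe]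
    exact (h s hs).comp (tendsto_add_atTop_nat 1)
  have hint : ∀ f : (Fin p → ℝ) → ℝ, Continuous f → (∃ C, ∀ y, |f y| ≤ C) →
      Tendsto (fun n => (∑ i ∈ Finset.range n, f (x i)) / n) atTop (𝓝 (∫ y, f y ∂P)) := by
    rintro f hf ⟨C, hC⟩
    have := (ProbabilityMeasure.tendsto_iff_forall_integral_tendsto.1 hE)
      (BoundedContinuousFunction.ofNormedAddCommGroup f hf C hC)
    rw [← tendsto_add_atTop_iff_nat 1]
    refine this.congr fun n => ?_
    rw [← integral_empirical]
    rfl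
  have hopen : ∀ G, IsOpen G → ∀ c : ℝ, c < P.real G →
      ∀ᶠ n in atTop, c < (empirical x n).real G := by
    intro G hG c hc
    rcases lt_or_ge c 0 with h0 | h0
    · exact Eventually.of_forall fun n => h0.trans_le measureReal_nonneg
    have h1 := ProbabilityMeasure.le_liminf_measure_open_of_tendsto hE hG
    have h2 : ENNReal.ofReal c < P G := (ENNReal.ofReal_lt_iff_lt_toReal h0 (measure_ne_top _ _)).2 hc
    have h3 := eventually_lt_of_lt_liminf (h2.trans_le h1)
    rw [eventually_atTop] at h3 ⊢
    obtain ⟨N, hN⟩ := h3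
    refine ⟨N + 1, fun n hn => ?_⟩
    obtain ⟨m, rfl⟩ : ∃ m, n = m + 1 := ⟨n - 1, by omega⟩
    have := isProbabilityMeasure_empirical x m.succ_ne_zero
    exact (ENNReal.ofReal_lt_iff_lt_toReal h0 (measure_ne_top _ _)).1 (hN m (by omega))
  refine ⟨hP, hopen, fun F hF c hc => ?_, hint⟩
  have h1 := hopen Fᶜ hF.isOpen_compl (1 - c) (by
    rw [probReal_compl_eq_one_sub hF.measurableSet]; linarith)
  filter_upwards [h1, eventually_ne_atTop 0] with n hn hn0
  have := isProbabilityMeasure_empirical x hn0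
  rw [probReal_compl_eq_one_sub hF.measurableSet] at hn
  linarith

/-- Almost sure weak convergence of empirical measures. -/
lemma ae_empiricalLimit {Ω : Type*} [MeasurableSpace Ω] (μ : Measure Ω) [IsProbabilityMeasure μ]
    (X : ℕ → Ω → Fin p → ℝ) (hXmeas : ∀ i, Measurable (X i)) (hXindep : iIndepFun X μ)
    {P : Measure (Fin p → ℝ)} [IsProbabilityMeasure P] (hXlaw : ∀ i, μ.map (X i) = P) :
    ∀ᵐ ω ∂μ, EmpiricalLimit (fun i => X i ω) P := by
  classical
  let B := TopologicalSpace.countableBasis (Fin p → ℝ)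
  have hB := TopologicalSpace.isBasis_countableBasis (Fin p → ℝ)
  -- The algebra generated by a countable basis is countable, so one null set serves all its members
  -- in the law of large numbers; it is also closed under intersections.
  let S := generateSetAlgebra B
  have hSc : S.Countable := countable_generateSetAlgebra
    (TopologicalSpace.countable_countableBasis _)
  have hmeas : ∀ s ∈ S, MeasurableSet s := by
    intro s hs
    induction hs with
    | base s hs => exact (hB.isOpen hs).measurableSet
    | empty => exact MeasurableSet.empty
    | compl s _ h => exact h.compl
    | union s t _ _ hs ht => exact hs.union ht
  have hlln : ∀ s ∈ S, ∀ᵐ ω ∂μ, Tendsto (fun n => (empirical (fun i => X i ω) n).real s) atTop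
      (𝓝 (P.real s)) := by
    intro s hs
    have hsm := hmeas s hs
    have hf : Measurable (s.indicator fun _ => (1 : ℝ)) := measurable_const.indicator hsm
    have hident : ∀ i, IdentDistrib (X i) (X 0) μ μ := fun i =>
      ⟨(hXmeas i).aemeasurable, (hXmeas 0).aemeasurable, by rw [hXlaw, hXlaw]⟩
    have hint : Integrable (fun ω => s.indicator (fun _ => (1 : ℝ)) (X 0 ω)) μ := by
      refine Integrable.of_bound (hf.comp (hXmeas 0)).aestronglyMeasurable 1
        (Eventually.of_forall fun ω => ?_)
      by_cases h : X 0 ω ∈ s <;> simp [h]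
    have := strong_law_ae_real (fun i ω => s.indicator (fun _ => (1 : ℝ)) (X i ω)) hint
      (fun i j hij => (hXindep.indepFun hij).comp hf hf) (fun i => (hident i).comp hf)
    have hval : ∫ ω, s.indicator (fun _ => (1 : ℝ)) (X 0 ω) ∂μ = P.real s := by
      rw [← integral_map (hXmeas 0).aemeasurable hf.aestronglyMeasurable, hXlaw,
        integral_indicator hsm]
      simp
    rw [hval] at this
    filter_upwards [this] with ω hω
    simpa only [empirical_real] using hω
  have hall := (ae_ball_iff hSc).2 hlln
  filter_upwards [hall] with ω hω
  refine empiricalLimit_of_tendsto (S := S) ?_ hmeas ?_ hω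
  · intro s hs t ht _
    exact isSetAlgebra_generateSetAlgebra.inter_mem hs ht
  · intro u hu y hy
    obtain ⟨s, hs, hys, hsu⟩ := hB.exists_subset_of_mem_open hy hu
    exact ⟨s, generateSetAlgebra.base s hs, (hB.isOpen hs).mem_nhds hys, hsu⟩

end Empirical

/-! ### Compactness along ultrafilters and thin slabs. -/

section Limits

lemma exists_tendsto_of_abs_le {ι : Type*} (U : Ultrafilter ι) {a : ι → ℝ} {C : ℝ}
    (h : ∀ᶠ n in U, |a n| ≤ C) : ∃ L, |L| ≤ C ∧ Tendsto a U (𝓝 L) := by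
  obtain ⟨L, hL, hl⟩ := (isCompact_Icc (a := -C) (b := C)).ultrafilter_le_nhds (U.map a)
    (by
      rw [le_principal_iff]
      exact h.mono fun n hn => abs_le.1 hn)
  exact ⟨L, abs_le.2 hL, hl⟩

lemma exists_tendsto_pi {ι : Type*} (U : Ultrafilter ι) {a : ι → Fin p → ℝ} {C : ℝ}
    (h : ∀ᶠ n in U, ‖a n‖ ≤ C) : ∃ L, Tendsto a U (𝓝 L) := by
  have : ∀ i, ∃ L, Tendsto (fun n => a n i) U (𝓝 L) := fun i =>
    (exists_tendsto_of_abs_le U (C := C) (h.mono fun n hn =>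
      (norm_le_pi_norm (a n) i).trans hn)).imp fun _ hL => hL.2
  choose L hL using this
  exact ⟨L, tendsto_pi_nhds.2 hL⟩

/-- Relative compactness of sets of parameters with bounded location and with scatter matrices
bounded above and away from degeneracy. -/
lemma exists_tendsto_param {ι : Type*} (U : Ultrafilter ι) {θ : ι → Param p} {C T c : ℝ}
    (hc : 0 < c) (hθ : ∀ᶠ n in U, θ n ∈ paramSpace p) (hC : ∀ᶠ n in U, ‖(θ n).1‖ ≤ C)
    (hT : ∀ᶠ n in U, (θ n).2.trace ≤ T)
    (hlow : ∀ᶠ n in U, ∀ y, c * (y ⬝ᵥ y) ≤ y ⬝ᵥ ((θ n).2 *ᵥ y)) :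
    ∃ σ ∈ paramSpace p, Tendsto θ U (𝓝 σ) := by
  obtain ⟨m, hm⟩ := exists_tendsto_pi U hC
  have : ∀ i j, ∃ L, Tendsto (fun n => (θ n).2 i j) U (𝓝 L) := fun i j =>
    (exists_tendsto_of_abs_le U (C := T) (by
      filter_upwards [hθ, hT] with n h1 h2 using (abs_apply_le_trace h1 i j).trans h2)).imp
        fun _ hL => hL.2
  choose S hS using this
  have hS' : Tendsto (fun n => (θ n).2) U (𝓝 (Matrix.of S)) :=
    tendsto_pi_nhds.2 fun i => tendsto_pi_nhds.2 fun j => hS i j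
  refine ⟨(m, Matrix.of S), ?_, hm.prodMk_nhds hS'⟩
  refine Matrix.PosDef.of_dotProduct_mulVec_pos ?_ fun y hy => ?_
  · ext i j
    have h1 : ∀ᶠ n in U, (θ n).2 j i = (θ n).2 i j := by
      filter_upwards [hθ] with n hn using by simpa using Matrix.IsHermitian.apply hn.1 i j
    simpa using tendsto_nhds_unique_of_eventuallyEq (hS j i) (hS i j) h1
  · have hy' : 0 < y ⬝ᵥ y := lt_of_le_of_ne (dotProduct_self_nonneg' y)
      fun h => hy (dotProduct_self_eq_zero.1 h.symm)
    have hcont : Continuous fun M : Matrix (Fin p) (Fin p) ℝ => y ⬝ᵥ (M *ᵥ y) := by fun_prop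
    have h1 := ge_of_tendsto ((hcont.tendsto _).comp hS') (hlow.mono fun n hn => hn y)
    rw [star_trivial]
    exact (mul_pos hc hy').trans_le h1

lemma abs_dotProduct_le (v x : Fin p → ℝ) : |v ⬝ᵥ x| ≤ p * (‖v‖ * ‖x‖) := by
  calc |v ⬝ᵥ x| ≤ ∑ i, |v i * x i| := Finset.abs_sum_le_sum_abs _ _
    _ ≤ ∑ _i : Fin p, ‖v‖ * ‖x‖ := by
        refine Finset.sum_le_sum fun i _ => ?_
        rw [abs_mul]
        exact mul_le_mul (norm_le_pi_norm v i) (norm_le_pi_norm x i) (abs_nonneg _) (norm_nonneg _)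
    _ = _ := by simp

/-- Continuity from above. It trades the mass of a limit set for that of a slightly larger closed
set, whose empirical mass weak convergence bounds from above. -/
lemma exists_measureReal_lt_of_iInter {P : Measure (Fin p → ℝ)} [IsFiniteMeasure P]
    {f : (Fin p → ℝ) → ℝ} (hf : Continuous f) {F : Set (Fin p → ℝ)} (hF : IsClosed F) (a : ℝ)
    {b : ℝ} (hb : P.real (F ∩ {x | f x ≤ a}) < b) :
    ∃ η > 0, P.real (F ∩ {x | f x ≤ a + η}) < b := by
  have hI : ⋂ n : ℕ, F ∩ {x | f x ≤ a + 1 / ((n : ℝ) + 1)} = F ∩ {x | f x ≤ a} := by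
    rw [← Set.inter_iInter]
    congr 1
    ext x
    simp only [Set.mem_iInter, Set.mem_ofPred_eq]
    constructor
    · intro hx
      have : Tendsto (fun n : ℕ => a + 1 / ((n : ℝ) + 1)) atTop (𝓝 (a + 0)) :=
        tendsto_const_nhds.add tendsto_one_div_add_atTop_nhds_zero_nat
      rw [add_zero] at this
      exact ge_of_tendsto' this hx
    · intro hx n
      have : 0 ≤ 1 / ((n : ℝ) + 1) := by positivity
      linarith
  have ht := tendsto_measure_iInter_atTop (μ := P)
    (s := fun n : ℕ => F ∩ {x | f x ≤ a + 1 / ((n : ℝ) + 1)})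
    (fun n => (hF.inter (isClosed_le hf continuous_const)).measurableSet.nullMeasurableSet)
    (fun m n hmn x hx => ⟨hx.1, le_trans (show f x ≤ a + 1 / ((n : ℝ) + 1) from hx.2)
      (by gcongr)⟩) ⟨0, measure_ne_top _ _⟩
  rw [hI] at ht
  have ht' := (ENNReal.tendsto_toReal (measure_ne_top _ _)).comp ht
  obtain ⟨n, hn⟩ := (ht'.eventually_lt_const hb).exists
  exact ⟨1 / ((n : ℝ) + 1), by positivity, hn⟩

lemma exists_measureReal_norm_ge_lt (P : Measure (Fin p → ℝ)) [IsFiniteMeasure P] {ε : ℝ}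
    (hε : 0 < ε) : ∃ R, P.real {x | R ≤ ‖x‖} < ε := by
  have hI : ⋂ n : ℕ, {x : Fin p → ℝ | (n : ℝ) ≤ ‖x‖} = ∅ := by
    refine Set.eq_empty_of_forall_notMem fun x hx => ?_
    obtain ⟨n, hn⟩ := exists_nat_gt ‖x‖
    exact absurd (Set.mem_iInter.1 hx n) (not_le.2 hn)
  have ht := tendsto_measure_iInter_atTop (μ := P)
    (s := fun n : ℕ => {x : Fin p → ℝ | (n : ℝ) ≤ ‖x‖})
    (fun n => (isClosed_le continuous_const continuous_norm).measurableSet.nullMeasurableSet)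
    (fun m n hmn x hx => le_trans (by exact_mod_cast hmn) (show (n : ℝ) ≤ ‖x‖ from hx))
    ⟨0, measure_ne_top _ _⟩
  rw [hI, measure_empty] at ht
  have ht' := (ENNReal.tendsto_toReal ENNReal.zero_ne_top).comp ht
  obtain ⟨n, hn⟩ := (ht'.eventually_lt_const hε).exists
  exact ⟨n, hn⟩

lemma volume_hyperplane {v : Fin p → ℝ} (hv : v ⬝ᵥ v = 1) (c : ℝ) :
    volume {x : Fin p → ℝ | v ⬝ᵥ x = c} = 0 := by
  let L : (Fin p → ℝ) →ₗ[ℝ] ℝ :=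
    { toFun := fun x => v ⬝ᵥ x
      map_add' := fun x y => dotProduct_add _ _ _
      map_smul' := fun a x => dotProduct_smul _ _ _ }
  have h1 : {x : Fin p → ℝ | v ⬝ᵥ x = c} = (fun x => x + -(c • v)) ⁻¹' (LinearMap.ker L : Set _) := by
    ext x
    simp only [Set.mem_ofPred_eq, Set.mem_preimage, SetLike.mem_coe, LinearMap.mem_ker]
    change _ ↔ v ⬝ᵥ (x + -(c • v)) = 0
    rw [dotProduct_add, dotProduct_neg, dotProduct_smul, hv, smul_eq_mul, mul_one,
      ← sub_eq_add_neg, sub_eq_zero]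
  rw [h1, measure_preimage_add_right]
  refine Measure.addHaar_submodule _ _ fun h => ?_
  have : v ∈ LinearMap.ker L := h ▸ Submodule.mem_top
  have h2 : v ⬝ᵥ v = 0 := this
  linarith

variable {x : ℕ → Fin p → ℝ} {P : Measure (Fin p → ℝ)}

/-- Along an ultrafilter, thin slabs have asymptotically no more empirical mass than
hyperplanes. -/
lemma EmpiricalLimit.exists_slab_lt (hx : EmpiricalLimit x P) {U : Ultrafilter ℕ}
    (hU : (U : Filter ℕ) ≤ atTop) {F : Set (Fin p → ℝ)} (hF : IsClosed F) {β : ℝ}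
    (hβ : ∀ v c, v ⬝ᵥ v = 1 → P.real (F ∩ {y | v ⬝ᵥ y = c}) ≤ β)
    {v : ℕ → Fin p → ℝ} (c : ℕ → ℝ) (hv : ∀ᶠ n in U, v n ⬝ᵥ v n = 1) {ε : ℝ} (hε : 0 < ε) :
    ∃ δ > 0, ∀ᶠ n in U, (empirical x n).real (F ∩ {y | |v n ⬝ᵥ y - c n| ≤ δ}) < β + ε := by
  have := hx.isProbabilityMeasure
  obtain ⟨R, hR⟩ := exists_measureReal_norm_ge_lt P (half_pos hε)
  have hRn : ∀ᶠ n in U, (empirical x n).real {y | R ≤ ‖y‖} < ε / 2 :=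
    hU (hx.lt_of_isClosed _ (isClosed_le continuous_const continuous_norm) _ hR)
  have hprob : ∀ᶠ n in U, IsProbabilityMeasure (empirical x n) :=
    hU ((eventually_ne_atTop 0).mono fun n hn => isProbabilityMeasure_empirical x hn)
  have hvn : ∀ᶠ n in U, ‖v n‖ ≤ 1 := by
    filter_upwards [hv] with n hn
    have := norm_sq_le_dotProduct_self (v n)
    rw [hn] at this
    exact (sq_le_one_iff₀ (norm_nonneg _)).1 this
  obtain ⟨w, hw⟩ := exists_tendsto_pi U hvn
  have hww : w ⬝ᵥ w = 1 := by
    have hcont : Continuous fun y : Fin p → ℝ => y ⬝ᵥ y := by fun_prop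
    exact tendsto_nhds_unique_of_eventuallyEq ((hcont.tendsto w).comp hw) tendsto_const_nhds hv
  have hR0 : 0 ≤ max R 0 := le_max_right _ _
  -- Either the offsets converge along `U`, and within a large ball the slabs lie in a slab around a
  -- limiting hyperplane, or they are unbounded and the slabs leave that ball.
  by_cases hb : ∃ C, ∀ᶠ n in U, |c n| ≤ C
  · obtain ⟨C, hC⟩ := hb
    obtain ⟨b, -, hcb⟩ := exists_tendsto_of_abs_le U hC
    have h0 : P.real (F ∩ {y | |w ⬝ᵥ y - b| ≤ 0}) < β + ε / 2 := by
      have : {y : Fin p → ℝ | |w ⬝ᵥ y - b| ≤ 0} = {y | w ⬝ᵥ y = b} := by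
        ext y; simp [sub_eq_zero]
      rw [this]
      linarith [hβ w b hww]
    obtain ⟨η, hη, hlt⟩ := exists_measureReal_lt_of_iInter (f := fun y => |w ⬝ᵥ y - b|)
      (by fun_prop) hF 0 h0
    rw [zero_add] at hlt
    have hcl : IsClosed (F ∩ {y | |w ⬝ᵥ y - b| ≤ η}) :=
      hF.inter (isClosed_le (by fun_prop) continuous_const)
    refine ⟨η / 2, half_pos hη, ?_⟩
    have hnear : ∀ᶠ n in U, p * (‖w - v n‖ * max R 0) + |c n - b| < η / 2 := by
      have h1 : Tendsto (fun n => p * (‖w - v n‖ * max R 0) + |c n - b|) U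
          (𝓝 (p * (‖w - w‖ * max R 0) + |b - b|)) :=
        (((tendsto_const_nhds.sub hw).norm.mul_const _).const_mul _).add
          (hcb.sub tendsto_const_nhds).abs
      refine h1.eventually_lt_const ?_
      simpa using hη
    filter_upwards [hRn, hU (hx.lt_of_isClosed _ hcl _ hlt), hnear, hprob] with n h1 h2 h3 h4
    have hsub : F ∩ {y | |v n ⬝ᵥ y - c n| ≤ η / 2} ⊆
        (F ∩ {y | |w ⬝ᵥ y - b| ≤ η}) ∪ {y | R ≤ ‖y‖} := by
      rintro y ⟨hyF, hy⟩
      by_cases hyR : R ≤ ‖y‖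
      · exact Or.inr hyR
      refine Or.inl ⟨hyF, ?_⟩
      have hy : |v n ⬝ᵥ y - c n| ≤ η / 2 := hy
      have e : w ⬝ᵥ y - b = (w - v n) ⬝ᵥ y + (v n ⬝ᵥ y - c n) + (c n - b) := by
        rw [sub_dotProduct]; ring
      have h5 := abs_dotProduct_le (w - v n) y
      have h6 : p * (‖w - v n‖ * ‖y‖) ≤ p * (‖w - v n‖ * max R 0) := by
        gcongr
        exact (not_le.1 hyR).le.trans (le_max_left _ _)
      change |w ⬝ᵥ y - b| ≤ η
      rw [e]
      have := abs_add_three ((w - v n) ⬝ᵥ y) (v n ⬝ᵥ y - c n) (c n - b)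
      linarith
    calc _ ≤ _ := measureReal_mono hsub
      _ ≤ _ := measureReal_union_le _ _
      _ < _ := by linarith
  · push Not at hb
    refine ⟨1, one_pos, ?_⟩
    have hbig := hb (p * max R 0 + 1)
    have hβ0 : 0 ≤ β := measureReal_nonneg.trans (hβ w 0 hww)
    filter_upwards [hRn, hbig, hvn, hprob] with n h1 h2 h3 h4
    have hsub : F ∩ {y | |v n ⬝ᵥ y - c n| ≤ 1} ⊆ {y | R ≤ ‖y‖} := by
      rintro y ⟨-, hy⟩
      by_contra hyR
      have hyR : ‖y‖ < R := not_le.1 hyR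
      have hy : |v n ⬝ᵥ y - c n| ≤ 1 := hy
      have h5 := abs_dotProduct_le (v n) y
      have h6 : p * (‖v n‖ * ‖y‖) ≤ p * (1 * max R 0) := by
        gcongr
        exact hyR.le.trans (le_max_left _ _)
      have h7 : |c n| ≤ |v n ⬝ᵥ y| + |v n ⬝ᵥ y - c n| := by
        have := abs_sub (v n ⬝ᵥ y) (v n ⬝ᵥ y - c n)
        simpa using this
      linarith
    calc _ ≤ _ := measureReal_mono hsub
      _ < _ := by linarith

/-- Continuity of the quadratic distance, uniformly on compact sets. -/
lemma eventually_abs_quadDist_sub_lt {τ : Param p} (hτ : τ ∈ paramSpace p)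
    {K : Set (Fin p → ℝ)} (hK : IsCompact K) {η : ℝ} (hη : 0 < η) :
    ∀ᶠ σ in 𝓝 τ, ∀ y ∈ K, |quadDist σ y - quadDist τ y| < η := by
  refine hK.eventually_forall_of_forall_eventually fun y _ => ?_
  have h1 : ContinuousAt (fun z : Param p × (Fin p → ℝ) =>
      |quadDist z.1 z.2 - quadDist τ z.2|) (τ, y) :=
    ((continuousAt_quadDist (z := (τ, y)) hτ).sub
      ((continuous_quadDist τ).continuousAt.comp (f := fun z : Param p × (Fin p → ℝ) => z.2)
        continuousAt_snd)).abs
  exact h1.eventually_lt continuousAt_const (by simpa using hη)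

lemma eventually_ellipsoid_subset_setOf {τ : Param p} (hτ : τ ∈ paramSpace p) {η : ℝ}
    (hη : 0 < η) : ∀ᶠ σ in 𝓝[paramSpace p] τ, ellipsoid σ 1 ⊆ {y | quadDist τ y ≤ 1 + η} := by
  obtain ⟨R, hR⟩ := eventually_ellipsoid_subset (τ := τ)
  filter_upwards [hR, nhdsWithin_le_nhds (eventually_abs_quadDist_sub_lt hτ
    (isCompact_closedBall (0 : Fin p → ℝ) R) hη)] with σ h1 h2
  intro y hy
  have h3 := abs_lt.1 (h2 y (h1 hy))
  have h4 : quadDist σ y ≤ 1 ^ 2 := hy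
  change quadDist τ y ≤ 1 + η
  linarith

end Limits

/-! ### Convergence of the empirical MVEs. -/

section EmpiricalMVE

variable {g : ℝ → ℝ} {π : ℝ} {θ : Param p} {Q : Measure (Fin p → ℝ)} {t : ℝ}
  {x : ℕ → Fin p → ℝ} {A : ℕ → Set (Fin p → ℝ)}

lemma half_le_measureReal {P : Measure (Fin p → ℝ)} [IsFiniteMeasure P] {B : Set (Fin p → ℝ)} :
    1 / 2 ≤ P B ↔ 1 / 2 ≤ P.real B := by
  rw [measureReal_def, ← ENNReal.ofReal_le_iff_le_toReal (measure_ne_top _ _),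
    ENNReal.ofReal_div_of_pos (by norm_num)]
  simp

lemma half_lt_measureReal {P : Measure (Fin p → ℝ)} [IsFiniteMeasure P] {B : Set (Fin p → ℝ)} :
    1 / 2 < P B ↔ 1 / 2 < P.real B := by
  rw [measureReal_def, ← ENNReal.ofReal_lt_iff_lt_toReal (by norm_num) (measure_ne_top _ _),
    ENNReal.ofReal_div_of_pos (by norm_num)]
  simp

lemma contaminated_real (hg : IsEllipticalGenerator p g) (h : IsGEM g π θ Q)
    (B : Set (Fin p → ℝ)) : (contaminated g π θ Q).real B =
      (1 - π) * (ellipticalMeasure g θ).real B + π * Q.real B := by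
  have := hg.isProbabilityMeasure θ h.mem_paramSpace
  have := h.isProbabilityMeasure
  have h0 := h.nonneg
  have h1 := h.lt_one
  rw [measureReal_def, contaminated_apply, ENNReal.toReal_add
    (ENNReal.mul_ne_top ENNReal.ofReal_ne_top (measure_ne_top _ _))
    (ENNReal.mul_ne_top ENNReal.ofReal_ne_top (measure_ne_top _ _)), ENNReal.toReal_mul,
    ENNReal.toReal_mul, ENNReal.toReal_ofReal (by linarith), ENNReal.toReal_ofReal h0]
  rfl

lemma IsPopulationLevel.contaminated_real_eq (hg : IsEllipticalGenerator p g)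
    (h : IsGEM g π θ Q) (ht : IsPopulationLevel g π θ Q t) :
    (contaminated g π θ Q).real {y | quadDist θ y ≤ t} = 1 / 2 := by
  rw [contaminated_real hg h, ht.measure_eq, measureReal_def, ht.null]
  simp

lemma volume_ellipsoid_le_iff (hp : 1 ≤ p) {σ τ : Param p} (hσ : σ ∈ paramSpace p)
    (hτ : τ ∈ paramSpace p) {r s : ℝ} (hr : 0 ≤ r) (hs : 0 ≤ s) :
    volume (ellipsoid σ r) ≤ volume (ellipsoid τ s) ↔
      √σ.2.det * r ^ p ≤ √τ.2.det * s ^ p := by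
  rw [volume_ellipsoid hp hσ hr, volume_ellipsoid hp hτ hs,
    ENNReal.mul_le_mul_iff_left volume_unitBall_pos.ne' volume_unitBall_lt_top.ne,
    ENNReal.ofReal_le_ofReal_iff (by positivity)]

/-- Eventually, empirical MVEs have volume below that of any ellipsoid strictly larger than the
population MVE. -/
lemma eventually_det_le (hp : 1 ≤ p) (hGEM : IsGEM g π θ Q)
    (ht : IsPopulationLevel g π θ Q t) (hx : EmpiricalLimit x (contaminated g π θ Q))
    (hA : ∀ᶠ n in atTop, IsMVE (empirical x n) (A n)) {s : ℝ} (hs : t < s) :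
    ∀ᶠ n in atTop, ∀ τ ∈ paramSpace p, A n = ellipsoid τ 1 →
      √τ.2.det ≤ √θ.2.det * √s ^ p := by
  have hθ := hGEM.mem_paramSpace
  have := hx.isProbabilityMeasure
  have hs0 : 0 < s := ht.pos.trans hs
  filter_upwards [hx.lt_of_isOpen _ (isOpen_lt (continuous_quadDist θ) continuous_const) _
    (half_lt_measureReal.1 (ht.lt_measure s hs)), hA, eventually_ne_atTop 0] with n h1 h2 h3 τ hτ hAτ
  have := isProbabilityMeasure_empirical x h3
  have hsub : {y | quadDist θ y < s} ⊆ ellipsoid θ √s := by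
    rw [← setOf_quadDist_le_eq_ellipsoid θ hs0.le]
    exact fun y (hy : quadDist θ y < s) => (hy.le : quadDist θ y ≤ s)
  have h4 := h2.2.2 (ellipsoid θ √s) ⟨θ, hθ, √s, Real.sqrt_pos.2 hs0, rfl⟩
    (half_le_measureReal.2 (h1.le.trans (measureReal_mono hsub)))
  rw [hAτ, volume_ellipsoid_le_iff hp hτ hθ zero_le_one (Real.sqrt_nonneg _)] at h4
  simpa using h4

/-- Along any ultrafilter, the parameters of the empirical MVEs converge to parameters of the
population MVE. -/
lemma exists_tendsto_mve (hp : 1 ≤ p) (hg : IsEllipticalGenerator p g) (hGEM : IsGEM g π θ Q)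
    (hπ : π < 1 / 2)
    (ht : IsPopulationLevel g π θ Q t) (hx : EmpiricalLimit x (contaminated g π θ Q))
    (hA : ∀ᶠ n in atTop, IsMVE (empirical x n) (A n)) {U : Ultrafilter ℕ}
    (hU : (U : Filter ℕ) ≤ atTop) :
    ∃ τ : ℕ → Param p, ∃ τ' ∈ paramSpace p,
      (∀ᶠ n in U, τ n ∈ paramSpace p ∧ A n = ellipsoid (τ n) 1) ∧ Tendsto τ U (𝓝 τ') ∧
        {y | quadDist θ y ≤ t} = ellipsoid τ' 1 := by
  have hθ := hGEM.mem_paramSpace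
  have hP := hx.isProbabilityMeasure
  set P := contaminated g π θ Q
  have hprob : ∀ᶠ n in U, IsProbabilityMeasure (empirical x n) :=
    hU ((eventually_ne_atTop 0).mono fun n hn => isProbabilityMeasure_empirical x hn)
  have hex : ∀ n, ∃ τ : Param p, IsMVE (empirical x n) (A n) →
      τ ∈ paramSpace p ∧ A n = ellipsoid τ 1 := by
    intro n
    by_cases h : IsMVE (empirical x n) (A n)
    · obtain ⟨τ, h1, h2⟩ := isEllipsoid_iff.1 h.1
      exact ⟨τ, fun _ => ⟨h1, h2⟩⟩
    · exact ⟨0, fun h' => absurd h' h⟩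
  choose τ hτ' using hex
  have hτ : ∀ᶠ n in U, τ n ∈ paramSpace p ∧ A n = ellipsoid (τ n) 1 :=
    hU (hA.mono fun n hn => hτ' n hn)
  have hhalf : ∀ᶠ n in U, 1 / 2 ≤ (empirical x n).real (ellipsoid (τ n) 1) := by
    filter_upwards [hU hA, hτ, hprob] with n h1 h2 h3
    rw [← h2.2]
    exact half_le_measureReal.1 h1.2.1
  have hdet : ∀ s, t < s → ∀ᶠ n in U, √(τ n).2.det ≤ √θ.2.det * √s ^ p := by
    intro s hs
    filter_upwards [hU (eventually_det_le hp hGEM ht hx hA hs), hτ] with n h1 h2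
      using h1 _ h2.1 h2.2
  have hmin : ∀ n, ∃ l : ℝ, ∃ v : Fin p → ℝ, τ n ∈ paramSpace p → 0 < l ∧
      v ⬝ᵥ v = 1 ∧ v ⬝ᵥ ((τ n).2 *ᵥ v) = l ∧ l ^ p ≤ (τ n).2.det ∧
      (τ n).2.trace * l ^ (p - 1) ≤ p * (τ n).2.det ∧
      ∀ y, l * (y ⬝ᵥ y) ≤ y ⬝ᵥ ((τ n).2 *ᵥ y) := by
    intro n
    by_cases h : τ n ∈ paramSpace p
    · obtain ⟨l, hl, v, hv⟩ := exists_min_eigenvalue hp h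
      exact ⟨l, v, fun _ => ⟨hl, hv⟩⟩
    · exact ⟨0, 0, fun h' => absurd h' h⟩
  choose l v hlv using hmin
  -- The elliptical part does not charge hyperplanes, so these have mass at most `π < 1/2`. A flat
  -- ellipsoid lies in a thin slab, whose empirical mass would drop below `1/2`.
  have hlow : ∃ c > 0, ∀ᶠ n in U, c ≤ l n := by
    by_contra! hcon
    have hβ : ∀ (w : Fin p → ℝ) (c : ℝ), w ⬝ᵥ w = 1 →
        P.real (Set.univ ∩ {y | w ⬝ᵥ y = c}) ≤ π := by
      intro w c hw
      have := hGEM.isProbabilityMeasure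
      rw [Set.univ_inter, contaminated_real hg hGEM, measureReal_def (ellipticalMeasure g θ),
        ellipticalMeasure_null (volume_hyperplane hw c)]
      have h1 : Q.real {y | w ⬝ᵥ y = c} ≤ 1 := measureReal_le_one
      have h2 := hGEM.nonneg
      simp only [ENNReal.toReal_zero, mul_zero, zero_add]
      nlinarith
    obtain ⟨δ, hδ, hslab⟩ := hx.exists_slab_lt hU isClosed_univ hβ (v := v)
      (fun n => v n ⬝ᵥ (τ n).1) (hτ.mono fun n hn => (hlv n hn.1).2.1)
      (show 0 < 1 / 2 - π by linarith)
    have hl := hcon (δ ^ 2) (by positivity)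
    obtain ⟨n, h1, h2, h3, h4, h5⟩ := (hslab.and (hl.and (hτ.and (hhalf.and hprob)))).exists
    have hsub : ellipsoid (τ n) 1 ⊆ Set.univ ∩ {y | |v n ⬝ᵥ y - v n ⬝ᵥ (τ n).1| ≤ δ} := by
      intro y hy
      refine ⟨trivial, ?_⟩
      have h6 := sq_dotProduct_sub_le_quadDist h3.1 (v n) y
      obtain ⟨hl0, hv1, hvl, -⟩ := hlv n h3.1
      have hy : quadDist (τ n) y ≤ 1 ^ 2 := hy
      rw [hvl] at h6
      change |v n ⬝ᵥ y - v n ⬝ᵥ (τ n).1| ≤ δ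
      rw [← dotProduct_sub]
      refine abs_le_of_sq_le_sq (h6.trans ?_) hδ.le
      nlinarith
    have := measureReal_mono (μ := empirical x n) hsub
    linarith
  obtain ⟨c, hc, hlc⟩ := hlow
  -- The bound on the determinant from `hdet` with `s = t + 1`; any fixed `s > t` would do.
  set D := (√θ.2.det * √(t + 1) ^ p) ^ 2
  have htr : ∀ᶠ n in U, (τ n).2.trace ≤ p * D / c ^ (p - 1) := by
    filter_upwards [hlc, hτ, hdet (t + 1) (by linarith)] with n h1 h2 h3
    obtain ⟨hl0, -, -, -, h4, -⟩ := hlv n h2.1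
    have hd := Matrix.PosDef.det_pos h2.1
    have h5 : (τ n).2.det ≤ D := by
      rw [← Real.sq_sqrt hd.le]
      exact pow_le_pow_left₀ (Real.sqrt_nonneg _) h3 2
    have h6 : 0 ≤ (τ n).2.trace := h2.1.posSemidef.trace_nonneg
    rw [le_div_iff₀ (by positivity)]
    calc (τ n).2.trace * c ^ (p - 1) ≤ (τ n).2.trace * l n ^ (p - 1) := by gcongr
      _ ≤ p * (τ n).2.det := h4
      _ ≤ p * D := by gcongr
  set T := p * D / c ^ (p - 1)
  obtain ⟨R, hR⟩ := exists_measureReal_norm_ge_lt P (show (0 : ℝ) < 1 / 2 by norm_num)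
  have hRn : ∀ᶠ n in U, (empirical x n).real {y | R ≤ ‖y‖} < 1 / 2 :=
    hU (hx.lt_of_isClosed _ (isClosed_le continuous_const continuous_norm) _ hR)
  have hloc : ∀ᶠ n in U, ‖(τ n).1‖ ≤ R + √T := by
    filter_upwards [hRn, hτ, hhalf, htr, hprob] with n h1 h2 h3 h4 h5
    -- A bounded ellipsoid with a remote centre would lie in a tail of mass less than `1/2`.
    by_contra! hlt
    have hsub : ellipsoid (τ n) 1 ⊆ {y | R ≤ ‖y‖} := by
      intro y hy
      have h6 := ellipsoid_subset_closedBall h2.1 1 hy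
      rw [mem_closedBall_iff_norm, one_pow, mul_one] at h6
      have h7 : √(τ n).2.trace ≤ √T := Real.sqrt_le_sqrt h4
      have h8 := norm_sub_norm_le (τ n).1 y
      rw [norm_sub_rev] at h8
      change R ≤ ‖y‖
      linarith
    have := measureReal_mono (μ := empirical x n) hsub
    linarith
  obtain ⟨τ', hτ'm, hlim⟩ := exists_tendsto_param U hc (hτ.mono fun n hn => hn.1) hloc htr (by
    filter_upwards [hlc, hτ] with n h1 h2 y
    obtain ⟨-, -, -, -, -, h4⟩ := hlv n h2.1
    exact (mul_le_mul_of_nonneg_right h1 (dotProduct_self_nonneg' y)).trans (h4 y))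
  refine ⟨τ, τ', hτ'm, hτ, hlim, ?_⟩
  have hlimw : Tendsto τ U (𝓝[paramSpace p] τ') :=
    tendsto_nhdsWithin_iff.2 ⟨hlim, hτ.mono fun n hn => hn.1⟩
  -- Otherwise a slightly enlarged limit ellipsoid, which eventually contains `A n`, would have
  -- empirical mass below `1/2`.
  have hPhalf : 1 / 2 ≤ P.real (ellipsoid τ' 1) := by
    by_contra! hlt
    have hlt' : P.real (Set.univ ∩ {y | quadDist τ' y ≤ 1}) < 1 / 2 := by
      simpa [ellipsoid] using hlt
    obtain ⟨η, hη, hη2⟩ := exists_measureReal_lt_of_iInter (continuous_quadDist τ')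
      isClosed_univ 1 hlt'
    rw [Set.univ_inter] at hη2
    have hFn : ∀ᶠ n in U, (empirical x n).real {y | quadDist τ' y ≤ 1 + η} < 1 / 2 :=
      hU (hx.lt_of_isClosed _ (isClosed_le (continuous_quadDist τ') continuous_const) _ hη2)
    obtain ⟨n, h1, h2, h3, h4⟩ := (hFn.and ((hlimw.eventually (eventually_ellipsoid_subset_setOf hτ'm
        hη)).and (hhalf.and hprob))).exists
    have := measureReal_mono (μ := empirical x n) h2
    linarith
  -- First `n` tends to infinity in the volume bound for a fixed `s > t`, then `s` decreases to `t`.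
  have hvol : volume (ellipsoid τ' 1) ≤ volume {y | quadDist θ y ≤ t} := by
    rw [setOf_quadDist_le_eq_ellipsoid θ ht.pos.le,
      volume_ellipsoid_le_iff hp hτ'm hθ zero_le_one (Real.sqrt_nonneg _), one_pow, mul_one]
    have h1 : ∀ s, t < s → √τ'.2.det ≤ √θ.2.det * √s ^ p := by
      intro s hs
      have hcont : Continuous fun σ : Param p => √σ.2.det := by fun_prop
      exact le_of_tendsto ((hcont.tendsto τ').comp hlim) (hdet s hs)
    have hcont : Continuous fun s : ℝ => √θ.2.det * √s ^ p := by fun_prop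
    exact ge_of_tendsto ((hcont.tendsto t).mono_left (nhdsWithin_le_nhds (s := Set.Ioi t)))
      (by filter_upwards [self_mem_nhdsWithin] with s hs using h1 s hs)
  exact (ht.eq_of_isMVE _ ⟨isEllipsoid_iff.2 ⟨τ', hτ'm, rfl⟩, half_le_measureReal.2 hPhalf,
    fun B hB hPB => hvol.trans (ht.isMVE.2.2 B hB hPB)⟩).symm

end EmpiricalMVE

/-! ### Identifiability of the weight and the parameter from the density near its centre. -/

section Identification

variable {g : ℝ → ℝ}

/-- The form in which (G1) is used: together with monotonicity it makes `0` a strict maximum of `g`.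
-/
lemma generator_lt_zero (hg : IsEllipticalGenerator p g) (hG1 : CondG1 g) {s : ℝ} (hs : 0 < s) :
    g s < g 0 := by
  obtain ⟨t, ht, hlim, hlt⟩ := hG1
  have hpos : ∀ n, 0 < t n := fun n =>
    lt_of_le_of_lt (ht.antitone.le_of_tendsto hlim (n + 1)) (ht n.lt_succ_self)
  obtain ⟨n, hn⟩ := (hlim.eventually_lt_const hs).exists
  calc g s ≤ g (t n) := hg.antitoneOn (hpos n).le hs.le hn.le
    _ < g (t (n + 1)) := hlt n
    _ ≤ g 0 := hg.antitoneOn (Set.mem_Ici.2 le_rfl) (hpos _).le (hpos _).le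

lemma generator_zero_pos (hg : IsEllipticalGenerator p g) (hG1 : CondG1 g) : 0 < g 0 :=
  (hg.nonneg 1 zero_le_one).trans_lt (generator_lt_zero hg hG1 one_pos)

/-- Iterating the relation gives `g r = g (ρ ^ k * r)`, which tends to `g 0` by continuity, against
the strict maximum at `0`. -/
lemma not_forall_generator_mul_eq (hg : IsEllipticalGenerator p g) (hG1 : CondG1 g)
    (hG2 : CondG2 g) {ρ t : ℝ} (hρ0 : 0 < ρ) (hρ1 : ρ < 1) (ht : 0 < t) :
    ¬ ∀ r, 0 < r → r < t → g (ρ * r) = g r := by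
  intro h
  have hr : 0 < t / 2 ∧ t / 2 < t := ⟨half_pos ht, half_lt_self ht⟩
  have hk : ∀ k : ℕ, g (max (ρ ^ k * (t / 2)) 0) = g (t / 2) := by
    intro k
    rw [max_eq_left (by positivity)]
    induction k with
    | zero => simp
    | succ k ih =>
      rw [pow_succ', mul_assoc, h _ (by positivity), ih]
      calc ρ ^ k * (t / 2) ≤ 1 * (t / 2) := by
            gcongr
            exact pow_le_one₀ hρ0.le hρ1.le
        _ < t := by linarith
  have hlim : Tendsto (fun k : ℕ => ρ ^ k * (t / 2)) atTop (𝓝 0) := by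
    simpa using (tendsto_pow_atTop_nhds_zero_of_lt_one hρ0.le hρ1).mul_const (t / 2)
  have h1 := ((continuous_comp_max hG2).tendsto 0).comp hlim
  have h2 := tendsto_nhds_unique h1 (tendsto_const_nhds.congr fun k => (hk k).symm)
  rw [max_self] at h2
  exact (generator_lt_zero hg hG1 hr.1).ne' h2

lemma quadDist_add_smul (θ : Param p) (s : ℝ) (u : Fin p → ℝ) :
    quadDist θ (θ.1 + s • u) = s ^ 2 * quadDist θ (θ.1 + u) := by
  simp only [quadDist, add_sub_cancel_left, Matrix.mulVec_smul, dotProduct_smul, smul_dotProduct,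
    smul_eq_mul]
  ring

/-- The difference of the inverse scatters is a symmetric matrix with vanishing quadratic form,
hence zero. -/
lemma eq_of_quadDist_eq {θ σ : Param p} (hθ : θ ∈ paramSpace p) (hσ : σ ∈ paramSpace p)
    (h1 : θ.1 = σ.1) (h : ∀ y, quadDist θ y = quadDist σ y) : θ = σ := by
  have hq : ∀ u, u ⬝ᵥ ((θ.2⁻¹ - σ.2⁻¹) *ᵥ u) = 0 := by
    intro u
    have := h (θ.1 + u)
    simp only [quadDist, add_sub_cancel_left] at this
    rw [h1, add_sub_cancel_left] at this
    rw [Matrix.sub_mulVec, dotProduct_sub, this, sub_self]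
  have hD : (θ.2⁻¹ - σ.2⁻¹).PosSemidef :=
    Matrix.PosSemidef.of_dotProduct_mulVec_nonneg
      ((Matrix.PosDef.inv hθ).1.sub (Matrix.PosDef.inv hσ).1) fun u => by
        rw [star_trivial, hq]
  have hzero : θ.2⁻¹ - σ.2⁻¹ = 0 := by
    refine Matrix.ext_of_mulVec_single fun i => ?_
    rw [Matrix.zero_mulVec]
    refine (hD.dotProduct_mulVec_zero_iff _).1 ?_
    rw [star_trivial, hq]
  have hinv : θ.2⁻¹ = σ.2⁻¹ := sub_eq_zero.1 hzero
  have h2 : θ.2 = σ.2 := by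
    rw [← Matrix.nonsing_inv_nonsing_inv θ.2 (isUnit_iff_ne_zero.2 (Matrix.PosDef.det_pos hθ).ne'),
      ← Matrix.nonsing_inv_nonsing_inv σ.2 (isUnit_iff_ne_zero.2 (Matrix.PosDef.det_pos hσ).ne'),
      hinv]
  exact Prod.ext h1 h2

/-- Scaled elliptical densities that agree near the centre of one of them are equal. -/
lemma eq_of_density_eq (hg : IsEllipticalGenerator p g) (hG1 : CondG1 g) (hG2 : CondG2 g)
    {θ σ : Param p} (hθ : θ ∈ paramSpace p) (hσ : σ ∈ paramSpace p) {t w z : ℝ} (ht : 0 < t)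
    (hz : 0 < z) (h : ∀ y, quadDist σ y < t → w * density g θ y = z * density g σ y) :
    w = z ∧ θ = σ := by
  have hg0 := generator_zero_pos hg hG1
  have hdθ : 0 < (√θ.2.det)⁻¹ := inv_pos.2 (Real.sqrt_pos.2 (Matrix.PosDef.det_pos hθ))
  have hdσ : 0 < (√σ.2.det)⁻¹ := inv_pos.2 (Real.sqrt_pos.2 (Matrix.PosDef.det_pos hσ))
  have hc := h σ.1 (by rw [quadDist_self]; exact ht)
  have hw : 0 < w := by
    have h1 : 0 < w * density g θ σ.1 := by
      rw [hc, density, quadDist_self]; positivity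
    by_contra! hw
    nlinarith [density_nonneg hg hθ σ.1]
  -- If the centres differ, a short step from `σ.1` towards `θ.1` does not decrease `f_θ` but
  -- strictly decreases `f_σ`, so the two sides cannot stay proportional.
  have hμ : θ.1 = σ.1 := by
    by_contra hne
    set u := θ.1 - σ.1
    have hu : σ.1 + u = θ.1 := by simp [u]
    have hb : 0 < quadDist σ θ.1 := quadDist_pos hσ hne
    obtain ⟨s, hs0, hs1, hst⟩ : ∃ s : ℝ, 0 < s ∧ s < 1 ∧ s ^ 2 * quadDist σ θ.1 < t := by
      have hlim : Tendsto (fun s : ℝ => s ^ 2 * quadDist σ θ.1) (𝓝[>] 0) (𝓝 0) := by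
        have hcont : Continuous fun s : ℝ => s ^ 2 * quadDist σ θ.1 := by fun_prop
        simpa using (hcont.tendsto 0).mono_left (nhdsWithin_le_nhds (s := Set.Ioi 0))
      obtain ⟨s, h1, h2⟩ := ((hlim.eventually_lt_const ht).and
        (Ioo_mem_nhdsGT (zero_lt_one (α := ℝ)))).exists
      exact ⟨s, h2.1, h2.2, h1⟩
    have h1 : quadDist σ (σ.1 + s • u) = s ^ 2 * quadDist σ θ.1 := by
      rw [quadDist_add_smul, hu]
    have h2 := h (σ.1 + s • u) (h1 ▸ hst)
    have h3 : quadDist θ (σ.1 + s • u) = (s - 1) ^ 2 * quadDist θ σ.1 := by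
      have e : σ.1 + s • u = θ.1 + (s - 1) • u := by
        rw [← hu]; module
      have e2 : quadDist θ σ.1 = quadDist θ (θ.1 + u) := by
        have e3 : σ.1 = θ.1 + (-1 : ℝ) • u := by rw [← hu]; module
        rw [e3, quadDist_add_smul]; ring
      rw [e, quadDist_add_smul, e2]
    have h4 : density g θ σ.1 ≤ density g θ (σ.1 + s • u) := by
      refine mul_le_mul_of_nonneg_left (hg.antitoneOn (quadDist_nonneg hθ _)
        (quadDist_nonneg hθ _) ?_) hdθ.le
      rw [h3]
      exact mul_le_of_le_one_left (quadDist_nonneg hθ σ.1) (by nlinarith)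
    have h5 : density g σ (σ.1 + s • u) < density g σ σ.1 := by
      refine mul_lt_mul_of_pos_left ?_ hdσ
      rw [quadDist_self, h1]
      exact generator_lt_zero hg hG1 (by positivity)
    have h6 := mul_le_mul_of_nonneg_left h4 hw.le
    have h7 := mul_lt_mul_of_pos_left h5 hz
    linarith
  have hconst : w * (√θ.2.det)⁻¹ = z * (√σ.2.det)⁻¹ := by
    rw [density, density, quadDist_self, ← hμ, quadDist_self, ← mul_assoc, ← mul_assoc] at hc
    exact mul_right_cancel₀ hg0.ne' hc
  have hgen : ∀ y, quadDist σ y < t → g (quadDist θ y) = g (quadDist σ y) := by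
    intro y hy
    have := h y hy
    rw [density, density, ← mul_assoc, ← mul_assoc, hconst] at this
    exact mul_left_cancel₀ (by positivity) this
  have hq : ∀ y, quadDist θ y = quadDist σ y := by
    intro y
    by_cases hy : y = σ.1
    · rw [hy, quadDist_self, ← hμ, quadDist_self]
    have hb : 0 < quadDist σ y := quadDist_pos hσ hy
    have ha : 0 < quadDist θ y := quadDist_pos hθ (hμ ▸ hy)
    -- Along the ray from the common centre through `y` the ratio of the two quadratic distances is
    -- constant; a ratio other than `1` gives the excluded self-similarity of `g`.
    have hscale : ∀ r, 0 < r → r < t → g (quadDist θ y / quadDist σ y * r) = g r := by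
      intro r hr hrt
      set s := √(r / quadDist σ y)
      have hs : s ^ 2 = r / quadDist σ y := Real.sq_sqrt (by positivity)
      have hyσ : σ.1 + (y - σ.1) = y := by simp
      have hyθ : θ.1 + (y - σ.1) = y := by rw [hμ]; simp
      have e1 : quadDist σ (σ.1 + s • (y - σ.1)) = r := by
        rw [quadDist_add_smul, hyσ, hs, div_mul_cancel₀ _ hb.ne']
      have e2 : quadDist θ (σ.1 + s • (y - σ.1)) = quadDist θ y / quadDist σ y * r := by
        rw [← hμ, quadDist_add_smul, hμ, hyσ, hs]; ring
      have := hgen (σ.1 + s • (y - σ.1)) (by rw [e1]; exact hrt)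
      rwa [e1, e2] at this
    rcases lt_trichotomy (quadDist θ y) (quadDist σ y) with hlt | heq | hgt
    · exact absurd hscale (not_forall_generator_mul_eq hg hG1 hG2 (by positivity)
        ((div_lt_one hb).2 hlt) ht)
    · exact heq
    · refine absurd ?_ (not_forall_generator_mul_eq hg hG1 hG2
        (ρ := quadDist σ y / quadDist θ y) (by positivity) ((div_lt_one ha).2 hgt) ht)
      intro r hr hrt
      have h1 : quadDist σ y / quadDist θ y * r < t := by
        refine lt_of_le_of_lt ?_ hrt
        have := ((div_lt_one ha).2 hgt).le
        nlinarith
      rw [← hscale _ (by positivity) h1]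
      congr 1
      field_simp
  have heq := eq_of_quadDist_eq hθ hσ hμ hq
  refine ⟨?_, heq⟩
  rw [heq] at hconst
  exact mul_right_cancel₀ hdσ.ne' hconst

end Identification

/-! ### Consequences of the convergence of the sets `A_n` to `E`. -/

section MVELimit

variable {g : ℝ → ℝ} {π : ℝ} {θ : Param p} {Q : Measure (Fin p → ℝ)} {t : ℝ}
  {x : ℕ → Fin p → ℝ} {A : ℕ → Set (Fin p → ℝ)}

/-- Convergence of sets along an ultrafilter to the level set `{q_θ ≤ t}`. -/
structure MVELimit (g : ℝ → ℝ) (θ : Param p) (t : ℝ) (x : ℕ → Fin p → ℝ)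
    (A : ℕ → Set (Fin p → ℝ)) (U : Ultrafilter ℕ) : Prop where
  subset : ∀ η > 0, ∀ᶠ n in U, A n ⊆ {y | quadDist θ y ≤ t + η}
  half_le : ∀ᶠ n in U, 1 / 2 ≤ (empirical x n).real (A n)
  tendsto_empirical : Tendsto (fun n => (empirical x n).real (A n)) U (𝓝 (1 / 2))
  tendsto_elliptical : ∀ (σ : Param p) (θs : ℕ → Param p), σ ∈ paramSpace p →
    (∀ᶠ n in U, θs n ∈ paramSpace p) → Tendsto θs U (𝓝 σ) →
    Tendsto (fun n => (ellipticalMeasure g (θs n)).real (A n)) U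
      (𝓝 ((ellipticalMeasure g σ).real {y | quadDist θ y ≤ t}))

lemma mveLimit (hp : 1 ≤ p) (hg : IsEllipticalGenerator p g) (hG2 : CondG2 g)
    (hGEM : IsGEM g π θ Q) (hπ : π < 1 / 2)
    (ht : IsPopulationLevel g π θ Q t) (hx : EmpiricalLimit x (contaminated g π θ Q))
    (hA : ∀ᶠ n in atTop, IsMVE (empirical x n) (A n)) {U : Ultrafilter ℕ}
    (hU : (U : Filter ℕ) ≤ atTop) : MVELimit g θ t x A U := by
  obtain ⟨τ, τ', hτ', hτ, hlim, hE⟩ := exists_tendsto_mve hp hg hGEM hπ ht hx hA hU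
  have hprob : ∀ᶠ n in U, IsProbabilityMeasure (empirical x n) :=
    hU ((eventually_ne_atTop 0).mono fun n hn => isProbabilityMeasure_empirical x hn)
  have := hx.isProbabilityMeasure
  have hlimw : Tendsto τ U (𝓝[paramSpace p] τ') :=
    tendsto_nhdsWithin_iff.2 ⟨hlim, hτ.mono fun n hn => hn.1⟩
  have hsub : ∀ η > 0, ∀ᶠ n in U, A n ⊆ {y | quadDist θ y ≤ t + η} := by
    intro η hη
    obtain ⟨R, hR⟩ := eventually_ellipsoid_subset (τ := τ')
    have hK : IsCompact (Metric.closedBall (0 : Fin p → ℝ) R ∩ {y | t + η ≤ quadDist θ y}) :=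
      (isCompact_closedBall _ _).inter_right (isClosed_le continuous_const (continuous_quadDist θ))
    -- On the compact part of `{q_θ ≥ t + η}` in a common ball, the limit form exceeds `1`; by
    -- compactness so do all nearby forms.
    have hout : ∀ᶠ σ in 𝓝 τ', ∀ y ∈ Metric.closedBall (0 : Fin p → ℝ) R ∩
        {y | t + η ≤ quadDist θ y}, 1 < quadDist σ y := by
      refine hK.eventually_forall_of_forall_eventually fun y hy => ?_
      have h1 : 1 < quadDist τ' y := by
        by_contra! hle
        have : y ∈ ellipsoid τ' 1 := by simpa [ellipsoid] using hle
        rw [← hE] at this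
        have h2 : quadDist θ y ≤ t := this
        have h3 : t + η ≤ quadDist θ y := hy.2
        linarith
      exact continuousAt_const.eventually_lt (continuousAt_quadDist (z := (τ', y)) hτ') h1
    filter_upwards [hlimw.eventually hR, hlim.eventually hout, hτ] with n h1 h2 h3 y hy
    rw [h3.2] at hy
    by_contra hcon
    have hcon : t + η < quadDist θ y := not_le.1 hcon
    have h4 := h2 y ⟨h1 hy, hcon.le⟩
    have h5 : quadDist (τ n) y ≤ 1 ^ 2 := hy
    linarith
  have hhalf : ∀ᶠ n in U, 1 / 2 ≤ (empirical x n).real (A n) := by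
    filter_upwards [hU hA, hprob] with n h1 h2 using half_le_measureReal.1 h1.2.1
  refine ⟨hsub, hhalf, ?_, ?_⟩
  -- The lower bound is the definition of an MVE. The upper bound holds because `A n` lies in
  -- slightly enlarged copies of `E`, whose mass is close to `1/2`.
  · rw [tendsto_order]
    refine ⟨fun a ha => hhalf.mono fun n hn => ha.trans_le hn, fun a ha => ?_⟩
    have h0 : (contaminated g π θ Q).real (Set.univ ∩ {y | quadDist θ y ≤ t}) < a := by
      rw [Set.univ_inter, ht.contaminated_real_eq hg hGEM]; exact ha
    obtain ⟨η, hη, hlt⟩ := exists_measureReal_lt_of_iInter (continuous_quadDist θ)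
      isClosed_univ t h0
    rw [Set.univ_inter] at hlt
    filter_upwards [hU (hx.lt_of_isClosed _ (isClosed_le (continuous_quadDist θ)
      continuous_const) _ hlt), hsub η hη, hprob] with n h1 h2 h3
    exact (measureReal_mono h2).trans_lt h1
  · intro σ θs hσ hθs hlimθ
    rw [hE]
    refine (tendsto_ellipticalMeasure hp hg hG2 hσ hτ' hlimθ hlim hθs
      (hτ.mono fun n hn => hn.1)).congr' ?_
    filter_upwards [hτ] with n hn
    rw [hn.2]

end MVELimit

/-! ### Likelihood domination confines the parameters to a compact set. -/

section Compactness

variable {g : ℝ → ℝ} {π : ℝ} {θ : Param p} {Q : Measure (Fin p → ℝ)} {t : ℝ}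
  {x : ℕ → Fin p → ℝ} {A : ℕ → Set (Fin p → ℝ)} {U : Ultrafilter ℕ}

/-- Real-valued smart log-likelihood of a single observation, with `w` in place of `1 - π`. -/
noncomputable def logTerm (g : ℝ → ℝ) (A : Set (Fin p → ℝ)) (w : ℝ) (θ : Param p)
    (y : Fin p → ℝ) : ℝ :=
  A.indicator (fun y => Real.log (w * density g θ y)) y +
    Aᶜ.indicator (fun _ => Real.log (1 - w * (ellipticalMeasure g θ).real A)) y

/-- The parameters `(w, σ)` are at least as likely as `(w₀, θ)`. -/
structure Dominates (g : ℝ → ℝ) (w₀ : ℝ) (θ : Param p) (A : Set (Fin p → ℝ))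
    (x : ℕ → Fin p → ℝ) (n : ℕ) (w : ℝ) (σ : Param p) : Prop where
  mem : σ ∈ paramSpace p
  pos : 0 < w
  outside_pos : 0 < 1 - w * (ellipticalMeasure g σ).real A
  density_pos : ∀ i < n, x i ∈ A → 0 < density g σ (x i)
  le : ∑ i ∈ Finset.range n, logTerm g A w₀ θ (x i) ≤ ∑ i ∈ Finset.range n, logTerm g A w σ (x i)

/-- Polynomial decay of the generator at a rate `γ > p / 2`. -/
def PolynomialDecay (p : ℕ) (g : ℝ → ℝ) : Prop :=
  ∃ C γ : ℝ, 0 < C ∧ (p : ℝ) / 2 < γ ∧ ∀ r, 0 < r → g r ≤ C * r ^ (-γ)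

/-- The margin `η` is needed because `A_n` is only known to lie in slight enlargements of `E`. -/
lemma exists_density_ge (hg : IsEllipticalGenerator p g) (hG2 : CondG2 g)
    (hθ : θ ∈ paramSpace p) (ht : IsPopulationLevel g π θ Q t) :
    ∃ η > 0, ∃ c > 0, ∀ y, quadDist θ y ≤ t + η → c ≤ density g θ y := by
  have hlim : Tendsto (fun s => g (max (t + s) 0)) (𝓝[>] 0) (𝓝 (g (max (t + 0) 0))) :=
    (((continuous_comp_max hG2).comp (continuous_const.add continuous_id)).tendsto
      (0 : ℝ)).mono_left nhdsWithin_le_nhds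
  rw [add_zero, max_eq_left ht.pos.le] at hlim
  obtain ⟨η, h1, h2⟩ := ((hlim.eventually_const_lt ht.generator_pos).and
    self_mem_nhdsWithin).exists
  have h2 : 0 < η := h2
  have h3 : 0 < t + η := add_pos ht.pos h2
  rw [max_eq_left h3.le] at h1
  refine ⟨η, h2, (√θ.2.det)⁻¹ * g (t + η), mul_pos (inv_pos.2 (Real.sqrt_pos.2
    (Matrix.PosDef.det_pos hθ))) h1, fun y hy => ?_⟩
  exact mul_le_mul_of_nonneg_left (hg.antitoneOn (quadDist_nonneg hθ y) h3.le hy) (by positivity)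

lemma MVELimit.tendsto_outside (hL : MVELimit g θ t x A U) (hθ : θ ∈ paramSpace p)
    (ht : IsPopulationLevel g π θ Q t) :
    Tendsto (fun n => 1 - (1 - π) * (ellipticalMeasure g θ).real (A n)) U (𝓝 (1 / 2)) := by
  have h := ((hL.tendsto_elliptical θ (fun _ => θ) hθ (Eventually.of_forall fun _ => hθ)
    tendsto_const_nhds).const_mul (1 - π)).const_sub 1
  rw [ht.measure_eq] at h
  convert! h using 2
  norm_num

lemma sum_indicator_const (x : ℕ → Fin p → ℝ) {n : ℕ} (hn : n ≠ 0) (B : Set (Fin p → ℝ)) (c : ℝ) :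
    ∑ i ∈ Finset.range n, B.indicator (fun _ => c) (x i) = c * (n * (empirical x n).real B) := by
  have hn' : (n : ℝ) ≠ 0 := by exact_mod_cast hn
  rw [empirical_real, mul_div_cancel₀ _ hn', Finset.mul_sum]
  refine Finset.sum_congr rfl fun i _ => ?_
  by_cases h : x i ∈ B <;> simp [h]

/-- Each term of the true log-likelihood is bounded below, and domination passes the bound on to `σ
n`. For `σ n`, the factor `w n` costs at most `log W`, and the terms outside `A n` are nonpositive.
-/
lemma exists_sum_log_density_ge (hg : IsEllipticalGenerator p g) (hG2 : CondG2 g)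
    (hπ : π < 1 / 2) (hθ : θ ∈ paramSpace p) (ht : IsPopulationLevel g π θ Q t)
    (hL : MVELimit g θ t x A U) {w : ℕ → ℝ} {σ : ℕ → Param p} {W : ℝ}
    (hdom : ∀ᶠ n in U, Dominates g (1 - π) θ (A n) x n (w n) (σ n))
    (hW : ∀ᶠ n in U, w n ≤ W) :
    ∃ C, 0 ≤ C ∧ ∀ᶠ n in U, -C * n ≤
      ∑ i ∈ Finset.range n, (A n).indicator (fun y => Real.log (density g (σ n) y)) (x i) := by
  obtain ⟨η, hη, c, hc, hdens⟩ := exists_density_ge hg hG2 hθ ht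
  have hw0 : 0 < 1 - π := by linarith
  set C₀ := |Real.log ((1 - π) * c)| + |Real.log (1 / 4)|
  refine ⟨C₀ + |Real.log W|, by positivity, ?_⟩
  filter_upwards [hL.subset η hη, (hL.tendsto_outside hθ ht).eventually_const_lt
    (show (1 / 4 : ℝ) < 1 / 2 by norm_num), hdom, hW] with n h1 h2 h3 h4
  have hlow : ∀ y, -C₀ ≤ logTerm g (A n) (1 - π) θ y := by
    intro y
    have a1 := neg_abs_le (Real.log ((1 - π) * c))
    have a2 := neg_abs_le (Real.log (1 / 4))
    have a3 := abs_nonneg (Real.log ((1 - π) * c))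
    have a4 := abs_nonneg (Real.log (1 / 4))
    by_cases hy : y ∈ A n
    · have := Real.log_le_log (by positivity)
        (mul_le_mul_of_nonneg_left (hdens y (h1 hy)) hw0.le)
      simp only [logTerm, Set.indicator_of_mem hy, Set.indicator_of_notMem
        (Set.notMem_compl_iff.2 hy), add_zero]
      linarith
    · have := Real.log_le_log (by norm_num) h2.le
      simp only [logTerm, Set.indicator_of_notMem hy, Set.indicator_of_mem
        (Set.mem_compl hy), zero_add]
      linarith
  have hup : ∀ i ∈ Finset.range n, logTerm g (A n) (w n) (σ n) (x i) ≤
      |Real.log W| + (A n).indicator (fun y => Real.log (density g (σ n) y)) (x i) := by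
    intro i hi
    by_cases hy : x i ∈ A n
    · have hd := h3.density_pos i (Finset.mem_range.1 hi) hy
      simp only [logTerm, Set.indicator_of_mem hy, Set.indicator_of_notMem
        (Set.notMem_compl_iff.2 hy), add_zero]
      rw [Real.log_mul h3.pos.ne' hd.ne']
      have := Real.log_le_log h3.pos h4
      linarith [le_abs_self (Real.log W)]
    · simp only [logTerm, Set.indicator_of_notMem hy, Set.indicator_of_mem
        (Set.mem_compl hy), zero_add, add_zero]
      refine (Real.log_nonpos h3.outside_pos.le ?_).trans (abs_nonneg _)
      have := mul_nonneg h3.pos.le (measureReal_nonneg (μ := ellipticalMeasure g (σ n)) (s := A n))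
      linarith
  have e1 := Finset.sum_le_sum hup
  have e2 : ∑ _i ∈ Finset.range n, (-C₀) ≤ ∑ i ∈ Finset.range n, logTerm g (A n) (1 - π) θ (x i) :=
    Finset.sum_le_sum fun i _ => hlow (x i)
  rw [Finset.sum_add_distrib] at e1
  simp only [Finset.sum_const, Finset.card_range, nsmul_eq_mul] at e1 e2
  have := h3.le
  linarith

/-- Some point of `A_n` has density bounded below. -/
lemma exists_mem_density_ge (hU : (U : Filter ℕ) ≤ atTop) (hL : MVELimit g θ t x A U)
    {σ : ℕ → Param p} {C : ℝ} (hC0 : 0 ≤ C)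
    (hpos : ∀ᶠ n in U, ∀ i < n, x i ∈ A n → 0 < density g (σ n) (x i))
    (hC : ∀ᶠ n in U, -C * n ≤
      ∑ i ∈ Finset.range n, (A n).indicator (fun y => Real.log (density g (σ n) y)) (x i)) :
    ∃ c > 0, ∀ᶠ n in U, ∃ y ∈ A n, c ≤ density g (σ n) y := by
  -- If all log-densities on `A n` were below `-(2C + 1)`, the mass `1/2` of `A n` would push the
  -- mean below `-C`.
  refine ⟨Real.exp (-(2 * C + 1)), Real.exp_pos _, ?_⟩
  filter_upwards [hpos, hC, hL.half_le, hU (eventually_ne_atTop 0)] with n h1 h2 h3 h4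
  by_contra! hcon
  have h5 : ∑ i ∈ Finset.range n, (A n).indicator (fun y => Real.log (density g (σ n) y)) (x i) ≤
      ∑ i ∈ Finset.range n, (A n).indicator (fun _ => -(2 * C + 1)) (x i) := by
    refine Finset.sum_le_sum fun i hi => ?_
    by_cases hy : x i ∈ A n
    · rw [Set.indicator_of_mem hy, Set.indicator_of_mem hy]
      have := Real.log_lt_log (h1 i (Finset.mem_range.1 hi) hy) (hcon _ hy)
      rw [Real.log_exp] at this
      exact this.le
    · rw [Set.indicator_of_notMem hy, Set.indicator_of_notMem hy]
  rw [sum_indicator_const x h4] at h5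
  have hn : (0 : ℝ) < n := by exact_mod_cast Nat.pos_of_ne_zero h4
  have := mul_le_mul_of_nonneg_left (mul_le_mul_of_nonneg_left h3 hn.le)
    (show 0 ≤ 2 * C + 1 by linarith)
  linarith

lemma log_inv_sqrt_le {l d : ℝ} (hl : 0 < l) (hld : l ^ p ≤ d) :
    Real.log (√d)⁻¹ ≤ -((p : ℝ) / 2 * Real.log l) := by
  have hd : 0 < d := (pow_pos hl p).trans_le hld
  have h := Real.log_le_log (pow_pos hl p) hld
  rw [Real.log_pow] at h
  rw [Real.log_inv, Real.log_sqrt hd.le]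
  linarith

/-- Scatter matrices stay away from degeneracy. -/
lemma exists_eigenvalue_ge (hp : 1 ≤ p) (hg : IsEllipticalGenerator p g) (hG1 : CondG1 g)
    (hdecay : PolynomialDecay p g) (hGEM : IsGEM g π θ Q) (hU : (U : Filter ℕ) ≤ atTop)
    (ht : IsPopulationLevel g π θ Q t) (hx : EmpiricalLimit x (contaminated g π θ Q))
    (hL : MVELimit g θ t x A U) {σ : ℕ → Param p} (hσ : ∀ᶠ n in U, σ n ∈ paramSpace p)
    (hpos : ∀ᶠ n in U, ∀ i < n, x i ∈ A n → 0 < density g (σ n) (x i))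
    {l : ℕ → ℝ} {v : ℕ → Fin p → ℝ} (hl : ∀ᶠ n in U, 0 < l n)
    (hv : ∀ᶠ n in U, v n ⬝ᵥ v n = 1) (hvl : ∀ᶠ n in U, v n ⬝ᵥ ((σ n).2 *ᵥ v n) = l n)
    (hdet : ∀ᶠ n in U, l n ^ p ≤ (σ n).2.det) {C : ℝ}
    (hC : ∀ᶠ n in U, -C * n ≤
      ∑ i ∈ Finset.range n, (A n).indicator (fun y => Real.log (density g (σ n) y)) (x i)) :
    ∃ c > 0, ∀ᶠ n in U, c ≤ l n := by
  by_contra! hcon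
  obtain ⟨K, γ, hK, hγ, hgK⟩ := hdecay
  have hγ0 : 0 < γ := lt_of_le_of_lt (by positivity) hγ
  have hPm := hx.isProbabilityMeasure
  have hQ := hGEM.isProbabilityMeasure
  have hg0 := generator_zero_pos hg hG1
  -- Chosen so that `γ * (2 ε) = κ = (γ - p/2) / 4`: the gain in the slab, of mass below `2 ε`, is
  -- at most `κ L`, half of the loss `2 κ L` due to the mass `1/2` of `A n`. Here `L = -log l`.
  set ε := (γ - p / 2) / (8 * γ)
  have hε : 0 < ε := div_pos (by linarith) (by positivity)
  have hQ0 : Q.real (Set.univ ∩ {y | quadDist θ y ≤ t}) < ε := by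
    rw [Set.univ_inter, measureReal_def, ht.null]; simpa using hε
  obtain ⟨η, hη, hQη⟩ := exists_measureReal_lt_of_iInter (continuous_quadDist θ) isClosed_univ t hQ0
  rw [Set.univ_inter] at hQη
  have hF : IsClosed {y | quadDist θ y ≤ t + η} :=
    isClosed_le (continuous_quadDist θ) continuous_const
  have hβ : ∀ (u : Fin p → ℝ) (b : ℝ), u ⬝ᵥ u = 1 → (contaminated g π θ Q).real
      ({y | quadDist θ y ≤ t + η} ∩ {y | u ⬝ᵥ y = b}) ≤ ε := by
    intro u b hu
    rw [contaminated_real hg hGEM, measureReal_def (ellipticalMeasure g θ), measure_mono_null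
      Set.inter_subset_right (ellipticalMeasure_null (volume_hyperplane hu b))]
    have h1 : Q.real ({y | quadDist θ y ≤ t + η} ∩ {y | u ⬝ᵥ y = b}) ≤ ε :=
      (measureReal_mono Set.inter_subset_left).trans hQη.le
    have h2 := hGEM.nonneg
    have h3 := hGEM.lt_one
    simp only [ENNReal.toReal_zero, mul_zero, zero_add]
    nlinarith [measureReal_nonneg (μ := Q) (s := {y | quadDist θ y ≤ t + η} ∩ {y | u ⬝ᵥ y = b})]
  obtain ⟨δ, hδ, hslab⟩ := hx.exists_slab_lt hU hF hβ (fun n => v n ⬝ᵥ (σ n).1) hv hε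
  set C' := |Real.log (g 0)| + |Real.log K| + γ * |Real.log (δ ^ 2)|
  have hC' : 0 ≤ C' := by positivity
  set κ := (γ - p / 2) / 4
  have hκ : 0 < κ := div_pos (by linarith) (by norm_num)
  have hprob : ∀ᶠ n in U, IsProbabilityMeasure (empirical x n) :=
    hU ((eventually_ne_atTop 0).mono fun n hn => isProbabilityMeasure_empirical x hn)
  -- The eigenvalue is taken so small that `κ L > C + C'`, which is what the final contradiction
  -- requires.
  have hsmall := hcon (min 1 (Real.exp (-((C + C') / κ)))) (lt_min one_pos (Real.exp_pos _))
  obtain ⟨n, h1, h2, h3, h4, h5, h6, h7, h8, h9, h10, h11, h12⟩ := (hsmall.and (hslab.and (hσ.and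
    (hpos.and (hl.and (hvl.and (hdet.and (hC.and ((hL.subset η hη).and (hL.half_le.and
    (hprob.and (hU (eventually_ne_atTop 0))))))))))))).exists
  set L := -Real.log (l n) with hLdef
  have hL0 : 0 ≤ L := neg_nonneg.2 (Real.log_nonpos h5.le (h1.le.trans (min_le_left _ _)))
  have hL1 : (C + C') / κ < L := by
    have := Real.log_lt_log h5 (h1.trans_le (min_le_right _ _))
    rw [Real.log_exp] at this
    linarith
  set S := {y | quadDist θ y ≤ t + η} ∩ {y | |v n ⬝ᵥ y - v n ⬝ᵥ (σ n).1| ≤ δ} with hS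
  have hdetpos := Matrix.PosDef.det_pos h3
  have hbase := log_inv_sqrt_le h5 h7
  -- Outside the slab, `q ≥ δ² / l` and the decay of `g` give `(p/2 - γ) L + C'`. In the slab only
  -- `g ≤ g 0` is available, giving `(p/2) L + C'`; the excess `γ L` is charged to `S`.
  have hpt : ∀ i ∈ Finset.range n,
      (A n).indicator (fun y => Real.log (density g (σ n) y)) (x i) ≤
        (A n).indicator (fun _ => (p / 2 - γ) * L + C') (x i) +
          S.indicator (fun _ => γ * L) (x i) := by
    intro i hi
    by_cases hy : x i ∈ A n
    · have hd := h4 i (Finset.mem_range.1 hi) hy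
      rw [Set.indicator_of_mem hy, Set.indicator_of_mem hy]
      have hgpos : 0 < g (quadDist (σ n) (x i)) := by
        by_contra! hle
        have : density g (σ n) (x i) ≤ 0 := mul_nonpos_of_nonneg_of_nonpos (by positivity) hle
        linarith
      have hlog : Real.log (density g (σ n) (x i)) =
          Real.log (√(σ n).2.det)⁻¹ + Real.log (g (quadDist (σ n) (x i))) :=
        Real.log_mul (inv_pos.2 (Real.sqrt_pos.2 hdetpos)).ne' hgpos.ne'
      by_cases hyS : x i ∈ S
      · rw [Set.indicator_of_mem hyS, hlog]
        have a1 : Real.log (g (quadDist (σ n) (x i))) ≤ Real.log (g 0) :=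
          Real.log_le_log hgpos (hg.antitoneOn (Set.mem_Ici.2 le_rfl) (quadDist_nonneg h3 _)
            (quadDist_nonneg h3 _))
        have a2 := le_abs_self (Real.log (g 0))
        have a3 : |Real.log (g 0)| ≤ C' := by
          have : 0 ≤ |Real.log K| + γ * |Real.log (δ ^ 2)| := by positivity
          simp only [C']; linarith
        have a4 : -((p : ℝ) / 2 * Real.log (l n)) = p / 2 * L := by rw [hLdef]; ring
        linarith
      · rw [Set.indicator_of_notMem hyS, hlog, add_zero]
        have hout : δ < |v n ⬝ᵥ (x i) - v n ⬝ᵥ (σ n).1| := by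
          by_contra! hle
          exact hyS ⟨h9 hy, hle⟩
        have hq : δ ^ 2 / l n ≤ quadDist (σ n) (x i) := by
          have b1 := sq_dotProduct_sub_le_quadDist h3 (v n) (x i)
          rw [h6, dotProduct_sub] at b1
          rw [div_le_iff₀ h5]
          have b2 : δ ^ 2 ≤ (v n ⬝ᵥ (x i) - v n ⬝ᵥ (σ n).1) ^ 2 := by
            rw [← sq_abs (v n ⬝ᵥ (x i) - v n ⬝ᵥ (σ n).1)]
            exact pow_le_pow_left₀ hδ.le hout.le 2
          linarith
        have hq0 : 0 < δ ^ 2 / l n := by positivity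
        have a1 : g (quadDist (σ n) (x i)) ≤ K * (δ ^ 2 / l n) ^ (-γ) :=
          (hg.antitoneOn hq0.le (quadDist_nonneg h3 _) hq).trans (hgK _ hq0)
        have a2 := Real.log_le_log hgpos a1
        rw [Real.log_mul hK.ne' (Real.rpow_pos_of_pos hq0 _).ne', Real.log_rpow hq0,
          Real.log_div (by positivity) h5.ne'] at a2
        have a3 := le_abs_self (Real.log K)
        have a4 := neg_abs_le (Real.log (δ ^ 2))
        have a5 : γ * (-|Real.log (δ ^ 2)|) ≤ γ * Real.log (δ ^ 2) :=
          mul_le_mul_of_nonneg_left a4 hγ0.le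
        have a6 := abs_nonneg (Real.log (g 0))
        have a7 : -((p : ℝ) / 2 * Real.log (l n)) = p / 2 * L := by rw [hLdef]; ring
        have a8 : -γ * (Real.log (δ ^ 2) - Real.log (l n)) = -(γ * Real.log (δ ^ 2)) - γ * L := by
          rw [hLdef]; ring
        simp only [C']
        linarith
    · rw [Set.indicator_of_notMem hy, Set.indicator_of_notMem hy, zero_add]
      exact Set.indicator_nonneg (fun _ _ => by positivity) _
  have hsum := Finset.sum_le_sum hpt
  rw [Finset.sum_add_distrib, sum_indicator_const x h12, sum_indicator_const x h12] at hsum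
  have hn : (0 : ℝ) < n := by exact_mod_cast Nat.pos_of_ne_zero h12
  have hm1 : (empirical x n).real (A n) ≤ 1 := measureReal_le_one
  set m := (empirical x n).real (A n)
  set e := (empirical x n).real S
  have he : e < ε + ε := h2
  have hfin : -C ≤ ((p / 2 - γ) * L + C') * m + γ * L * e := by
    have : (-C) * n ≤ (((p / 2 - γ) * L + C') * m + γ * L * e) * n := by linarith
    exact le_of_mul_le_mul_right this hn
  have c1 : (p / 2 - γ) * L * m ≤ (p / 2 - γ) * L * (1 / 2) :=
    mul_le_mul_of_nonpos_left h10 (mul_nonpos_of_nonpos_of_nonneg (by linarith) hL0)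
  have c2 : C' * m ≤ C' := mul_le_of_le_one_right hC' hm1
  have c3 : γ * L * e ≤ γ * L * (ε + ε) := by gcongr
  have c4 : γ * (ε + ε) = κ := by simp only [ε, κ]; field_simp; ring
  have c5 : γ * L * (ε + ε) = κ * L := by rw [← c4]; ring
  have c6 : (p / 2 - γ) * L * (1 / 2) = -(2 * κ * L) := by simp only [κ]; ring
  have c7 : C + C' < κ * L := by rwa [div_lt_iff₀' hκ] at hL1
  linarith

/-- Likelihood domination forces convergence of the parameters along an ultrafilter. -/
lemma exists_tendsto_of_dominates (hp : 1 ≤ p) (hg : IsEllipticalGenerator p g) (hG1 : CondG1 g)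
    (hG2 : CondG2 g) (hdecay : PolynomialDecay p g) (hGEM : IsGEM g π θ Q) (hπ : π < 1 / 2)
    (hU : (U : Filter ℕ) ≤ atTop)
    (ht : IsPopulationLevel g π θ Q t) (hx : EmpiricalLimit x (contaminated g π θ Q))
    (hL : MVELimit g θ t x A U) {w : ℕ → ℝ} {σ : ℕ → Param p} {W : ℝ}
    (hdom : ∀ᶠ n in U, Dominates g (1 - π) θ (A n) x n (w n) (σ n))
    (hW : ∀ᶠ n in U, w n ≤ W) :
    ∃ σ' ∈ paramSpace p, Tendsto σ U (𝓝 σ') := by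
  have hθ := hGEM.mem_paramSpace
  have hσ : ∀ᶠ n in U, σ n ∈ paramSpace p := hdom.mono fun n hn => hn.mem
  have hpos : ∀ᶠ n in U, ∀ i < n, x i ∈ A n → 0 < density g (σ n) (x i) :=
    hdom.mono fun n hn => hn.density_pos
  obtain ⟨C, hC0, hC⟩ := exists_sum_log_density_ge hg hG2 hπ hθ ht hL hdom hW
  obtain ⟨c₂, hc₂, hy⟩ := exists_mem_density_ge hU hL hC0 hpos hC
  have hmin : ∀ n, ∃ l : ℝ, ∃ v : Fin p → ℝ, σ n ∈ paramSpace p → 0 < l ∧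
      v ⬝ᵥ v = 1 ∧ v ⬝ᵥ ((σ n).2 *ᵥ v) = l ∧ l ^ p ≤ (σ n).2.det ∧
      (σ n).2.trace * l ^ (p - 1) ≤ p * (σ n).2.det ∧
      ∀ y, l * (y ⬝ᵥ y) ≤ y ⬝ᵥ ((σ n).2 *ᵥ y) := by
    intro n
    by_cases h : σ n ∈ paramSpace p
    · obtain ⟨l, hl, v, hv⟩ := exists_min_eigenvalue hp h
      exact ⟨l, v, fun _ => ⟨hl, hv⟩⟩
    · exact ⟨0, 0, fun h' => absurd h' h⟩
  choose l v hlv using hmin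
  obtain ⟨c, hc, hlc⟩ := exists_eigenvalue_ge hp hg hG1 hdecay hGEM hU ht hx hL hσ hpos
    (hσ.mono fun n hn => (hlv n hn).1) (hσ.mono fun n hn => (hlv n hn).2.1)
    (hσ.mono fun n hn => (hlv n hn).2.2.1) (hσ.mono fun n hn => (hlv n hn).2.2.2.1) hC
  have hg0 := generator_zero_pos hg hG1
  -- Some point of `A n` has density at least `c₂`, while the density never exceeds `g 0 / √det`.
  set D := (g 0 / c₂) ^ 2
  have hdetD : ∀ᶠ n in U, (σ n).2.det ≤ D := by
    filter_upwards [hσ, hy] with n h1 ⟨y, _, h2⟩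
    have hd := Matrix.PosDef.det_pos h1
    have h3 := h2.trans (density_le hg h1 y)
    rw [inv_mul_eq_div, le_div_iff₀ (Real.sqrt_pos.2 hd)] at h3
    rw [← Real.sq_sqrt hd.le]
    refine pow_le_pow_left₀ (Real.sqrt_nonneg _) ?_ 2
    rw [le_div_iff₀ hc₂]
    linarith
  set T := p * D / c ^ (p - 1)
  have htr : ∀ᶠ n in U, (σ n).2.trace ≤ T := by
    filter_upwards [hlc, hσ, hdetD] with n h1 h2 h5
    obtain ⟨hl0, -, -, -, h4, -⟩ := hlv n h2
    have h6 : 0 ≤ (σ n).2.trace := Matrix.PosSemidef.trace_nonneg (Matrix.PosDef.posSemidef h2)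
    rw [le_div_iff₀ (by positivity)]
    calc (σ n).2.trace * c ^ (p - 1) ≤ (σ n).2.trace * l n ^ (p - 1) := by gcongr
      _ ≤ p * (σ n).2.det := h4
      _ ≤ p * D := by gcongr
  obtain ⟨R, hR⟩ : ∃ R, ∀ᶠ n in U, A n ⊆ Metric.closedBall 0 R := by
    refine ⟨√(θ.2.trace * (t + 1)) + ‖θ.1‖, ?_⟩
    filter_upwards [hL.subset 1 one_pos] with n hn y hyA
    rw [mem_closedBall_zero_iff]
    have h1 : quadDist θ y ≤ t + 1 := hn hyA
    have h2 := norm_sub_sq_le_quadDist hθ y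
    have h3 : 0 ≤ θ.2.trace := hθ.posSemidef.trace_nonneg
    have h4 := Real.le_sqrt_of_sq_le (h2.trans (mul_le_mul_of_nonneg_left h1 h3))
    have h5 : ‖y‖ ≤ ‖y - θ.1‖ + ‖θ.1‖ := by simpa using norm_add_le (y - θ.1) θ.1
    linarith
  -- With `det ≥ c ^ p`, a point of density at least `c₂` has quadratic distance at most `r`; this
  -- ties the centre to a point of the bounded set `A n`.
  obtain ⟨r, hr0, hr⟩ : ∃ r > 0, g r < c₂ * √(c ^ p) := by
    obtain ⟨K, γ, hK, hγ, hgK⟩ := hdecay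
    have hγ0 : 0 < γ := lt_of_le_of_lt (by positivity) hγ
    have hlim := (tendsto_rpow_neg_atTop hγ0).const_mul K
    rw [mul_zero] at hlim
    obtain ⟨r, h1, h2⟩ := ((hlim.eventually_lt_const (show 0 < c₂ * √(c ^ p) by positivity)).and
      (eventually_gt_atTop 0)).exists
    exact ⟨r, h2, (hgK r h2).trans_lt h1⟩
  have hloc : ∀ᶠ n in U, ‖(σ n).1‖ ≤ R + √(T * r) := by
    filter_upwards [hσ, hy, hR, hlc, htr] with n h1 ⟨y, hyA, h2⟩ h3 h4 h5
    obtain ⟨hl0, -, -, hd, -, -⟩ := hlv n h1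
    have hdpos := Matrix.PosDef.det_pos h1
    have hq : quadDist (σ n) y ≤ r := by
      by_contra! hlt
      have a1 : g (quadDist (σ n) y) ≤ g r := hg.antitoneOn hr0.le (quadDist_nonneg h1 y) hlt.le
      rw [density, inv_mul_eq_div, le_div_iff₀ (Real.sqrt_pos.2 hdpos)] at h2
      have a2 : √(c ^ p) ≤ √(σ n).2.det :=
        Real.sqrt_le_sqrt ((pow_le_pow_left₀ hc.le h4 p).trans hd)
      have a3 := mul_le_mul_of_nonneg_left a2 hc₂.le
      linarith
    have h6 : 0 ≤ (σ n).2.trace := Matrix.PosSemidef.trace_nonneg (Matrix.PosDef.posSemidef h1)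
    have h7 := Real.le_sqrt_of_sq_le ((norm_sub_sq_le_quadDist h1 y).trans
      (mul_le_mul h5 hq (quadDist_nonneg h1 y) (h6.trans h5)))
    have h8 := mem_closedBall_zero_iff.1 (h3 hyA)
    have h9 := norm_sub_norm_le (σ n).1 y
    rw [norm_sub_rev] at h9
    linarith
  refine exists_tendsto_param U hc hσ hloc htr ?_
  filter_upwards [hlc, hσ] with n h1 h2 y
  obtain ⟨-, -, -, -, -, h4⟩ := hlv n h2
  exact (mul_le_mul_of_nonneg_right h1 (dotProduct_self_nonneg' y)).trans (h4 y)

end Compactness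

/-! ### Hellinger argument and convergence along an ultrafilter. -/

section Hellinger

variable {g : ℝ → ℝ} {π : ℝ} {θ : Param p} {Q : Measure (Fin p → ℝ)} {t : ℝ}
  {x : ℕ → Fin p → ℝ} {A : ℕ → Set (Fin p → ℝ)} {U : Ultrafilter ℕ}

/-- Upper semicontinuity of truncated empirical means along an ultrafilter. -/
lemma EmpiricalLimit.eventually_mean_le {P : Measure (Fin p → ℝ)} (hU : (U : Filter ℕ) ≤ atTop)
    (hx : EmpiricalLimit x P) (hL : MVELimit g θ t x A U) {φ : (Fin p → ℝ) → ℝ}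
    (hφ : Continuous φ) {B : ℝ} (hφ0 : ∀ y, 0 ≤ φ y) (hφB : ∀ y, φ y ≤ B)
    {F : ℕ → (Fin p → ℝ) → ℝ} (hF : ∀ ε > 0, ∀ᶠ n in U, ∀ y ∈ A n, F n y ≤ φ y + ε)
    {ε : ℝ} (hε : 0 < ε) :
    ∀ᶠ n in U, (∑ i ∈ Finset.range n, (A n).indicator (F n) (x i)) / n ≤
      (∫ y in {y | quadDist θ y ≤ t}, φ y ∂P) + ε := by
  have hPm := hx.isProbabilityMeasure
  have hB : 0 ≤ B := (hφ0 0).trans (hφB 0)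
  set E := {y | quadDist θ y ≤ t} with hE
  have hEm : MeasurableSet E :=
    (isClosed_le (continuous_quadDist θ) continuous_const).measurableSet
  have h0 : P.real (Set.univ ∩ {y | quadDist θ y ≤ t}) < P.real E + ε / (3 * (B + 1)) := by
    rw [Set.univ_inter]
    have : 0 < ε / (3 * (B + 1)) := by positivity
    linarith
  obtain ⟨η, hη, hlt⟩ := exists_measureReal_lt_of_iInter (continuous_quadDist θ) isClosed_univ t h0
  rw [Set.univ_inter] at hlt
  set G := {y | quadDist θ y ≤ t + η} with hG
  have hGm : MeasurableSet G :=
    (isClosed_le (continuous_quadDist θ) continuous_const).measurableSet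
  -- A continuous cutoff, `1` where `q_θ ≤ t + η/2` (hence eventually on `A n`) and `0` where `q_θ >
  -- t + η`. It makes weak convergence applicable.
  let χ : (Fin p → ℝ) → ℝ := fun y => max 0 (min 1 (2 - 2 * (quadDist θ y - t) / η))
  have hχc : Continuous χ := by
    have := continuous_quadDist θ
    fun_prop
  have hχ0 : ∀ y, 0 ≤ χ y := fun y => le_max_left _ _
  have hχ1 : ∀ y, χ y ≤ 1 := fun y => max_le zero_le_one (min_le_left _ _)
  have hχin : ∀ y, quadDist θ y ≤ t + η / 2 → χ y = 1 := by
    intro y hy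
    have : 2 * (quadDist θ y - t) / η ≤ 1 := by rw [div_le_one hη]; linarith
    simp only [χ]
    rw [min_eq_left (by linarith), max_eq_right zero_le_one]
  have hχout : ∀ y, y ∉ G → χ y = 0 := by
    intro y hy
    have hy : t + η < quadDist θ y := not_le.1 hy
    have : 2 ≤ 2 * (quadDist θ y - t) / η := by rw [le_div_iff₀ hη]; linarith
    exact max_eq_left ((min_le_right _ _).trans (by linarith))
  have hψ : ∀ y, φ y * χ y ≤ G.indicator φ y := by
    intro y
    by_cases hy : y ∈ G
    · rw [Set.indicator_of_mem hy]
      exact mul_le_of_le_one_right (hφ0 y) (hχ1 y)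
    · rw [Set.indicator_of_notMem hy, hχout y hy, mul_zero]
  have hφi : Integrable φ P := Integrable.of_bound hφ.aestronglyMeasurable B
    (Eventually.of_forall fun y => by rw [Real.norm_of_nonneg (hφ0 y)]; exact hφB y)
  have hψb : ∀ y, |φ y * χ y| ≤ B := fun y => by
    rw [abs_of_nonneg (mul_nonneg (hφ0 y) (hχ0 y))]
    exact (mul_le_of_le_one_right (hφ0 y) (hχ1 y)).trans (hφB y)
  have hψi : Integrable (fun y => φ y * χ y) P :=
    Integrable.of_bound (hφ.mul hχc).aestronglyMeasurable B (Eventually.of_forall hψb)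
  have hint : ∫ y, φ y * χ y ∂P ≤ (∫ y in E, φ y ∂P) + ε / 3 := by
    have hEG : E ⊆ G := fun y (hy : quadDist θ y ≤ t) =>
      (by linarith : quadDist θ y ≤ t + η)
    calc ∫ y, φ y * χ y ∂P ≤ ∫ y, G.indicator φ y ∂P :=
          integral_mono hψi (hφi.indicator hGm) hψ
      _ = ∫ y in G, φ y ∂P := integral_indicator hGm
      _ = (∫ y in E, φ y ∂P) + ∫ y in G \ E, φ y ∂P := by
          rw [← setIntegral_union Set.disjoint_sdiff_right (hGm.diff hEm) hφi.integrableOn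
            hφi.integrableOn, Set.union_sdiff_cancel hEG]
      _ ≤ (∫ y in E, φ y ∂P) + B * P.real (G \ E) := by
          gcongr
          calc ∫ y in G \ E, φ y ∂P ≤ ∫ _y in G \ E, B ∂P :=
                integral_mono hφi.integrableOn (integrable_const B) hφB
            _ = _ := by simp [mul_comm]
      _ ≤ _ := by
          have h1 : P.real (G \ E) = P.real G - P.real E := measureReal_sdiff hEG hEm
          have h2 : P.real (G \ E) ≤ ε / (3 * (B + 1)) := by linarith
          have h3 : B * P.real (G \ E) ≤ (B + 1) * (ε / (3 * (B + 1))) := by gcongr; linarith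
          have h4 : (B + 1) * (ε / (3 * (B + 1))) = ε / 3 := by field_simp
          linarith
  have hlim := (hx.tendsto_integral (fun y => φ y * χ y) (hφ.mul hχc) ⟨B, hψb⟩).mono_left hU
  filter_upwards [hlim.eventually_lt_const (show _ < (∫ y, φ y * χ y ∂P) + ε / 3 by linarith),
    hF (ε / 3) (by positivity), hL.subset (η / 2) (half_pos hη), hU (eventually_ne_atTop 0)]
    with n h1 h2 h3 h4
  have hn : (0 : ℝ) < n := by exact_mod_cast Nat.pos_of_ne_zero h4
  have hle : ∑ i ∈ Finset.range n, (A n).indicator (F n) (x i) ≤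
      ∑ i ∈ Finset.range n, (φ (x i) * χ (x i) + ε / 3) := by
    refine Finset.sum_le_sum fun i _ => ?_
    by_cases hy : x i ∈ A n
    · rw [Set.indicator_of_mem hy, hχin _ (h3 hy), mul_one]
      exact h2 _ hy
    · rw [Set.indicator_of_notMem hy]
      have := mul_nonneg (hφ0 (x i)) (hχ0 (x i))
      positivity
  rw [Finset.sum_add_distrib] at hle
  simp only [Finset.sum_const, Finset.card_range, nsmul_eq_mul] at hle
  have h5 : (∑ i ∈ Finset.range n, (A n).indicator (F n) (x i)) / n ≤
      (∑ i ∈ Finset.range n, φ (x i) * χ (x i)) / n + ε / 3 := by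
    rw [div_le_iff₀ hn, add_mul, div_mul_cancel₀ _ hn.ne']
    linarith
  linarith

/-- Applied to likelihood ratios, this replaces a logarithm unbounded below at zero by a square
root. -/
lemma log_le_two_mul_sqrt_sub_one {z : ℝ} (hz : 0 < z) : Real.log z ≤ 2 * (√z - 1) := by
  have h := Real.log_le_sub_one_of_pos (Real.sqrt_pos.2 hz)
  rw [Real.log_sqrt hz.le] at h
  linarith

/-- Likelihood domination yields a Hellinger-type inequality for the sample. -/
lemma Dominates.hellinger {B : Set (Fin p → ℝ)} {n : ℕ} {w₀ w : ℝ} {σ : Param p}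
    (h : Dominates g w₀ θ B x n w σ) (hn : n ≠ 0) (hw₀ : 0 < w₀)
    (hθ : ∀ y ∈ B, 0 < density g θ y) (hs : 0 < 1 - w₀ * (ellipticalMeasure g θ).real B) :
    0 ≤ (∑ i ∈ Finset.range n, B.indicator
        (fun y => √(w * density g σ y / (w₀ * density g θ y))) (x i)) / n -
      (empirical x n).real B + (1 - (empirical x n).real B) *
        (√((1 - w * (ellipticalMeasure g σ).real B) /
          (1 - w₀ * (ellipticalMeasure g θ).real B)) - 1) := by
  set r := √((1 - w * (ellipticalMeasure g σ).real B) / (1 - w₀ * (ellipticalMeasure g θ).real B))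
  set m := (empirical x n).real B
  have hpt : ∀ i ∈ Finset.range n, logTerm g B w σ (x i) - logTerm g B w₀ θ (x i) ≤
      2 * (B.indicator (fun y => √(w * density g σ y / (w₀ * density g θ y))) (x i) -
        B.indicator (fun _ => (1 : ℝ)) (x i) + (r - 1) -
        B.indicator (fun _ => r - 1) (x i)) := by
    intro i hi
    by_cases hy : x i ∈ B
    · have hd := h.density_pos i (Finset.mem_range.1 hi) hy
      have hd0 := hθ _ hy
      have h1 := log_le_two_mul_sqrt_sub_one (div_pos (mul_pos h.pos hd) (mul_pos hw₀ hd0))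
      rw [Real.log_div (mul_pos h.pos hd).ne' (mul_pos hw₀ hd0).ne'] at h1
      simp only [logTerm, Set.indicator_of_mem hy, Set.indicator_of_notMem
        (Set.notMem_compl_iff.2 hy), add_zero]
      linarith
    · have h1 := log_le_two_mul_sqrt_sub_one (div_pos h.outside_pos hs)
      rw [Real.log_div h.outside_pos.ne' hs.ne'] at h1
      simp only [logTerm, Set.indicator_of_notMem hy, Set.indicator_of_mem
        (Set.mem_compl hy), zero_add]
      linarith
  have hsum := Finset.sum_le_sum hpt
  rw [Finset.sum_sub_distrib, ← Finset.mul_sum, Finset.sum_sub_distrib, Finset.sum_add_distrib,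
    Finset.sum_sub_distrib, sum_indicator_const x hn, sum_indicator_const x hn] at hsum
  simp only [Finset.sum_const, Finset.card_range, nsmul_eq_mul] at hsum
  have hn' : (0 : ℝ) < n := by exact_mod_cast Nat.pos_of_ne_zero hn
  have hle := h.le
  have h2 : 0 ≤ (∑ i ∈ Finset.range n, B.indicator
        (fun y => √(w * density g σ y / (w₀ * density g θ y))) (x i)) +
        (-m + (1 - m) * (r - 1)) * n := by linarith
  have h3 := div_nonneg h2 hn'.le
  rw [add_div, mul_div_cancel_right₀ _ hn'.ne'] at h3
  linarith

/-- Consistency along an ultrafilter. -/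
lemma tendsto_of_dominates (hp : 1 ≤ p) (hg : IsEllipticalGenerator p g) (hG1 : CondG1 g)
    (hG2 : CondG2 g) (hdecay : PolynomialDecay p g) (hGEM : IsGEM g π θ Q) (hπ : π < 1 / 2)
    (hU : (U : Filter ℕ) ≤ atTop)
    (ht : IsPopulationLevel g π θ Q t) (hx : EmpiricalLimit x (contaminated g π θ Q))
    (hL : MVELimit g θ t x A U) {w : ℕ → ℝ} {σ : ℕ → Param p} {W : ℝ}
    (hdom : ∀ᶠ n in U, Dominates g (1 - π) θ (A n) x n (w n) (σ n))
    (hW : ∀ᶠ n in U, w n ≤ W) :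
    Tendsto w U (𝓝 (1 - π)) ∧ Tendsto σ U (𝓝 θ) := by
  have hθ := hGEM.mem_paramSpace
  have hw₀ : 0 < 1 - π := by linarith
  set w₀ := 1 - π with hw₀def
  obtain ⟨σ', hσ', hσlim⟩ := exists_tendsto_of_dominates hp hg hG1 hG2 hdecay hGEM hπ hU ht hx hL
    hdom hW
  obtain ⟨w', -, hwlim⟩ := exists_tendsto_of_abs_le U (a := w) (C := W) (by
    filter_upwards [hdom, hW] with n h1 h2
    rwa [abs_of_pos h1.pos])
  have hw' : 0 ≤ w' := ge_of_tendsto hwlim (hdom.mono fun n hn => hn.pos.le)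
  obtain ⟨η, hη, c, hc, hdens⟩ := exists_density_ge hg hG2 hθ ht
  set E := {y | quadDist θ y ≤ t} with hEdef
  have hEm : MeasurableSet E :=
    (isClosed_le (continuous_quadDist θ) continuous_const).measurableSet
  have hσm : ∀ᶠ n in U, σ n ∈ paramSpace p := hdom.mono fun n hn => hn.mem
  have hfθ := continuous_density hG2 hθ
  have hfσ := continuous_density hG2 hσ'
  have hnn := density_nonneg hg hσ'
  -- Truncating the denominator at `c` makes `φ` continuous and bounded everywhere; near `E` the
  -- true density is at least `c`, so nothing changes there.
  set φ : (Fin p → ℝ) → ℝ := fun y => √(w' * density g σ' y / (w₀ * max (density g θ y) c)) with hφ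
  have hden : ∀ y, 0 < w₀ * max (density g θ y) c := fun y =>
    mul_pos hw₀ (lt_of_lt_of_le hc (le_max_right _ _))
  have hφc : Continuous φ := by
    refine Real.continuous_sqrt.comp ?_
    exact (continuous_const.mul hfσ).div (continuous_const.mul (hfθ.max continuous_const))
      fun y => (hden y).ne'
  have hφB : ∀ y, φ y ≤ √(w' * ((√σ'.2.det)⁻¹ * g 0) / (w₀ * c)) := by
    intro y
    refine Real.sqrt_le_sqrt ?_
    have h1 := density_le hg hσ' y
    have h2 := le_max_right (density g θ y) c
    have h3 := (hnn y).trans h1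
    gcongr
  have hunif : ∀ ε > 0, ∀ᶠ n in U, ∀ y ∈ A n,
      √(w n * density g (σ n) y / (w₀ * density g θ y)) ≤ φ y + ε := by
    intro ε hε
    have hK : IsCompact {y | quadDist θ y ≤ t + η} := by
      rw [setOf_quadDist_le_eq_ellipsoid θ (add_pos ht.pos hη).le]
      exact (isCompact_closedBall _ _).of_isClosed_subset (isClosed_ellipsoid _ _)
        (ellipsoid_subset_closedBall hθ _)
    -- Joint continuity is uniform over the compact set. Membership in `paramSpace` stays a
    -- hypothesis, as the density is only continuous relative to it.
    have htube : ∀ᶠ z : ℝ × Param p in 𝓝 (w', σ'), ∀ y ∈ {y | quadDist θ y ≤ t + η},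
        z.2 ∈ paramSpace p →
          √(z.1 * density g z.2 y / (w₀ * max (density g θ y) c)) < φ y + ε := by
      refine hK.eventually_forall_of_forall_eventually fun y _ => ?_
      set S : Set ((ℝ × Param p) × (Fin p → ℝ)) := {z | z.1.2 ∈ paramSpace p}
      have h1 : ContinuousWithinAt (fun z : (ℝ × Param p) × (Fin p → ℝ) => density g z.1.2 z.2) S
          ((w', σ'), y) :=
        ContinuousWithinAt.comp (f := fun z : (ℝ × Param p) × (Fin p → ℝ) => (z.1.2, z.2))
          (g := fun z : Param p × (Fin p → ℝ) => density g z.1 z.2)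
          (t := paramSpace p ×ˢ Set.univ)
          (continuousWithinAt_density hG2 (z := (σ', y)) hσ') (by fun_prop)
          fun z hz => ⟨hz, trivial⟩
      have h2 : ContinuousWithinAt (fun z : (ℝ × Param p) × (Fin p → ℝ) =>
          √(z.1.1 * density g z.1.2 z.2 / (w₀ * max (density g θ z.2) c))) S ((w', σ'), y) := by
        refine (Real.continuous_sqrt.continuousAt).comp_continuousWithinAt ?_
        refine ContinuousWithinAt.div (ContinuousWithinAt.mul (by fun_prop) h1) ?_ (hden y).ne'
        exact Continuous.continuousWithinAt (by fun_prop)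
      have h3 : ContinuousWithinAt (fun z : (ℝ × Param p) × (Fin p → ℝ) => φ z.2 + ε) S
          ((w', σ'), y) := Continuous.continuousWithinAt (by fun_prop)
      have h4 := h2.tendsto.eventually_lt h3.tendsto (by simpa [hφ] using hε)
      exact eventually_nhdsWithin_iff.1 h4
    filter_upwards [(hwlim.prodMk_nhds hσlim).eventually htube, hσm, hL.subset η hη]
      with n h1 h2 h3 y hy
    have h4 := h1 y (h3 hy) h2
    rw [max_eq_left (hdens y (h3 hy))] at h4
    exact h4.le
  set J := ∫ y in E, φ y ∂(contaminated g π θ Q)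
  have hs0 := hL.tendsto_outside hθ ht
  have hs := ((hwlim.mul (hL.tendsto_elliptical σ' σ hσ' hσm hσlim)).const_sub 1)
  set s' := 1 - w' * (ellipticalMeasure g σ').real E with hs'def
  have hs'0 : 0 ≤ s' := ge_of_tendsto hs (hdom.mono fun n hn => hn.outside_pos.le)
  have hJ : 0 ≤ J - 1 / 2 + (1 - 1 / 2) * (√(s' / (1 / 2)) - 1) := by
    refine le_of_forall_pos_le_add fun ε hε => ?_
    have hlim : Tendsto (fun n => J + ε - (empirical x n).real (A n) +
        (1 - (empirical x n).real (A n)) *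
        (√((1 - w n * (ellipticalMeasure g (σ n)).real (A n)) /
          (1 - w₀ * (ellipticalMeasure g θ).real (A n))) - 1)) U
        (𝓝 (J + ε - 1 / 2 + (1 - 1 / 2) * (√(s' / (1 / 2)) - 1))) := by
      refine (tendsto_const_nhds.sub hL.tendsto_empirical).add
        ((hL.tendsto_empirical.const_sub 1).mul (Tendsto.sub_const ?_ 1))
      exact (Real.continuous_sqrt.tendsto _).comp (hs.div hs0 (by norm_num))
    have h1 : 0 ≤ J + ε - 1 / 2 + (1 - 1 / 2) * (√(s' / (1 / 2)) - 1) := by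
      refine ge_of_tendsto hlim ?_
      filter_upwards [hdom, hx.eventually_mean_le hU hL hφc (fun y => Real.sqrt_nonneg _) hφB hunif
        hε, hU (eventually_ne_atTop 0), hL.subset η hη, hs0.eventually_const_lt
        (show (0 : ℝ) < 1 / 2 by norm_num)] with n h1 h2 h3 h4 h5
      have := h1.hellinger h3 hw₀ (fun y hy => hc.trans_le (hdens y (h4 hy))) h5
      linarith
    linarith
  have hdensE : ∀ y ∈ E, c ≤ density g θ y := fun y hy =>
    hdens y (le_trans (show quadDist θ y ≤ t from hy) (by linarith))
  have hiσ := integrable_density hg hG2 hσ'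
  have hiθ := integrable_density hg hG2 hθ
  have hsq : ∀ y, √(w' * density g σ' y) ^ 2 = w' * density g σ' y := fun y =>
    Real.sq_sqrt (mul_nonneg hw' (hnn y))
  have hsq0 : ∀ y, √(w₀ * density g θ y) ^ 2 = w₀ * density g θ y := fun y =>
    Real.sq_sqrt (mul_nonneg hw₀.le (density_nonneg hg hθ y))
  have hcross : Integrable (fun y => √(w' * density g σ' y) * √(w₀ * density g θ y)) := by
    refine Integrable.mono' ((hiσ.const_mul w').add (hiθ.const_mul w₀)) ?_
      (Eventually.of_forall fun y => ?_)
    · exact (((continuous_const.mul hfσ).sqrt).mul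
        ((continuous_const.mul hfθ).sqrt)).aestronglyMeasurable
    · rw [Real.norm_of_nonneg (by positivity)]
      simp only [Pi.add_apply]
      nlinarith [sq_nonneg (√(w' * density g σ' y) - √(w₀ * density g θ y)), hsq y, hsq0 y,
        sq_nonneg (√(w' * density g σ' y)), sq_nonneg (√(w₀ * density g θ y))]
  -- On `E` the mixture is `w₀ P_θ`, since `Q(E) = 0`; multiplying `φ` by its density leaves the
  -- Hellinger affinity.
  have hJeq : J = ∫ y in E, √(w' * density g σ' y) * √(w₀ * density g θ y) := by
    have hQE : Q.restrict E = 0 := Measure.restrict_eq_zero.2 ht.null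
    have h1 : (contaminated g π θ Q).restrict E =
        ENNReal.ofReal w₀ • ((ellipticalMeasure g θ).restrict E) := by
      rw [contaminated, Measure.restrict_add, Measure.restrict_smul, Measure.restrict_smul, hQE,
        smul_zero, add_zero]
    have h2 : J = w₀ * ∫ y in E, φ y ∂(ellipticalMeasure g θ) := by
      simp only [J]
      rw [h1, integral_smul_measure, ENNReal.toReal_ofReal hw₀.le, smul_eq_mul]
    have h3 : ∫ y in E, φ y ∂(ellipticalMeasure g θ) = ∫ y in E, density g θ y * φ y := by
      rw [ellipticalMeasure, restrict_withDensity hEm,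
        integral_withDensity_eq_integral_toReal_smul
          (by fun_prop) (Eventually.of_forall fun y => ENNReal.ofReal_lt_top)]
      refine integral_congr_ae (Eventually.of_forall fun y => ?_)
      simp only [smul_eq_mul]
      rw [ENNReal.toReal_ofReal (density_nonneg hg hθ y)]
    rw [h2, h3, ← integral_const_mul]
    refine setIntegral_congr_fun hEm fun y hy => ?_
    have hpos : 0 < w₀ * density g θ y := mul_pos hw₀ (hc.trans_le (hdensE y hy))
    simp only [hφ]
    rw [max_eq_left (hdensE y hy), Real.sqrt_div (mul_nonneg hw' (hnn y)), ← mul_assoc]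
    nth_rewrite 1 [← hsq0 y]
    have := (Real.sqrt_pos.2 hpos).ne'
    field_simp
  -- Expanding the square gives `3/2 - s' - 2J`. The limiting inequality says `2J ≥ 2 - √(2s')`, and
  -- `√(2s') ≤ s' + 1/2` is the arithmetic-geometric mean inequality.
  have hI : ∫ y in E, (√(w' * density g σ' y) - √(w₀ * density g θ y)) ^ 2 ≤ 0 := by
    have h1 : ∫ y in E, (√(w' * density g σ' y) - √(w₀ * density g θ y)) ^ 2 =
        (1 - s') + 1 / 2 - 2 * J := by
      have e : ∀ y, (√(w' * density g σ' y) - √(w₀ * density g θ y)) ^ 2 =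
          (w' * density g σ' y + w₀ * density g θ y) -
            2 * (√(w' * density g σ' y) * √(w₀ * density g θ y)) := by
        intro y
        rw [sub_sq, hsq y, hsq0 y]; ring
      simp_rw [e]
      have hadd : Integrable fun y => w' * density g σ' y + w₀ * density g θ y :=
        (hiσ.const_mul w').add (hiθ.const_mul w₀)
      rw [integral_sub hadd.integrableOn
        (hcross.const_mul 2).integrableOn, integral_add (hiσ.const_mul w').integrableOn
        (hiθ.const_mul w₀).integrableOn, integral_const_mul, integral_const_mul,
        integral_const_mul, ← hJeq, ← ellipticalMeasure_real hg hG2 hσ' hEm,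
        ← ellipticalMeasure_real hg hG2 hθ hEm, ht.measure_eq, hs'def]
      ring
    have h2 : √(s' / (1 / 2)) ≤ s' + 1 / 2 := by
      refine Real.sqrt_le_iff.2 ⟨by linarith, ?_⟩
      nlinarith [sq_nonneg (s' - 1 / 2)]
    rw [h1]
    linarith
  have hcont : Continuous fun y => (√(w' * density g σ' y) - √(w₀ * density g θ y)) ^ 2 := by
    fun_prop
  have hint : IntegrableOn (fun y => (√(w' * density g σ' y) - √(w₀ * density g θ y)) ^ 2) E := by
    have h1 : IsCompact E := by
      rw [hEdef, setOf_quadDist_le_eq_ellipsoid θ ht.pos.le]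
      exact (isCompact_closedBall _ _).of_isClosed_subset (isClosed_ellipsoid _ _)
        (ellipsoid_subset_closedBall hθ _)
    exact hcont.continuousOn.integrableOn_compact h1
  have hae : (fun y => (√(w' * density g σ' y) - √(w₀ * density g θ y)) ^ 2)
      =ᵐ[volume.restrict E] 0 :=
    (integral_eq_zero_iff_of_nonneg (fun y => sq_nonneg _) hint).1
      (le_antisymm hI (integral_nonneg fun y => sq_nonneg _))
  have hV : IsOpen {y | quadDist θ y < t} := isOpen_lt (continuous_quadDist θ) continuous_const
  have hVE : {y | quadDist θ y < t} ⊆ E :=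
    fun y (hy : quadDist θ y < t) => (hy.le : quadDist θ y ≤ t)
  -- Almost everywhere equality becomes equality everywhere on the open set `{q_θ < t}` by
  -- continuity.
  have heq := Measure.eqOn_open_of_ae_eq (ae_restrict_of_ae_restrict_of_subset hVE hae) hV
    hcont.continuousOn continuousOn_const
  obtain ⟨h1, h2⟩ := eq_of_density_eq hg hG1 hG2 hσ' hθ ht.pos hw₀ (w := w') fun y hy => by
    have h3 : (√(w' * density g σ' y) - √(w₀ * density g θ y)) ^ 2 = 0 := heq hy
    have h4 : √(w' * density g σ' y) = √(w₀ * density g θ y) := by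
      have := pow_eq_zero_iff (two_ne_zero) |>.1 h3
      linarith
    rw [← hsq, h4, hsq0]
  exact ⟨h1 ▸ hwlim, h2 ▸ hσlim⟩

end Hellinger

/-! ### Polynomial decay of the generator. -/

section Decay

variable {g : ℝ → ℝ}

/-- Below `R` the bound `g ≤ g 0 ≤ g 0 * (R / r) ^ γ` suffices, at the price of a larger constant.
-/
lemma polynomialDecay_of_eventually (hg : IsEllipticalGenerator p g) (hG1 : CondG1 g) {C γ R : ℝ}
    (hγ : (p : ℝ) / 2 < γ) (hR : 0 < R) (h : ∀ r, R ≤ r → g r ≤ C * r ^ (-γ)) :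
    PolynomialDecay p g := by
  have hγ0 : 0 < γ := lt_of_le_of_lt (by positivity) hγ
  have hg0 := generator_zero_pos hg hG1
  refine ⟨|C| + g 0 * R ^ γ, γ, by positivity, hγ, fun r hr => ?_⟩
  rw [add_mul]
  rcases le_total R r with hle | hle
  · have h1 : C * r ^ (-γ) ≤ |C| * r ^ (-γ) := by gcongr; exact le_abs_self C
    have h2 : 0 ≤ g 0 * R ^ γ * r ^ (-γ) := by positivity
    linarith [h r hle]
  · have h1 : g r ≤ g 0 := hg.antitoneOn (Set.mem_Ici.2 le_rfl) hr.le hr.le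
    have h2 : 1 ≤ R ^ γ * r ^ (-γ) := by
      rw [Real.rpow_neg hr.le, ← div_eq_mul_inv, one_le_div (by positivity)]
      exact Real.rpow_le_rpow hr.le hle hγ0.le
    have h3 : 0 ≤ |C| * r ^ (-γ) := by positivity
    have h4 := mul_le_mul_of_nonneg_left h2 hg0.le
    rw [mul_one, ← mul_assoc] at h4
    linarith

lemma polynomialDecay_of_condGp (hg : IsEllipticalGenerator p g) (hG1 : CondG1 g)
    (hGp : CondGp p g) (hp : 1 < p) : PolynomialDecay p g := by
  obtain ⟨γ, hγ, hlim⟩ := hGp hp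
  obtain ⟨R, hR⟩ := eventually_atTop.1 ((hlim.eventually_lt_const zero_lt_one).and
    (eventually_gt_atTop 0))
  have hR0 : 0 < max R 1 := lt_of_lt_of_le one_pos (le_max_right _ _)
  refine polynomialDecay_of_eventually hg hG1 (C := 1) hγ hR0 fun r hr => ?_
  obtain ⟨h1, h2⟩ := hR r ((le_max_left _ _).trans hr)
  rw [one_mul, Real.rpow_neg h2.le, ← one_div, le_div_iff₀ (Real.rpow_pos_of_pos h2 _)]
  linarith

/-- Spherical parameters. -/
noncomputable def spherical (a : Fin p → ℝ) (r : ℝ) : Param p :=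
  (a, r • (1 : Matrix (Fin p) (Fin p) ℝ))

lemma spherical_mem (a : Fin p → ℝ) {r : ℝ} (hr : 0 < r) : spherical a r ∈ paramSpace p :=
  Matrix.PosDef.smul Matrix.PosDef.one hr

lemma quadDist_spherical (a : Fin p → ℝ) {r : ℝ} (hr : 0 < r) (y : Fin p → ℝ) :
    quadDist (spherical a r) y = r⁻¹ * ((y - a) ⬝ᵥ (y - a)) := by
  have h := quadDist_smul (θ := (a, (1 : Matrix (Fin p) (Fin p) ℝ))) Matrix.PosDef.one hr.ne' y
  have h2 : spherical a r = (a, r • (1 : Matrix (Fin p) (Fin p) ℝ)) := rfl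
  rw [h2, h]
  simp [quadDist]

lemma sqrt_det_spherical (a : Fin p → ℝ) {r : ℝ} (hr : 0 < r) :
    √(spherical a r).2.det = √r ^ p := by
  have h : (spherical a r).2.det = (√r ^ p) ^ 2 := by
    rw [← pow_mul, mul_comm p 2, pow_mul, Real.sq_sqrt hr.le]
    simp [spherical]
  rw [h, Real.sqrt_sq (by positivity)]

/-- The standardizing substitution. The right side depends neither on `a` nor on `r`, so one `T`
fixes the mass for all scales. -/
lemma ellipticalMeasure_spherical (hg : IsEllipticalGenerator p g) (hG2 : CondG2 g)
    (a : Fin p → ℝ) {r : ℝ} (hr : 0 < r) (T : ℝ) :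
    (ellipticalMeasure g (spherical a r)).real {y | quadDist (spherical a r) y ≤ T} =
      ∫ z : Fin p → ℝ, {z : Fin p → ℝ | z ⬝ᵥ z ≤ T}.indicator (fun z => g (z ⬝ᵥ z)) z := by
  have hm : MeasurableSet {y | quadDist (spherical a r) y ≤ T} :=
    (isClosed_le (continuous_quadDist _) continuous_const).measurableSet
  set F : (Fin p → ℝ) → ℝ := {z : Fin p → ℝ | z ⬝ᵥ z ≤ T}.indicator (fun z => g (z ⬝ᵥ z))
  rw [ellipticalMeasure_real hg hG2 (spherical_mem a hr) hm, ← integral_indicator hm]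
  have hs : 0 < √r := Real.sqrt_pos.2 hr
  have h1 : ∀ y, {y | quadDist (spherical a r) y ≤ T}.indicator (density g (spherical a r)) y =
      (√r ^ p)⁻¹ * F ((√r)⁻¹ • (y - a)) := by
    intro y
    have hq : ((√r)⁻¹ • (y - a)) ⬝ᵥ ((√r)⁻¹ • (y - a)) = quadDist (spherical a r) y := by
      rw [quadDist_spherical a hr, smul_dotProduct, dotProduct_smul, smul_eq_mul, smul_eq_mul,
        ← mul_assoc, ← mul_inv, Real.mul_self_sqrt hr.le]
    by_cases hy : quadDist (spherical a r) y ≤ T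
    · rw [Set.indicator_of_mem (s := {y | quadDist (spherical a r) y ≤ T}) hy]
      simp only [F]
      rw [Set.indicator_of_mem (by rw [Set.mem_ofPred_eq, hq]; exact hy), hq, density,
        sqrt_det_spherical a hr]
    · rw [Set.indicator_of_notMem (s := {y | quadDist (spherical a r) y ≤ T}) hy]
      simp only [F]
      rw [Set.indicator_of_notMem (by rw [Set.mem_ofPred_eq, hq]; exact hy), mul_zero]
  simp_rw [h1]
  rw [integral_const_mul, integral_sub_right_eq_self (fun y => F ((√r)⁻¹ • y)),
    Measure.integral_comp_smul]
  simp only [Module.finrank_fintype_fun_eq_card, Fintype.card_fin, smul_eq_mul, inv_pow, inv_inv]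
  rw [abs_of_pos (by positivity), ← mul_assoc, inv_mul_cancel₀ (by positivity), one_mul]

/-! ### Dimension one: decay from the existence of a maximizer. -/

section OneDimensional

variable {x : ℕ → Fin 1 → ℝ} {n : ℕ} {A : Set (Fin 1 → ℝ)}

lemma dotProduct_self_one (y : Fin 1 → ℝ) : y ⬝ᵥ y = (y 0) ^ 2 := by
  simp [dotProduct, sq]

lemma ellipsoid_spherical_one (m : Fin 1 → ℝ) {s : ℝ} (hs : 0 < s) :
    ellipsoid (spherical m (s ^ 2)) 1 = {y | |y 0 - m 0| ≤ s} := by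
  ext y
  simp only [ellipsoid, Set.mem_ofPred_eq]
  rw [quadDist_spherical m (by positivity), dotProduct_self_one, inv_mul_le_iff₀ (by positivity),
    one_pow, mul_one, Pi.sub_apply, sq_le_sq, abs_of_pos hs]

lemma exists_interval (hA : IsEllipsoid A) :
    ∃ (m : Fin 1 → ℝ) (s : ℝ), 0 < s ∧ A = {y | |y 0 - m 0| ≤ s} := by
  obtain ⟨τ, hτ, rfl⟩ := isEllipsoid_iff.1 hA
  have hpos : 0 < τ.2 0 0 := Matrix.PosDef.diag_pos hτ
  refine ⟨τ.1, √(τ.2 0 0), Real.sqrt_pos.2 hpos, ?_⟩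
  rw [← ellipsoid_spherical_one τ.1 (Real.sqrt_pos.2 hpos), Real.sq_sqrt hpos.le]
  congr 1
  refine Prod.ext rfl ?_
  ext i j
  rw [Subsingleton.elim i 0, Subsingleton.elim j 0]
  simp [spherical]

/-- A one-dimensional MVE of an empirical measure has an observation at one of its endpoints. -/
lemma exists_observation_endpoint (hn : n ≠ 0) (hA : IsMVE (empirical x n) A) :
    ∃ (m : Fin 1 → ℝ) (s : ℝ), 0 < s ∧ A = {y | |y 0 - m 0| ≤ s} ∧
      ∃ i < n, |x i 0 - m 0| = s := by
  obtain ⟨m, s, hs, hAeq⟩ := exists_interval hA.1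
  refine ⟨m, s, hs, hAeq, ?_⟩
  by_contra! hcon
  have := isProbabilityMeasure_empirical x hn
  -- With no observation at an endpoint the interval could shrink slightly and keep all its
  -- observations, contradicting minimality.
  have hev : ∀ᶠ u in 𝓝[<] s, ∀ i ∈ Finset.range n, x i ∈ A → |x i 0 - m 0| ≤ u := by
    rw [Filter.eventually_all_finset]
    intro i hi
    by_cases hx : x i ∈ A
    · have h1 : |x i 0 - m 0| ≤ s := by rw [hAeq] at hx; exact hx
      have h2 := lt_of_le_of_ne h1 (hcon i (Finset.mem_range.1 hi))
      filter_upwards [Ioo_mem_nhdsLT h2] with u hu _ using hu.1.le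
    · exact Eventually.of_forall fun u h => absurd h hx
  obtain ⟨u, hu, hu0, hus⟩ := (hev.and (Ioo_mem_nhdsLT hs)).exists
  have hell : IsEllipsoid {y : Fin 1 → ℝ | |y 0 - m 0| ≤ u} :=
    isEllipsoid_iff.2 ⟨_, spherical_mem m (by positivity), (ellipsoid_spherical_one m hu0).symm⟩
  have hmass : 1 / 2 ≤ empirical x n {y : Fin 1 → ℝ | |y 0 - m 0| ≤ u} := by
    refine hA.2.1.trans ?_
    rw [empirical_apply, empirical_apply]
    refine mul_le_mul' le_rfl (Finset.sum_le_sum fun i hi => ?_)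
    by_cases hx : x i ∈ A
    · rw [Set.indicator_of_mem hx, Set.indicator_of_mem]
      exact hu i hi hx
    · rw [Set.indicator_of_notMem hx]; exact bot_le
  have hvol := hA.2.2 _ hell hmass
  rw [hAeq, ← ellipsoid_spherical_one m hs, ← ellipsoid_spherical_one m hu0,
    volume_ellipsoid_le_iff le_rfl (spherical_mem m (by positivity))
      (spherical_mem m (by positivity)) zero_le_one zero_le_one,
    sqrt_det_spherical m (by positivity), sqrt_det_spherical m (by positivity),
    Real.sqrt_sq hs.le, Real.sqrt_sq hu0.le] at hvol
  norm_num at hvol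
  linarith

/-- The mass of an interval under a symmetric distribution concentrated at one of its
endpoints. -/
lemma ellipticalMeasure_interval (hg : IsEllipticalGenerator 1 g) (hG2 : CondG2 g)
    {m a : Fin 1 → ℝ} {s : ℝ} (ha : |a 0 - m 0| = s) {r : ℝ} (hr : 0 < r) :
    (ellipticalMeasure g (spherical a r)).real {y | |y 0 - m 0| ≤ s} ≤ 1 / 2 ∧
      (ellipticalMeasure g (spherical a r)).real {y | quadDist (spherical a r) y ≤ s ^ 2 / r} ≤
        2 * (ellipticalMeasure g (spherical a r)).real {y | |y 0 - m 0| ≤ s} := by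
  have hθ := spherical_mem a hr
  have := hg.isProbabilityMeasure _ hθ
  set ν := ellipticalMeasure g (spherical a r)
  set A : Set (Fin 1 → ℝ) := {y | |y 0 - m 0| ≤ s} with hAdef
  -- The reflection of `A` in the endpoint `a`: it has the same mass, meets `A` only at `a`, and
  -- together with `A` covers the interval of half-length `s` about `a`.
  set A' : Set (Fin 1 → ℝ) := {y | |(a + a - y) 0 - m 0| ≤ s} with hA'def
  have hA : MeasurableSet A := (isClosed_le (by fun_prop) continuous_const).measurableSet
  have hA' : MeasurableSet A' := (isClosed_le (by fun_prop) continuous_const).measurableSet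
  have hrefl : ν.real A' = ν.real A := by
    rw [ellipticalMeasure_real hg hG2 hθ hA, ellipticalMeasure_real hg hG2 hθ hA',
      ← integral_indicator hA, ← integral_indicator hA',
      ← integral_sub_left_eq_self (fun y => A.indicator (density g (spherical a r)) y) volume (a + a)]
    refine integral_congr_ae (Eventually.of_forall fun y => ?_)
    have hd : density g (spherical a r) (a + a - y) = density g (spherical a r) y := by
      have e : a + a - y - a = -(y - a) := by abel
      rw [density, density, quadDist_spherical a hr, quadDist_spherical a hr, e, neg_dotProduct,
        dotProduct_neg, neg_neg]
    by_cases hy : y ∈ A'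
    · have hy2 : a + a - y ∈ A := hy
      simp only []
      rw [Set.indicator_of_mem hy, Set.indicator_of_mem hy2, hd]
    · have hy2 : a + a - y ∉ A := hy
      simp only []
      rw [Set.indicator_of_notMem hy, Set.indicator_of_notMem hy2]
  have hmeet : ν.real (A ∩ A') = 0 := by
    have hsub : A ∩ A' ⊆ {y | quadDist (spherical a r) y = 0} := by
      rintro y ⟨h1, h2⟩
      have h1 : |y 0 - m 0| ≤ s := h1
      have h2 : |a 0 + a 0 - y 0 - m 0| ≤ s := h2
      have h3 : y 0 = a 0 := by
        rw [← ha, abs_le] at h1 h2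
        rcases abs_cases (a 0 - m 0) with h | h <;> linarith
      have h4 : y = a := by
        funext i
        rw [Subsingleton.elim i 0, h3]
      change quadDist (spherical a r) y = 0
      rw [h4]
      exact quadDist_self (spherical a r)
    rw [measureReal_def, measure_mono_null hsub
      (ellipticalMeasure_null (volume_quadDist_eq le_rfl hθ 0)), ENNReal.toReal_zero]
  have hunion := measureReal_union_add_inter (μ := ν) (s := A) hA'
  rw [hmeet, hrefl, add_zero] at hunion
  constructor
  · have : ν.real (A ∪ A') ≤ 1 := measureReal_le_one
    linarith
  · have hsub : {y | quadDist (spherical a r) y ≤ s ^ 2 / r} ⊆ A ∪ A' := by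
      intro y hy
      have hy : quadDist (spherical a r) y ≤ s ^ 2 / r := hy
      rw [quadDist_spherical a hr, dotProduct_self_one, inv_mul_eq_div,
        div_le_div_iff_of_pos_right hr, Pi.sub_apply] at hy
      have hs : 0 ≤ s := ha ▸ abs_nonneg _
      have hy := abs_le.1 (abs_le_of_sq_le_sq hy hs)
      have h : |y 0 - m 0| ≤ s ∨ |a 0 + a 0 - y 0 - m 0| ≤ s := by
        rw [abs_le, abs_le]
        rcases abs_cases (a 0 - m 0) with h | h <;> rcases le_total (y 0) (a 0) with h' | h'
        · exact Or.inl ⟨by linarith, by linarith⟩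
        · exact Or.inr ⟨by linarith, by linarith⟩
        · exact Or.inr ⟨by linarith, by linarith⟩
        · exact Or.inl ⟨by linarith, by linarith⟩
      exact h
    have := measureReal_mono (μ := ν) hsub
    linarith

/-- In dimension one, polynomial decay of the generator follows from the boundedness of the
likelihood of a single sample. -/
lemma polynomialDecay_of_bounded (hg : IsEllipticalGenerator 1 g) (hG1 : CondG1 g)
    (hG2 : CondG2 g) (hn : n ≠ 0) (hA : IsMVE (empirical x n) A) {α B : ℝ} (hα : α < 1 / 2)
    (hB : ∀ θ ∈ paramSpace 1, (∀ y, 0 < density g θ y) → α ≤ (ellipticalMeasure g θ).real A →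
      (ellipticalMeasure g θ).real A ≤ 1 / 2 →
      ∑ i ∈ Finset.range n, A.indicator (fun y => Real.log (density g θ y)) (x i) ≤ B) :
    PolynomialDecay 1 g := by
  have hg0 := generator_zero_pos hg hG1
  by_cases hT : ∃ T > 0, g T ≤ 0
  · obtain ⟨T, hT, hgT⟩ := hT
    refine polynomialDecay_of_eventually hg hG1 (C := 0) (γ := 1) (by norm_num) hT fun r hr => ?_
    rw [zero_mul]
    exact (hg.antitoneOn hT.le (hT.le.trans hr) hr).trans hgT
  push Not at hT
  have hgpos : ∀ u, 0 ≤ u → 0 < g u := by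
    intro u hu
    rcases hu.eq_or_lt with rfl | hu
    exacts [hg0, hT u hu]
  obtain ⟨m, s, hs, hAeq, i₀, hi₀, ha⟩ := exists_observation_endpoint hn hA
  set a := x i₀ with hadef
  have haA : a ∈ A := by rw [hAeq]; exact ha.le
  -- For `r ≤ s² / T` the interval about `a` has mass at least `2α`, so `A` has mass at least `α`.
  -- The maximum with `1/2` only keeps the level positive.
  obtain ⟨T, hT0, hTb⟩ := exists_ellipticalMeasure_eq le_rfl hg hG2
    (spherical_mem a one_pos) (a := max (2 * α) (1 / 2))
    ⟨lt_max_of_lt_right (by norm_num), max_lt (by linarith) (by norm_num)⟩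
  rw [ellipticalMeasure_spherical hg hG2 a one_pos] at hTb
  set k := (n : ℝ) * (empirical x n).real A
  have hk1 : 1 ≤ k := by
    have h1 := sum_indicator_const x hn A 1
    rw [one_mul] at h1
    rw [show k = _ from h1.symm]
    calc (1 : ℝ) = A.indicator (fun _ => (1 : ℝ)) (x i₀) := by rw [Set.indicator_of_mem haA]
      _ ≤ _ := Finset.single_le_sum (f := fun i => A.indicator (fun _ => (1 : ℝ)) (x i))
        (fun i _ => Set.indicator_nonneg (fun _ _ => zero_le_one) _) (Finset.mem_range.2 hi₀)
  -- Observations in `A` are within `2s` of the endpoint `a`, so their scaled squared distance is at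
  -- most `D / r`.
  set D := (2 * s) ^ 2
  have hD : 0 < D := by positivity
  -- Centre the distribution at `a`. Each of the `k` observations in `A` gains `-(log r) / 2`, the
  -- one at `a` contributes `log (g 0)`, and the other `k - 1` at least `log (g (D / r))`. The bound
  -- `B` therefore limits `g (D / r)`.
  have key : ∀ r, 0 < r → r ≤ s ^ 2 / T →
      (k - 1) * Real.log (g (D / r)) ≤ B - Real.log (g 0) + k / 2 * Real.log r := by
    intro r hr hrT
    have hsqrt := Real.sqrt_pos.2 hr
    have hdens : ∀ y, density g (spherical a r) y = (√r)⁻¹ * g (r⁻¹ * (y 0 - a 0) ^ 2) := by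
      intro y
      rw [density, sqrt_det_spherical a hr, pow_one, quadDist_spherical a hr, dotProduct_self_one,
        Pi.sub_apply]
    obtain ⟨hle, hge⟩ := ellipticalMeasure_interval hg hG2 ha hr
    rw [← hAeq] at hle hge
    have h1 : max (2 * α) (1 / 2) ≤ (ellipticalMeasure g (spherical a r)).real
        {y | quadDist (spherical a r) y ≤ s ^ 2 / r} := by
      have := hg.isProbabilityMeasure _ (spherical_mem a hr)
      rw [← hTb, ← ellipticalMeasure_spherical hg hG2 a hr T]
      have hsub : {y | quadDist (spherical a r) y ≤ T} ⊆
          {y | quadDist (spherical a r) y ≤ s ^ 2 / r} := by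
        intro y (hy : quadDist (spherical a r) y ≤ T)
        refine le_trans hy ?_
        rw [le_div_iff₀ hr]
        rw [le_div_iff₀ hT0] at hrT
        linarith
      exact measureReal_mono hsub
    have h2 := le_max_left (2 * α) (1 / 2)
    have hsum := hB _ (spherical_mem a hr)
      (fun y => by rw [hdens]; exact mul_pos (inv_pos.2 hsqrt) (hgpos _ (by positivity)))
      (by linarith) hle
    have hlogd : ∀ u, 0 ≤ u → Real.log ((√r)⁻¹ * g u) = -(Real.log r / 2) + Real.log (g u) := by
      intro u hu
      rw [Real.log_mul (inv_pos.2 hsqrt).ne' (hgpos u hu).ne', Real.log_inv, Real.log_sqrt hr.le]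
    have hpt : ∀ i ∈ Finset.range n,
        A.indicator (fun _ => -(Real.log r / 2) + Real.log (g (D / r))) (x i) +
          (if i = i₀ then Real.log (g 0) - Real.log (g (D / r)) else 0) ≤
        A.indicator (fun y => Real.log (density g (spherical a r) y)) (x i) := by
      intro i _
      by_cases hy : x i ∈ A
      · rw [Set.indicator_of_mem hy, Set.indicator_of_mem hy, hdens, hlogd _ (by positivity)]
        split_ifs with hi
        · rw [hi, ← hadef, sub_self]
          simp
        · have h3 : r⁻¹ * (x i 0 - a 0) ^ 2 ≤ D / r := by
            rw [inv_mul_eq_div]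
            have h4 : |x i 0 - m 0| ≤ s := by rw [hAeq] at hy; exact hy
            have h5 : |x i 0 - a 0| ≤ 2 * s := by
              have := abs_sub_le (x i 0) (m 0) (a 0)
              rw [abs_sub_comm (m 0), ha] at this
              linarith
            have h6 : (x i 0 - a 0) ^ 2 ≤ D := sq_le_sq' (by linarith [(abs_le.1 h5).1])
              (abs_le.1 h5).2
            gcongr
          have h7 := Real.log_le_log (hgpos _ (by positivity)) (hg.antitoneOn
            (Set.mem_Ici.2 (by positivity)) (Set.mem_Ici.2 (by positivity)) h3)
          linarith
      · have hi : i ≠ i₀ := fun h => hy (h ▸ haA)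
        rw [Set.indicator_of_notMem hy, Set.indicator_of_notMem hy, if_neg hi, add_zero]
    have hsum2 := (Finset.sum_le_sum hpt).trans hsum
    rw [Finset.sum_add_distrib, sum_indicator_const x hn, Finset.sum_ite_eq',
      if_pos (Finset.mem_range.2 hi₀)] at hsum2
    change (-(Real.log r / 2) + Real.log (g (D / r))) * k + _ ≤ B at hsum2
    linarith
  -- With a single observation in `A`, the likelihood is unbounded as `r` tends to `0`. Otherwise
  -- the exponent `k / (2(k - 1))` exceeds `1/2`, exactly the rate required.
  rcases hk1.eq_or_lt with hk | hk
  · exfalso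
    set r := min (s ^ 2 / T) (Real.exp (2 * (-(B - Real.log (g 0)) - 1)))
    have hr : 0 < r := lt_min (by positivity) (Real.exp_pos _)
    have h1 := key r hr (min_le_left _ _)
    have h2 := Real.log_le_log hr (min_le_right _ _)
    rw [Real.log_exp] at h2
    rw [← hk] at h1
    linarith
  · have hk0 : 0 < k - 1 := by linarith
    set γ := k / 2 / (k - 1)
    have hγ : ((1 : ℕ) : ℝ) / 2 < γ := by
      rw [Nat.cast_one, lt_div_iff₀ hk0]; linarith
    set C := Real.exp ((B - Real.log (g 0)) / (k - 1) + γ * Real.log D)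
    refine polynomialDecay_of_eventually hg hG1 (C := C) hγ (R := D / (s ^ 2 / T)) (by positivity)
      fun R hR => ?_
    have hR0 : 0 < R := lt_of_lt_of_le (by positivity) hR
    have h1 := key (D / R) (by positivity) (by
      rw [div_le_iff₀ (by positivity)] at hR ⊢; linarith)
    rw [div_div_cancel₀ hD.ne', Real.log_div hD.ne' hR0.ne'] at h1
    have h2 : Real.log (g R) ≤ (B - Real.log (g 0)) / (k - 1) + γ * Real.log D + -γ * Real.log R := by
      have h3 : Real.log (g R) ≤
          (B - Real.log (g 0) + k / 2 * (Real.log D - Real.log R)) / (k - 1) := by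
        rw [le_div_iff₀ hk0]; linarith
      refine h3.trans (le_of_eq ?_)
      simp only [γ]
      ring
    calc g R = Real.exp (Real.log (g R)) := (Real.exp_log (hgpos R hR0.le)).symm
      _ ≤ Real.exp ((B - Real.log (g 0)) / (k - 1) + γ * Real.log D + -γ * Real.log R) :=
          Real.exp_le_exp.2 h2
      _ = C * R ^ (-γ) := by
          rw [Real.exp_add, Real.rpow_def_of_pos hR0, mul_comm (Real.log R)]

end OneDimensional

end Decay

/-! ### Each type of maximizer dominates the admissible competitors. -/

section Maximizers

variable {g : ℝ → ℝ} {x : ℕ → Fin p → ℝ} {n : ℕ} {A : Set (Fin p → ℝ)}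

lemma elog_of_pos {t : ℝ} (ht : 0 < t) : elog t = (Real.log t : EReal) :=
  ENNReal.log_ofReal_of_pos ht

lemma pos_of_elog_ne_bot {t : ℝ} (ht : elog t ≠ ⊥) : 0 < t := by
  by_contra h
  exact ht (by rw [elog, ENNReal.log_ofReal, if_pos (not_lt.1 h)])

lemma empiricalMean_coe {L : (Fin p → ℝ) → EReal} {l : (Fin p → ℝ) → ℝ}
    (h : ∀ i < n, L (x i) = (l (x i) : EReal)) :
    empiricalMean x n L = (((∑ i ∈ Finset.range n, l (x i)) / n : ℝ) : EReal) := by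
  have hsum : ∀ s : Finset ℕ, (∑ i ∈ s, (l (x i) : EReal)) = ((∑ i ∈ s, l (x i) : ℝ) : EReal) := by
    intro s
    induction s using Finset.cons_induction with
    | empty => simp
    | cons a s ha ih => rw [Finset.sum_cons, Finset.sum_cons, ih, EReal.coe_add]
  rw [empiricalMean, Finset.sum_congr rfl fun i hi => h i (Finset.mem_range.1 hi), hsum,
    EReal.coe_div, EReal.coe_natCast]

lemma ne_bot_of_empiricalMean_ne_bot {L : (Fin p → ℝ) → EReal} (h : empiricalMean x n L ≠ ⊥)
    {i : ℕ} (hi : i < n) : L (x i) ≠ ⊥ := by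
  intro hL
  refine h ?_
  have hn : (0 : EReal) < n := by exact_mod_cast (Nat.zero_le i).trans_lt hi
  rw [empiricalMean, ← Finset.add_sum_erase _ _ (Finset.mem_range.2 hi), hL, EReal.bot_add,
    EReal.bot_div_of_pos_ne_top hn (EReal.natCast_ne_top n)]

lemma sum_le_of_empiricalMean_le (hn : n ≠ 0) {L L' : (Fin p → ℝ) → EReal}
    {l l' : (Fin p → ℝ) → ℝ} (h : ∀ i < n, L (x i) = (l (x i) : EReal))
    (h' : ∀ i < n, L' (x i) = (l' (x i) : EReal))
    (hle : empiricalMean x n L ≤ empiricalMean x n L') :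
    ∑ i ∈ Finset.range n, l (x i) ≤ ∑ i ∈ Finset.range n, l' (x i) := by
  rw [empiricalMean_coe h, empiricalMean_coe h', EReal.coe_le_coe_iff] at hle
  have : (0 : ℝ) < n := by exact_mod_cast hn.bot_lt
  exact (div_le_div_iff_of_pos_right this).1 hle

lemma exists_notMem_of_empirical_lt_one (hn : n ≠ 0) (h : (empirical x n).real A < 1) :
    ∃ i < n, x i ∉ A := by
  by_contra! hcon
  rw [empirical_real, Finset.sum_congr rfl fun i hi =>
    Set.indicator_of_mem (hcon i (Finset.mem_range.1 hi)) _] at h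
  have hn' : (n : ℝ) ≠ 0 := by exact_mod_cast hn
  simp [hn'] at h

lemma smartLogLik_of_mem {y : Fin p → ℝ} (hy : y ∈ A) (π : ℝ) (θ : Param p) :
    smartLogLik g A π θ y = elog ((1 - π) * density g θ y) := by
  rw [smartLogLik, Set.indicator_of_mem hy, Set.indicator_of_notMem (Set.notMem_compl_iff.2 hy),
    add_zero]

lemma smartLogLik_of_notMem (hg : IsEllipticalGenerator p g) (hA : MeasurableSet A)
    {y : Fin p → ℝ} (hy : y ∉ A) (π : ℝ) {θ : Param p} (hθ : θ ∈ paramSpace p) :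
    smartLogLik g A π θ y = elog (1 - (1 - π) * (ellipticalMeasure g θ).real A) := by
  have := hg.isProbabilityMeasure θ hθ
  rw [smartLogLik, Set.indicator_of_notMem hy, Set.indicator_of_mem (Set.mem_compl hy),
    zero_add, probReal_compl_eq_one_sub hA]
  congr 1
  ring

lemma censoredLogLik_eq (g : ℝ → ℝ) (A : Set (Fin p → ℝ)) (θ : Param p) :
    censoredLogLik g A θ = smartLogLik g A 0 θ := by
  funext y
  simp [censoredLogLik, smartLogLik]

lemma smartLogLik_eq_logTerm (hg : IsEllipticalGenerator p g) (hA : MeasurableSet A) {π : ℝ}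
    (hπ : π < 1) {θ : Param p} (hθ : θ ∈ paramSpace p) {y : Fin p → ℝ}
    (hin : y ∈ A → 0 < density g θ y) (hout : 0 < 1 - (1 - π) * (ellipticalMeasure g θ).real A) :
    smartLogLik g A π θ y = (logTerm g A (1 - π) θ y : EReal) := by
  by_cases hy : y ∈ A
  · rw [smartLogLik_of_mem hy, elog_of_pos (mul_pos (by linarith) (hin hy)), logTerm,
      Set.indicator_of_mem hy, Set.indicator_of_notMem (Set.notMem_compl_iff.2 hy), add_zero]
  · rw [smartLogLik_of_notMem hg hA hy _ hθ, elog_of_pos hout, logTerm,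
      Set.indicator_of_notMem hy, Set.indicator_of_mem (Set.mem_compl hy), zero_add]

/-- The competitor has a finite log-likelihood, so no term of `(π, σ)` is `-∞`; this yields the
positivity conditions. The one outside `A` needs an observation there, hence empirical mass below
`1`. -/
lemma dominates_of_smartLogLik_le (hg : IsEllipticalGenerator p g) (hn : n ≠ 0)
    (hA : MeasurableSet A) (hlt : (empirical x n).real A < 1) {π₀ π : ℝ} {θ σ : Param p}
    (hπ₀ : π₀ < 1) (hπ : π < 1) (hθ : θ ∈ paramSpace p) (hσ : σ ∈ paramSpace p)
    (hin : ∀ i < n, x i ∈ A → 0 < density g θ (x i))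
    (hout : 0 < 1 - (1 - π₀) * (ellipticalMeasure g θ).real A)
    (hle : empiricalMean x n (smartLogLik g A π₀ θ) ≤ empiricalMean x n (smartLogLik g A π σ)) :
    Dominates g (1 - π₀) θ A x n (1 - π) σ := by
  have h0 : ∀ i < n, smartLogLik g A π₀ θ (x i) = (logTerm g A (1 - π₀) θ (x i) : EReal) :=
    fun i hi => smartLogLik_eq_logTerm hg hA hπ₀ hθ (hin i hi) hout
  have hbot : empiricalMean x n (smartLogLik g A π σ) ≠ ⊥ := by
    refine ne_bot_of_le_ne_bot ?_ hle
    rw [empiricalMean_coe h0]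
    exact EReal.coe_ne_bot _
  have hσin : ∀ i < n, x i ∈ A → 0 < density g σ (x i) := by
    intro i hi hy
    have h := ne_bot_of_empiricalMean_ne_bot hbot hi
    rw [smartLogLik_of_mem hy] at h
    exact (mul_pos_iff_of_pos_left (by linarith)).1 (pos_of_elog_ne_bot h)
  have hσout : 0 < 1 - (1 - π) * (ellipticalMeasure g σ).real A := by
    obtain ⟨i, hi, hy⟩ := exists_notMem_of_empirical_lt_one hn hlt
    have h := ne_bot_of_empiricalMean_ne_bot hbot hi
    rw [smartLogLik_of_notMem hg hA hy _ hσ] at h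
    exact pos_of_elog_ne_bot h
  exact ⟨hσ, by linarith, hσout, hσin, sum_le_of_empiricalMean_le hn h0
    (fun i hi => smartLogLik_eq_logTerm hg hA hπ hσ (hσin i hi) hσout) hle⟩

lemma IsMLEs.dominates (hg : IsEllipticalGenerator p g) (hn : n ≠ 0) (hA : MeasurableSet A)
    (hlt : (empirical x n).real A < 1) {π : ℝ} {σ : Param p} (h : IsMLEs g A x n π σ)
    {π₀ : ℝ} (hπ₀ : π₀ ∈ Set.Ico (0 : ℝ) 1) {θ : Param p} (hθ : θ ∈ paramSpace p)
    (hin : ∀ i < n, x i ∈ A → 0 < density g θ (x i))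
    (hout : 0 < 1 - (1 - π₀) * (ellipticalMeasure g θ).real A) :
    Dominates g (1 - π₀) θ A x n (1 - π) σ :=
  dominates_of_smartLogLik_le hg hn hA hlt hπ₀.2 h.1.2 hθ h.2.1 hin hout (h.2.2 π₀ hπ₀ θ hθ)

lemma IsMLEc.dominates (hg : IsEllipticalGenerator p g) (hn : n ≠ 0) (hA : MeasurableSet A)
    (hlt : (empirical x n).real A < 1) {σ : Param p} (h : IsMLEc g A x n σ)
    {θ : Param p} (hθ : θ ∈ paramSpace p)
    (hin : ∀ i < n, x i ∈ A → 0 < density g θ (x i))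
    (hout : 0 < 1 - 1 * (ellipticalMeasure g θ).real A) :
    Dominates g 1 θ A x n 1 σ := by
  have hle := h.2 θ hθ
  rw [censoredLogLik_eq, censoredLogLik_eq] at hle
  have := dominates_of_smartLogLik_le hg hn hA hlt zero_lt_one zero_lt_one hθ h.1 hin
    (by rwa [sub_zero]) hle
  rwa [sub_zero] at this

/-- Gibbs' inequality for two Bernoulli laws. -/
lemma mul_log_add_mul_log_le {m q : ℝ} (hm : 0 < m) (hm1 : m < 1) (hq : 0 < q) (hq1 : q < 1) :
    m * Real.log q + (1 - m) * Real.log (1 - q) ≤ m * Real.log m + (1 - m) * Real.log (1 - m) := by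
  have hm' : 0 < 1 - m := by linarith
  have hq' : 0 < 1 - q := by linarith
  have h1 := mul_le_mul_of_nonneg_left (Real.log_le_sub_one_of_pos (div_pos hq hm)) hm.le
  have h2 := mul_le_mul_of_nonneg_left (Real.log_le_sub_one_of_pos (div_pos hq' hm')) hm'.le
  rw [Real.log_div hq.ne' hm.ne', mul_sub m (q / m), mul_div_cancel₀ _ hm.ne'] at h1
  rw [Real.log_div hq'.ne' hm'.ne', mul_sub (1 - m) ((1 - q) / (1 - m)),
    mul_div_cancel₀ _ hm'.ne'] at h2
  linarith

lemma truncatedLogLik_eq {θ : Param p} [IsProbabilityMeasure (ellipticalMeasure g θ)]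
    (hθ : 0 < (ellipticalMeasure g θ).real A) (y : Fin p → ℝ) :
    truncatedLogLik g A θ y =
      A.indicator (fun y => elog (density g θ y / (ellipticalMeasure g θ).real A)) y := by
  rw [truncatedLogLik, if_neg]
  intro h
  rw [measureReal_def, h, ENNReal.toReal_zero] at hθ
  exact lt_irrefl _ hθ

lemma truncatedLogLik_eq_coe {θ : Param p} [IsProbabilityMeasure (ellipticalMeasure g θ)]
    (hθ : 0 < (ellipticalMeasure g θ).real A) {y : Fin p → ℝ} (hy : y ∈ A → 0 < density g θ y) :
    truncatedLogLik g A θ y = (A.indicator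
      (fun y => Real.log (density g θ y / (ellipticalMeasure g θ).real A)) y : ℝ) := by
  rw [truncatedLogLik_eq hθ]
  by_cases h : y ∈ A
  · rw [Set.indicator_of_mem h, Set.indicator_of_mem h, elog_of_pos (div_pos (hy h) hθ)]
  · rw [Set.indicator_of_notMem h, Set.indicator_of_notMem h, EReal.coe_zero]

/-- Decomposition of the smart log-likelihood into its truncated part and the log-likelihood of
the number of observations in `A`. -/
lemma sum_logTerm (hn : n ≠ 0) {w : ℝ} (hw : 0 < w) {θ : Param p}
    (hθ : 0 < (ellipticalMeasure g θ).real A) (hin : ∀ i < n, x i ∈ A → 0 < density g θ (x i)) :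
    ∑ i ∈ Finset.range n, logTerm g A w θ (x i) =
      ∑ i ∈ Finset.range n, A.indicator
        (fun y => Real.log (density g θ y / (ellipticalMeasure g θ).real A)) (x i) +
      n * ((empirical x n).real A * Real.log (w * (ellipticalMeasure g θ).real A) +
        (1 - (empirical x n).real A) * Real.log (1 - w * (ellipticalMeasure g θ).real A)) := by
  set P := (ellipticalMeasure g θ).real A
  have hpt : ∀ i ∈ Finset.range n, logTerm g A w θ (x i) =
      A.indicator (fun y => Real.log (density g θ y / P)) (x i) +
      (A.indicator (fun _ => Real.log (w * P) - Real.log (1 - w * P)) (x i) +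
        Real.log (1 - w * P)) := by
    intro i hi
    by_cases hy : x i ∈ A
    · have hd := hin i (Finset.mem_range.1 hi) hy
      rw [logTerm, Set.indicator_of_mem hy, Set.indicator_of_notMem (Set.notMem_compl_iff.2 hy),
        Set.indicator_of_mem hy, Set.indicator_of_mem hy, Real.log_mul hw.ne' hd.ne',
        Real.log_div hd.ne' hθ.ne', Real.log_mul hw.ne' hθ.ne']
      ring
    · rw [logTerm, Set.indicator_of_notMem hy, Set.indicator_of_mem (Set.mem_compl hy),
        Set.indicator_of_notMem hy, Set.indicator_of_notMem hy, zero_add, zero_add]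
  rw [Finset.sum_congr rfl hpt, Finset.sum_add_distrib, Finset.sum_add_distrib,
    sum_indicator_const x hn, Finset.sum_const, Finset.card_range, nsmul_eq_mul]
  ring

/-- By `sum_logTerm` the truncated part is maximal at `σ`, and the binomial part is maximal when the
weight times `P_σ(A)` equals the empirical mass. The weight may exceed `1`, as `Dominates` allows.
-/
lemma IsMLEr.dominates (hg : IsEllipticalGenerator p g) (hn : n ≠ 0)
    (hpos : 0 < (empirical x n).real A) (hlt : (empirical x n).real A < 1) {α : ℝ} (hα : 0 < α)
    {σ : Param p} (h : IsMLEr g α A x n σ) {w : ℝ} (hw : 0 < w) {θ : Param p}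
    (hθ : θ ∈ paramSpace p) (hθα : α ≤ (ellipticalMeasure g θ).real A)
    (hin : ∀ i < n, x i ∈ A → 0 < density g θ (x i))
    (hout : 0 < 1 - w * (ellipticalMeasure g θ).real A) :
    Dominates g w θ A x n ((empirical x n).real A / (ellipticalMeasure g σ).real A) σ := by
  have := hg.isProbabilityMeasure θ hθ
  have := hg.isProbabilityMeasure σ h.1.1
  have hPθ := hα.trans_le hθα
  have hPσ := hα.trans_le h.1.2
  have hle := h.2 θ ⟨hθ, hθα⟩
  have h0 := fun i hi => truncatedLogLik_eq_coe hPθ (hin i hi)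
  have hbot : empiricalMean x n (truncatedLogLik g A σ) ≠ ⊥ := by
    refine ne_bot_of_le_ne_bot ?_ hle
    rw [empiricalMean_coe h0]
    exact EReal.coe_ne_bot _
  have hσin : ∀ i < n, x i ∈ A → 0 < density g σ (x i) := by
    intro i hi hy
    have h := ne_bot_of_empiricalMean_ne_bot hbot hi
    rw [truncatedLogLik_eq hPσ, Set.indicator_of_mem hy] at h
    exact (div_pos_iff_of_pos_right hPσ).1 (pos_of_elog_ne_bot h)
  have hsum := sum_le_of_empiricalMean_le hn h0
    (fun i hi => truncatedLogLik_eq_coe hPσ (hσin i hi)) hle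
  have hw' := div_pos hpos hPσ
  refine ⟨h.1.1, hw', ?_, hσin, ?_⟩
  · rw [div_mul_cancel₀ _ hPσ.ne']; linarith
  · rw [sum_logTerm hn hw hPθ hin, sum_logTerm hn hw' hPσ hσin, div_mul_cancel₀ _ hPσ.ne']
    refine add_le_add hsum (mul_le_mul_of_nonneg_left ?_ (Nat.cast_nonneg n))
    exact mul_log_add_mul_log_le hpos hlt (mul_pos hw hPθ) (by linarith)

end Maximizers

/-- Competitors of weight `1` and mass at most `1/2` on `A` lose at most `log 2` per observation
outside `A`, so domination bounds their log-densities summed over `A`. -/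
lemma polynomialDecay_of_dominates {g : ℝ → ℝ} (hg : IsEllipticalGenerator 1 g) (hG1 : CondG1 g)
    (hG2 : CondG2 g) {x : ℕ → Fin 1 → ℝ} {n : ℕ} {A : Set (Fin 1 → ℝ)} (hn : n ≠ 0)
    (hA : IsMVE (empirical x n) A) {α w : ℝ} {σ : Param 1} (hα : α < 1 / 2)
    (hdom : ∀ θ ∈ paramSpace 1, α ≤ (ellipticalMeasure g θ).real A →
      (∀ i < n, x i ∈ A → 0 < density g θ (x i)) → 0 < 1 - 1 * (ellipticalMeasure g θ).real A →
      Dominates g 1 θ A x n w σ) : PolynomialDecay 1 g := by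
  refine polynomialDecay_of_bounded hg hG1 hG2 hn hA hα
    (B := ∑ i ∈ Finset.range n, logTerm g A w σ (x i) + n * Real.log 2) ?_
  intro θ hθ hpos hle hge
  have h := (hdom θ hθ hle (fun i _ _ => hpos _) (by linarith)).le
  have hpt : ∀ i ∈ Finset.range n, A.indicator (fun y => Real.log (density g θ y)) (x i) ≤
      logTerm g A 1 θ (x i) + Real.log 2 := by
    intro i _
    have h2 := Real.log_pos one_lt_two
    by_cases hy : x i ∈ A
    · rw [logTerm, Set.indicator_of_mem hy, Set.indicator_of_mem hy,
        Set.indicator_of_notMem (Set.notMem_compl_iff.2 hy), one_mul]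
      linarith
    · rw [logTerm, Set.indicator_of_notMem hy, Set.indicator_of_notMem hy,
        Set.indicator_of_mem (Set.mem_compl hy)]
      have h3 := Real.log_le_log (show (0 : ℝ) < 1 / 2 by norm_num)
        (show 1 / 2 ≤ 1 - 1 * (ellipticalMeasure g θ).real A by linarith)
      rw [one_div, Real.log_inv] at h3
      linarith
  have h4 := Finset.sum_le_sum hpt
  rw [Finset.sum_add_distrib, Finset.sum_const, Finset.card_range, nsmul_eq_mul] at h4
  linarith

/-! ### From domination to consistency. -/

section Consistency

variable {g : ℝ → ℝ} {π : ℝ} {θ : Param p} {Q : Measure (Fin p → ℝ)} {t : ℝ}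
  {x : ℕ → Fin p → ℝ} {A : ℕ → Set (Fin p → ℝ)}

lemma tendsto_empirical_mve (hp : 1 ≤ p) (hg : IsEllipticalGenerator p g) (hG2 : CondG2 g)
    (hGEM : IsGEM g π θ Q) (hπ : π < 1 / 2)
    (ht : IsPopulationLevel g π θ Q t) (hx : EmpiricalLimit x (contaminated g π θ Q))
    (hA : ∀ᶠ n in atTop, IsMVE (empirical x n) (A n)) :
    Tendsto (fun n => (empirical x n).real (A n)) atTop (𝓝 (1 / 2)) :=
  tendsto_iff_ultrafilter _ _ _ |>.2 fun _ hU =>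
    (mveLimit hp hg hG2 hGEM hπ ht hx hA hU).tendsto_empirical

lemma IsMVE.measurableSet {P : Measure (Fin p → ℝ)} {B : Set (Fin p → ℝ)} (h : IsMVE P B) :
    MeasurableSet B := by
  obtain ⟨τ, _, r, _, rfl⟩ := h.1
  exact (isClosed_ellipsoid τ r).measurableSet

/-- Consistency of any sequence of parameters that eventually dominates all competitors, at the
true contamination level and at level zero. -/
lemma tendsto_of_eventually_dominates (hp : 1 ≤ p) (hg : IsEllipticalGenerator p g)
    (hG1 : CondG1 g) (hG2 : CondG2 g) (hGp : CondGp p g) (hGEM : IsGEM g π θ Q) (hπ : π < 1 / 2)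
    (ht : IsPopulationLevel g π θ Q t) (hx : EmpiricalLimit x (contaminated g π θ Q))
    (hA : ∀ᶠ n in atTop, IsMVE (empirical x n) (A n)) {α W : ℝ} (hα : α < 1 / 2)
    {w : ℕ → ℝ} {σ : ℕ → Param p} (hW : ∀ᶠ n in atTop, w n ≤ W)
    (hdom : ∀ᶠ n in atTop, n ≠ 0 → MeasurableSet (A n) →
      0 < (empirical x n).real (A n) → (empirical x n).real (A n) < 1 →
      ∀ w₀, w₀ = 1 ∨ w₀ = 1 - π → ∀ τ ∈ paramSpace p, α ≤ (ellipticalMeasure g τ).real (A n) →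
        (∀ i < n, x i ∈ A n → 0 < density g τ (x i)) →
        0 < 1 - w₀ * (ellipticalMeasure g τ).real (A n) →
        Dominates g w₀ τ (A n) x n (w n) (σ n)) :
    Tendsto w atTop (𝓝 (1 - π)) ∧ Tendsto σ atTop (𝓝 θ) := by
  have hθ := hGEM.mem_paramSpace
  have hm := tendsto_empirical_mve hp hg hG2 hGEM hπ ht hx hA
  have hdom' : ∀ᶠ n in atTop,
      ∀ w₀, w₀ = 1 ∨ w₀ = 1 - π → ∀ τ ∈ paramSpace p, α ≤ (ellipticalMeasure g τ).real (A n) →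
        (∀ i < n, x i ∈ A n → 0 < density g τ (x i)) →
        0 < 1 - w₀ * (ellipticalMeasure g τ).real (A n) →
        Dominates g w₀ τ (A n) x n (w n) (σ n) := by
    filter_upwards [hdom, hA, eventually_ne_atTop 0,
      hm.eventually_const_lt (show (0 : ℝ) < 1 / 2 by norm_num),
      hm.eventually_lt_const (show (1 / 2 : ℝ) < 1 by norm_num)] with n h1 h2 h3 h4 h5
      using h1 h3 h2.measurableSet h4 h5
  -- Weight `1` is needed only here, in dimension one, and a single sample suffices.
  have hdecay : PolynomialDecay p g := by
    rcases hp.eq_or_lt with rfl | hp1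
    · obtain ⟨n, h1, h2, h3⟩ := (hdom'.and (hA.and (eventually_ne_atTop 0))).exists
      exact polynomialDecay_of_dominates hg hG1 hG2 h3 h2 hα (h1 1 (Or.inl rfl))
    · exact polynomialDecay_of_condGp hg hG1 hGp hp1
  obtain ⟨η, hη, c, hc, hdens⟩ := exists_density_ge hg hG2 hθ ht
  have hfin : ∀ U : Ultrafilter ℕ, (U : Filter ℕ) ≤ atTop →
      Tendsto w U (𝓝 (1 - π)) ∧ Tendsto σ U (𝓝 θ) := by
    intro U hU
    have hL := mveLimit hp hg hG2 hGEM hπ ht hx hA hU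
    -- The limit mass is `1 / (2(1 - π)) ≥ 1/2 > α`, so the truth eventually meets the level
    -- restriction.
    have hP : α < (ellipticalMeasure g θ).real {y | quadDist θ y ≤ t} := by
      have h1 := ht.measure_eq
      have h2 := mul_nonneg hGEM.nonneg
        (measureReal_nonneg (μ := ellipticalMeasure g θ) (s := {y | quadDist θ y ≤ t}))
      linarith
    refine tendsto_of_dominates hp hg hG1 hG2 hdecay hGEM hπ hU ht hx hL ?_ (hU hW)
    filter_upwards [hU hdom', hL.subset η hη,
      (hL.tendsto_outside hθ ht).eventually_const_lt (show (0 : ℝ) < 1 / 2 by norm_num),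
      (hL.tendsto_elliptical θ (fun _ => θ) hθ (Eventually.of_forall fun _ => hθ)
        tendsto_const_nhds).eventually_const_lt hP] with n h1 h2 h3 h4
    exact h1 _ (Or.inr rfl) θ hθ h4.le (fun i _ hi => hc.trans_le (hdens _ (h2 hi))) h3
  exact ⟨tendsto_iff_ultrafilter _ _ _ |>.2 fun U hU => (hfin U hU).1,
    tendsto_iff_ultrafilter _ _ _ |>.2 fun U hU => (hfin U hU).2⟩

end Consistency

end EllipticalGEM

theorem theorem3p2
    {p : ℕ} (hp : 1 ≤ p) (g : ℝ → ℝ)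
    (hg : EllipticalGEM.IsEllipticalGenerator p g)
    (hG1 : EllipticalGEM.CondG1 g) (hG2 : EllipticalGEM.CondG2 g)
    (hGp : EllipticalGEM.CondGp p g)
    (π₀ : ℝ) (hπ₀ : π₀ < 1 / 2) (θ₀ : EllipticalGEM.Param p) (Q : Measure (Fin p → ℝ))
    (hGEM : EllipticalGEM.IsGEM g π₀ θ₀ Q)
    (hMVE : ∃! A, EllipticalGEM.IsMVE (EllipticalGEM.contaminated g π₀ θ₀ Q) A)
    {Ω : Type*} [MeasurableSpace Ω] (μ : Measure Ω) [IsProbabilityMeasure μ]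
    (X : ℕ → Ω → Fin p → ℝ) (hXmeas : ∀ i, Measurable (X i)) (hXindep : iIndepFun X μ)
    (hXlaw : ∀ i, μ.map (X i) = EllipticalGEM.contaminated g π₀ θ₀ Q)
    (A : ℕ → Ω → Set (Fin p → ℝ))
    (hA : ∀ᵐ ω ∂μ, ∀ᶠ n in atTop,
      EllipticalGEM.IsMVE (EllipticalGEM.empirical (fun i => X i ω) n) (A n ω)) :
    (∀ (πs : ℕ → Ω → ℝ) (θs : ℕ → Ω → EllipticalGEM.Param p),
      (∀ᵐ ω ∂μ, ∀ᶠ n in atTop,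
        EllipticalGEM.IsMLEs g (A n ω) (fun i => X i ω) n (πs n ω) (θs n ω)) →
      ∀ᵐ ω ∂μ, Tendsto (fun n => πs n ω) atTop (𝓝 π₀) ∧
        Tendsto (fun n => θs n ω) atTop (𝓝 θ₀)) ∧
    (π₀ = 0 → ∀ θc : ℕ → Ω → EllipticalGEM.Param p,
      (∀ᵐ ω ∂μ, ∀ᶠ n in atTop,
        EllipticalGEM.IsMLEc g (A n ω) (fun i => X i ω) n (θc n ω)) →
      ∀ᵐ ω ∂μ, Tendsto (fun n => θc n ω) atTop (𝓝 θ₀)) ∧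
    (∀ α : ℝ, 0 < α → α < 1 / 2 → ∀ θr : ℕ → Ω → EllipticalGEM.Param p,
      (∀ᵐ ω ∂μ, ∀ᶠ n in atTop,
        EllipticalGEM.IsMLEr g α (A n ω) (fun i => X i ω) n (θr n ω)) →
      ∀ᵐ ω ∂μ, Tendsto (fun n => θr n ω) atTop (𝓝 θ₀) ∧
        Tendsto (fun n =>
          EllipticalGEM.inducedLevel g (A n ω) (fun i => X i ω) n (θr n ω))
          atTop (𝓝 π₀)) := by
  have hθ₀ := hGEM.mem_paramSpace
  have := hGEM.isProbabilityMeasure_contaminated hg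
  obtain ⟨t, ht⟩ := EllipticalGEM.exists_isPopulationLevel hp hg hG2 hπ₀ hGEM hMVE
  have hx := EllipticalGEM.ae_empiricalLimit μ X hXmeas hXindep hXlaw
  have hIco : ∀ w₀, w₀ = 1 ∨ w₀ = 1 - π₀ → ∃ π ∈ Set.Ico (0 : ℝ) 1, w₀ = 1 - π := by
    rintro w₀ (rfl | rfl)
    exacts [⟨0, ⟨le_rfl, one_pos⟩, (sub_zero 1).symm⟩, ⟨π₀, ⟨hGEM.nonneg, hGEM.lt_one⟩, rfl⟩]
  refine ⟨fun πs θs hs => ?_, fun hπ θc hc => ?_, fun α hα0 hα θr hr => ?_⟩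
  · filter_upwards [hx, hA, hs] with ω hxω hAω hsω
    obtain ⟨h1, h2⟩ := EllipticalGEM.tendsto_of_eventually_dominates hp hg hG1 hG2 hGp hGEM hπ₀ ht
      hxω hAω (α := 0) (W := 1) (by norm_num) (w := fun n => 1 - πs n ω) (σ := fun n => θs n ω)
      (hsω.mono fun n h => sub_le_self _ h.1.1) <| by
        filter_upwards [hsω] with n h hn hAm _ hlt w₀ hw₀ τ hτ _ hin hout
        obtain ⟨π, hπ, rfl⟩ := hIco w₀ hw₀
        exact h.dominates hg hn hAm hlt hπ hτ hin hout
    refine ⟨?_, h2⟩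
    simpa using h1.const_sub 1
  · filter_upwards [hx, hA, hc] with ω hxω hAω hcω
    refine (EllipticalGEM.tendsto_of_eventually_dominates hp hg hG1 hG2 hGp hGEM hπ₀ ht
      hxω hAω (α := 0) (W := 1) (by norm_num) (w := fun _ => 1) (σ := fun n => θc n ω)
      (Eventually.of_forall fun _ => le_rfl) ?_).2
    filter_upwards [hcω] with n h hn hAm _ hlt w₀ hw₀ τ hτ _ hin hout
    -- Since `π₀ = 0`, the two comparison weights coincide, and the censored likelihood covers both.
    obtain rfl : w₀ = 1 := by rcases hw₀ with rfl | rfl <;> simp [hπ]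
    exact h.dominates hg hn hAm hlt hτ hin hout
  · filter_upwards [hx, hA, hr] with ω hxω hAω hrω
    -- The level restriction bounds the weight `P_n(A_n) / P_σ(A_n)` by `1 / α`. Its limit `1 - π₀`
    -- gives the induced level, which is one minus the weight.
    obtain ⟨h1, h2⟩ := EllipticalGEM.tendsto_of_eventually_dominates hp hg hG1 hG2 hGp hGEM hπ₀ ht
      hxω hAω (α := α) (W := 1 / α) hα
      (w := fun n => (EllipticalGEM.empirical (fun i => X i ω) n).real (A n ω) /
        (EllipticalGEM.ellipticalMeasure g (θr n ω)).real (A n ω)) (σ := fun n => θr n ω)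
      (by
        filter_upwards [hrω, eventually_ne_atTop 0] with n h hn
        have := EllipticalGEM.isProbabilityMeasure_empirical (fun i => X i ω) hn
        exact div_le_div₀ zero_le_one measureReal_le_one hα0 h.1.2) <| by
        filter_upwards [hrω] with n h hn _ hpos hlt w₀ hw₀ τ hτ hτα hin hout
        have hw₀' : 0 < w₀ := by rcases hw₀ with rfl | rfl <;> linarith
        exact h.dominates hg hn hpos hlt hα0 hw₀' hτ hτα hin hout
    refine ⟨h2, ?_⟩
    have h3 := h1.const_sub 1
    rw [sub_sub_cancel] at h3
    refine h3.congr' ?_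
    filter_upwards [hrω] with n h
    rw [EllipticalGEM.inducedLevel, sub_div, div_self (hα0.trans_le h.1.2).ne']
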